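/- **Setting.** A *tile* is a subset of $\mathbb{R}^d$ homeomorphic to the closed unit ball, possibly carrying a label. A *partial tiling* is a set of tiles with pairwise disjoint interiors, a *patch* is a finite one, its *support* is the union of its tiles, and a *tiling* is a partial tiling with support $\mathbb{R}^d$. For a partial tiling $T$ and $U\subset\mathbb{R}^d$ let $T(U)=\{t\in T: t\cap U\ne\emptyset\}$. Let $\mathcal P$ be a nonempty finite set of labelled tiles (*prototiles*), each with the origin in its interior, whose boundaries have capacity less than $d$: there are $0\le c<d$ and $K$ such that for all $0<\varepsilon\le1$ each $\partial p$ is covered by at most $K\varepsilon^{-c}$ balls of radius $\varepsilon$. A *substitution rule* $\omega$ with expansion $\lambda>1$ assigns to each $p\in\mathcal P$ a partial tiling $\omega(p)$ by translates of prototiles with support $\lambda p$; it is extended by $\omega(p+x)=\omega(p)+\lambda x$ and $\omega(P)=\bigcup_{t\in P}\omega(t)$. The *hull* $\Omega$ is the set of tilings $T$ by translates of prototiles such that every patch in $T$ is contained in $\omega^n(p)+x$ for some $n\in\mathbb N$, $p\in\mathcal P$, $x\in\mathbb{R}^d$. Assume: * (primitivity) there is $N$ such that $\omega^N(p)$ contains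 a translate of $q$ for all $p,q\in\mathcal P$; * (finite local complexity) for every $T\in\Omega$ and $R>0$ there are, up to translation, finitely many patches $P\subset T$ whose support has diameter less than $R$; * $\omega:\Omega\to\Omega$ is injective; * ($\omega$ forces its border) there is $n$ such that for all $p\in\mathcal P$, $T,T'\in\Omega$ and $x,x'\in\mathbb{R}^d$, if $\omega^n(p)+x\subset T$ and $\omega^n(p)+x'\subset T'$, then $T(\mathrm{supp}(\omega^n(p)+x))-x=T'(\mathrm{supp}(\omega^n(p)+x'))-x'$. The *puncture* of the tile $p+x$ ($p\in\mathcal P$) is $x$. Let $\Omega_{\rm punc}$ be the set of $T\in\Omega$ that have a tile with puncture $0$, with the topology of the tiling metric $d(T,T')=\inf(\{1\}\cup\{\varepsilon:\exists\,\|x\|,\|x'\|<\varepsilon,\ (T-x)(B_{1/\varepsilon}(0))=(T'-x')(B_{1/\varepsilon}(0))\})$. Let $\mathcal R_{\rm punc}=\{(T,T+x): T,T+x\in\Omega_{\rm punc},\ x\in\mathbb R^d\}$ be the groupoid of this equivalence relation, with $r(T,T')=T$, $s(T,T')=T'$, and the topology generated by the sets of all $(T,\,T+\mathbf x_1-\mathbf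 x_2)\in\mathcal R_{\rm punc}$ with $P-\mathbf x_1\subset T$, where $P$ is a patch of a tiling in $\Omega$ and $\mathbf x_1,\mathbf x_2$ are punctures of tiles of $P$. Let $\mathcal R_n$ be the set of $(T,T-x)\in\mathcal R_{\rm punc}$ such that, writing $T=\omega^n(T_0)$ with $T_0\in\Omega$, the points $0$ and $x$ are punctures of tiles in one supertile $\omega^n(t)$, $t\in T_0$; let $\mathcal R_{AF}=\bigcup_n\mathcal R_n$. A *symmetry group* for $(\mathcal P,\omega)$ is a subgroup $G\subset O(d,\mathbb R)$ acting on the (labelled) prototiles by $p\mapsto gp$ with $\omega(gp)=g\,\omega(p)$. It acts on $\mathcal R_{\rm punc}$ by $g(T,T')=(gT,gT')$. The groupoid $\mathcal R_{\rm punc}\rtimes G$ is $\mathcal R_{\rm punc}\times G$ with the product topology ($G$ discrete), unit space $\Omega_{\rm punc}$, $r(\gamma,g)=r(\gamma)$, $s(\gamma,g)=g^{-1}s(\gamma)$, $(\gamma,g)(\xi,h)=(\gamma\cdot g\xi,\,gh)$, $(\gamma,g)^{-1}=(g^{-1}\gamma^{-1},g^{-1})$. The subgroupoid $\mathcal R_{AF}\rtimes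 G$ consists of the $(\gamma,g)$ with $\gamma\in\mathcal R_{AF}$. **Groupoid notions.** A *Cantor groupoid* is a topological groupoid $\mathscr G$ that is locally compact, Hausdorff and second countable, with $r,s$ local homeomorphisms, and whose unit space $\mathscr G^{(0)}$ is homeomorphic to the Cantor set. Subgroupoids have the same unit space. $\mathscr G$ is *principal* if an arrow is determined by its range and source, and *AF* if it is a Cantor groupoid that is the union of an increasing sequence of compact open principal Cantor subgroupoids. A *graph* is a set of arrows on which $r$ and $s$ are injective. A compact $K\subset\mathscr G^{(0)}$ is *thin* for $\mathscr G$ if for every $n$ there are compact graphs $S_1,\dots,S_n\subset\mathscr G$ with $s(S_k)=K$ and $r(S_1),\dots,r(S_n)$ pairwise disjoint. A set $E\subset\mathscr G^{(0)}$ is *invariant* if $s(\gamma)\in E$ implies $r(\gamma)\in E$, and a Borel measure $\mu$ on $\mathscr G^{(0)}$ is *invariant* if $\mu(r(S))=\mu(s(S))$ for every open graph $S$. A Cantor groupoid $\mathscr G$ is *almost AF with respect to* an open subgroupoid $\mathscr G_0$ if 1. $\mathscr G_0$ is AF, and for every compact $K\subset\mathscr G\setminus\mathscr G_0$ the set $s(K)$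 is thin for $\mathscr G_0$; and 2. for every closed invariant $E\subset\mathscr G^{(0)}$ and every nonempty relatively open $U\subset E$ there is an invariant Borel probability measure $\mu$ on $\mathscr G^{(0)}$ with $\mu(U)>0$. **Theorem.** Let $G$ be a finite symmetry group for $(\mathcal P,\omega)$ that acts freely on $\mathcal P$ (if $gp=p$ for some $p\in\mathcal P$, then $g=e$). Then $\mathcal R_{\rm punc}\rtimes G$ is an almost AF Cantor groupoid with respect to the open AF subgroupoid $\mathcal R_{AF}\rtimes G$. -/

import Mathlib

open Set

/-! ### Groupoids with unit space `X` and arrow space `Γ` -/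

/-- A groupoid, presented by its set of arrows `Γ`, its set of units `X` (identified with a subset of
`Γ` through `one`), range and source maps, a product of the pairs `(a, b)` with `s a = r b`, and
inverses. -/
structure SetGroupoid (X : Type*) (Γ : Type*) where
  r : Γ → X
  s : Γ → X
  one : X → Γ
  mul : (a b : Γ) → s a = r b → Γ
  inv : Γ → Γ
  r_one : ∀ x, r (one x) = x
  s_one : ∀ x, s (one x) = x
  r_mul : ∀ a b h, r (mul a b h) = r a
  s_mul : ∀ a b h, s (mul a b h) = s b
  r_inv : ∀ a, r (inv a) = s a
  s_inv : ∀ a, s (inv a) = r a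
  mul_assoc : ∀ a b c (hab : s a = r b) (hbc : s b = r c),
    mul (mul a b hab) c ((s_mul a b hab).trans hbc) =
      mul a (mul b c hbc) (hab.trans (r_mul b c hbc).symm)
  one_mul : ∀ a, mul (one (r a)) a (s_one (r a)) = a
  mul_one : ∀ a, mul a (one (s a)) (r_one (s a)).symm = a
  mul_inv : ∀ a, mul a (inv a) (r_inv a).symm = one (r a)
  inv_mul : ∀ a, mul (inv a) a (s_inv a) = one (s a)

namespace SetGroupoid

variable {X Γ : Type*} (𝒢 : SetGroupoid X Γ)

/-- At most one arrow between any two units. -/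
def IsPrincipal : Prop := ∀ a b, 𝒢.r a = 𝒢.r b → 𝒢.s a = 𝒢.s b → a = b

/-- A graph: a set of arrows on which both the range and the source map are injective. -/
def IsGraph (S : Set Γ) : Prop := InjOn 𝒢.r S ∧ InjOn 𝒢.s S

/-- Invariant sets of units. -/
def IsInvariant (E : Set X) : Prop := ∀ a, 𝒢.s a ∈ E → 𝒢.r a ∈ E

/-- Subgroupoids have the same unit space as the groupoid. -/
structure IsSubgroupoid (H : Set Γ) : Prop where
  one_mem : ∀ x, 𝒢.one x ∈ H
  mul_mem : ∀ a b h, a ∈ H → b ∈ H → 𝒢.mul a b h ∈ H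
  inv_mem : ∀ a, a ∈ H → 𝒢.inv a ∈ H

/-- A subgroupoid as a groupoid in its own right; its arrow space is the subtype `H`, which carries
the subspace topology. -/
def restrict {H : Set Γ} (hH : 𝒢.IsSubgroupoid H) : SetGroupoid X H where
  r a := 𝒢.r a
  s a := 𝒢.s a
  one x := ⟨𝒢.one x, hH.one_mem x⟩
  mul a b h := ⟨𝒢.mul a b h, hH.mul_mem a b h a.2 b.2⟩
  inv a := ⟨𝒢.inv a, hH.inv_mem a a.2⟩
  r_one x := 𝒢.r_one x
  s_one x := 𝒢.s_one x
  r_mul a b h := 𝒢.r_mul a b h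
  s_mul a b h := 𝒢.s_mul a b h
  r_inv a := 𝒢.r_inv a
  s_inv a := 𝒢.s_inv a
  mul_assoc a b c hab hbc := Subtype.ext (𝒢.mul_assoc a b c hab hbc)
  one_mul a := Subtype.ext (𝒢.one_mul a)
  mul_one a := Subtype.ext (𝒢.mul_one a)
  mul_inv a := Subtype.ext (𝒢.mul_inv a)
  inv_mul a := Subtype.ext (𝒢.inv_mul a)

section Topology

variable [TopologicalSpace X] [TopologicalSpace Γ]

/-- Topological groupoids. Since `r ∘ one = id`, continuity of `one` and `r` makes `one` a
homeomorphism of `X` onto the unit space inside `Γ`. -/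
structure IsTopological : Prop where
  continuous_r : Continuous 𝒢.r
  continuous_s : Continuous 𝒢.s
  continuous_one : Continuous 𝒢.one
  continuous_inv : Continuous 𝒢.inv
  continuous_mul : Continuous
    (fun p : {p : Γ × Γ // 𝒢.s p.1 = 𝒢.r p.2} => 𝒢.mul p.1.1 p.1.2 p.2)

/-- Étale groupoids: locally compact, Hausdorff, second countable, and the range and source maps are
local homeomorphisms. -/
structure IsEtale : Prop extends 𝒢.IsTopological where
  locallyCompact : LocallyCompactSpace Γ
  t2 : T2Space Γ
  secondCountable : SecondCountableTopology Γ
  isLocalHomeomorph_r : IsLocalHomeomorph 𝒢.r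
  isLocalHomeomorph_s : IsLocalHomeomorph 𝒢.s

/-- Cantor groupoids: étale, with unit space homeomorphic to the Cantor set. -/
structure IsCantor : Prop extends 𝒢.IsEtale where
  units_homeomorph : Nonempty (X ≃ₜ cantorSet)

/-- AF Cantor groupoids: Cantor groupoids that are the union of an increasing sequence of compact
open principal Cantor subgroupoids (each with the full unit space). -/
structure IsAF : Prop extends 𝒢.IsCantor where
  exists_filtration : ∃ H : ℕ → Set Γ, Monotone H ∧ ⋃ n, H n = univ ∧
    ∀ n, IsCompact (H n) ∧ IsOpen (H n) ∧
      ∃ hH : 𝒢.IsSubgroupoid (H n), (𝒢.restrict hH).IsPrincipal ∧ (𝒢.restrict hH).IsCantor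

/-- Thin compact sets of units: for every `n` there are compact graphs `S₁, …, Sₙ`, each with source
`K`, whose ranges are pairwise disjoint. -/
def IsThin (K : Set X) : Prop :=
  IsCompact K ∧ ∀ n : ℕ, ∃ S : Fin n → Set Γ,
    (∀ k, IsCompact (S k) ∧ 𝒢.IsGraph (S k) ∧ 𝒢.s '' S k = K) ∧
    Pairwise fun k l => Disjoint (𝒢.r '' S k) (𝒢.r '' S l)

/-- Invariant measures on the unit space: `μ (r(S)) = μ (s(S))` for every open graph `S`. -/
def IsInvariantMeasure [MeasurableSpace X] (μ : MeasureTheory.Measure X) : Prop :=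
  ∀ S : Set Γ, IsOpen S → 𝒢.IsGraph S → μ (𝒢.r '' S) = μ (𝒢.s '' S)

/-- For every closed invariant set `E` of units and every nonempty relatively open `U ⊆ E` there is
an invariant Borel probability measure `μ` on the unit space with `μ U > 0`. -/
def HasEnoughInvariantMeasures : Prop :=
  letI : MeasurableSpace X := borel X
  ∀ E : Set X, IsClosed E → 𝒢.IsInvariant E →
    ∀ V : Set X, IsOpen V → (V ∩ E).Nonempty →
      ∃ μ : MeasureTheory.Measure X, MeasureTheory.IsProbabilityMeasure μ ∧
        𝒢.IsInvariantMeasure μ ∧ 0 < μ (V ∩ E)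

/-- `𝒢` is an almost AF Cantor groupoid with respect to the open AF subgroupoid `H`: the source of
every compact subset of the complement of `H` is thin for `H`, and there are enough invariant
measures. -/
structure IsAlmostAFWith (H : Set Γ) : Prop extends 𝒢.IsCantor where
  isOpen : IsOpen H
  isSubgroupoid : 𝒢.IsSubgroupoid H
  isAF : (𝒢.restrict isSubgroupoid).IsAF
  thin : ∀ K : Set Γ, IsCompact K → K ⊆ Hᶜ → (𝒢.restrict isSubgroupoid).IsThin (𝒢.s '' K)
  measures : 𝒢.HasEnoughInvariantMeasures

end Topology

/-- An action of a group by automorphisms of a groupoid. -/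
structure Action (G : Type*) [Group G] where
  onUnits : G →* Equiv.Perm X
  onArrows : G →* Equiv.Perm Γ
  r_map : ∀ g a, 𝒢.r (onArrows g a) = onUnits g (𝒢.r a)
  s_map : ∀ g a, 𝒢.s (onArrows g a) = onUnits g (𝒢.s a)
  one_map : ∀ g x, 𝒢.one (onUnits g x) = onArrows g (𝒢.one x)
  inv_map : ∀ g a, 𝒢.inv (onArrows g a) = onArrows g (𝒢.inv a)
  mul_map : ∀ g a b (h : 𝒢.s a = 𝒢.r b),
    𝒢.mul (onArrows g a) (onArrows g b) (by rw [s_map, r_map, h]) = onArrows g (𝒢.mul a b h)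

lemma mul_congr {a a' b b' : Γ} (ha : a = a') (hb : b = b') (h : 𝒢.s a = 𝒢.r b) :
    𝒢.mul a b h = 𝒢.mul a' b' (by rw [← ha, ← hb, h]) := by
  subst ha hb; rfl

/-- The arrows of a semidirect product. -/
def SemidirectArrow (Γ G : Type*) : Type _ := Γ × G

/-- The product topology, where the group is discrete. -/
instance {Γ G : Type*} [TopologicalSpace Γ] : TopologicalSpace (SemidirectArrow Γ G) :=
  @instTopologicalSpaceProd Γ G _ ⊥

/-- The semidirect product: `r (γ, g) = r γ`, `s (γ, g) = g⁻¹ (s γ)`,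
`(γ, g) (ξ, h) = (γ (g ξ), g h)` and `(γ, g)⁻¹ = (g⁻¹ γ⁻¹, g⁻¹)`. -/
def semidirect {G : Type*} [Group G] (α : 𝒢.Action G) : SetGroupoid X (SemidirectArrow Γ G) where
  r a := 𝒢.r a.1
  s a := α.onUnits a.2⁻¹ (𝒢.s a.1)
  one x := (𝒢.one x, 1)
  mul a b h := (𝒢.mul a.1 (α.onArrows a.2 b.1) (by
    rw [α.r_map, ← h, map_inv]; simp), a.2 * b.2)
  inv a := (α.onArrows a.2⁻¹ (𝒢.inv a.1), a.2⁻¹)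
  r_one x := 𝒢.r_one x
  s_one x := by simp [𝒢.s_one]
  r_mul a b h := 𝒢.r_mul _ _ _
  s_mul a b h := by
    simp only [𝒢.s_mul, α.s_map, mul_inv_rev, map_mul, Equiv.Perm.mul_apply]
    simp
  r_inv a := by simp only [α.r_map, 𝒢.r_inv]
  s_inv a := by simp only [α.s_map, 𝒢.s_inv]; simp
  mul_assoc a b c hab hbc := by
    refine Prod.ext ?_ (_root_.mul_assoc _ _ _)
    have hbc' : 𝒢.s b.1 = 𝒢.r (α.onArrows b.2 c.1) := by
      rw [α.r_map, ← hbc, map_inv]; simp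
    have h1 : 𝒢.s a.1 = 𝒢.r (α.onArrows a.2 b.1) := by
      rw [α.r_map, ← hab, map_inv]; simp
    have h2 : 𝒢.s (α.onArrows a.2 b.1) = 𝒢.r (α.onArrows a.2 (α.onArrows b.2 c.1)) := by
      rw [α.s_map, α.r_map, hbc']
    refine Eq.trans ?_ ((𝒢.mul_assoc a.1 (α.onArrows a.2 b.1)
      (α.onArrows a.2 (α.onArrows b.2 c.1)) h1 h2).trans ?_)
    · exact 𝒢.mul_congr rfl (by simp) _
    · exact 𝒢.mul_congr rfl (α.mul_map _ _ _ hbc') _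
  one_mul a := by
    refine Prod.ext ?_ (_root_.one_mul _)
    exact (𝒢.mul_congr rfl (by simp) _).trans (𝒢.one_mul a.1)
  mul_one a := by
    refine Prod.ext ?_ (_root_.mul_one _)
    exact (𝒢.mul_congr rfl (by simp [← α.one_map]) _).trans (𝒢.mul_one a.1)
  mul_inv a := by
    refine Prod.ext ?_ (_root_.mul_inv_cancel _)
    exact (𝒢.mul_congr rfl (by simp) _).trans (𝒢.mul_inv a.1)
  inv_mul a := by
    refine Prod.ext ?_ (_root_.inv_mul_cancel _)
    refine (α.mul_map _ _ _ (𝒢.s_inv a.1)).trans ?_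
    rw [𝒢.inv_mul, α.one_map]

end SetGroupoid

/-! ### Substitution tilings -/

/-- A translate of a labelled prototile: the pair `(i, x)` stands for `pᵢ + x`, with puncture `x`. -/
abbrev Tile (d : ℕ) (ι : Type*) : Type _ := ι × EuclideanSpace ℝ (Fin d)

/-- The translate `P + x` of a set of tiles. -/
def translateTiles {d : ℕ} {ι : Type*} (P : Set (Tile d ι)) (x : EuclideanSpace ℝ (Fin d)) :
    Set (Tile d ι) :=
  (fun t => (t.1, t.2 + x)) '' P

/-- The subset of `ℝᵈ` covered by a tile, for prototiles of the given shapes. -/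
def tileSet {d : ℕ} {ι : Type*} (shape : ι → Set (EuclideanSpace ℝ (Fin d))) (t : Tile d ι) :
    Set (EuclideanSpace ℝ (Fin d)) :=
  (fun y => y + t.2) '' shape t.1

/-- The union of the tiles of a set of tiles. -/
def tileSupport {d : ℕ} {ι : Type*} (shape : ι → Set (EuclideanSpace ℝ (Fin d)))
    (P : Set (Tile d ι)) : Set (EuclideanSpace ℝ (Fin d)) :=
  ⋃ t ∈ P, tileSet shape t

/-- Partial tilings: distinct tiles have disjoint interiors. -/
def IsPartialTiling {d : ℕ} {ι : Type*} (shape : ι → Set (EuclideanSpace ℝ (Fin d)))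
    (P : Set (Tile d ι)) : Prop :=
  P.Pairwise fun t u => Disjoint (interior (tileSet shape t)) (interior (tileSet shape u))

/-- A substitution tiling system in `ℝᵈ` whose prototiles are labelled by `ι`. The prototiles are
homeomorphic to the closed unit ball, contain the origin in their interiors, and have boundaries of
capacity (box-counting dimension) less than `d`. -/
structure SubstitutionSystem (d : ℕ) (ι : Type*) where
  shape : ι → Set (EuclideanSpace ℝ (Fin d))
  shape_homeomorph : ∀ i,
    Nonempty (shape i ≃ₜ Metric.closedBall (0 : EuclideanSpace ℝ (Fin d)) 1)
  zero_mem_interior : ∀ i, 0 ∈ interior (shape i)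
  capacity_lt : ∃ c : ℝ, 0 ≤ c ∧ c < d ∧ ∃ K : ℝ, ∀ i, ∀ ε : ℝ, 0 < ε → ε ≤ 1 →
    ∃ C : Finset (EuclideanSpace ℝ (Fin d)), (C.card : ℝ) ≤ K * ε ^ (-c) ∧
      frontier (shape i) ⊆ ⋃ z ∈ C, Metric.ball z ε
  scale : ℝ
  one_lt_scale : 1 < scale
  /-- The substitution rule on prototiles. -/
  subst : ι → Set (Tile d ι)
  subst_isPartialTiling : ∀ i, IsPartialTiling shape (subst i)
  subst_support : ∀ i, tileSupport shape (subst i) = (fun y => scale • y) '' shape i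

namespace SubstitutionSystem

variable {d : ℕ} {ι : Type*} (S : SubstitutionSystem d ι)

/-- The substitution on sets of tiles, determined by `ω(p + x) = ω(p) + λ x`. -/
def omega (P : Set (Tile d ι)) : Set (Tile d ι) :=
  ⋃ t ∈ P, translateTiles (S.subst t.1) (S.scale • t.2)

/-- The supertile `ωⁿ(t)`. -/
def supertile (n : ℕ) (t : Tile d ι) : Set (Tile d ι) := S.omega^[n] {t}

/-- The hull `Ω`: all tilings each of whose patches is contained in a translate of some `ωⁿ(p)`. -/
def hull : Set (Set (Tile d ι)) :=
  {T | IsPartialTiling S.shape T ∧ tileSupport S.shape T = univ ∧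
    ∀ P ⊆ T, P.Finite → ∃ (i : ι) (n : ℕ) (x : EuclideanSpace ℝ (Fin d)),
      P ⊆ translateTiles (S.supertile n (i, 0)) x}

/-- `T(U)`: the tiles of `T` that intersect `U`. -/
def tilesMeeting (T : Set (Tile d ι)) (U : Set (EuclideanSpace ℝ (Fin d))) : Set (Tile d ι) :=
  {t ∈ T | (tileSet S.shape t ∩ U).Nonempty}

/-- Primitivity. -/
def IsPrimitive : Prop :=
  ∃ N : ℕ, ∀ i j : ι, ∃ x : EuclideanSpace ℝ (Fin d), (j, x) ∈ S.supertile N (i, 0)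

/-- Finite local complexity of every tiling in the hull. -/
def HasFLC : Prop :=
  ∀ T ∈ S.hull, ∀ R : ℝ, 0 < R → ∃ F : Set (Set (Tile d ι)), F.Finite ∧
    ∀ P ⊆ T, P.Finite → Metric.diam (tileSupport S.shape P) < R →
      ∃ Q ∈ F, ∃ x : EuclideanSpace ℝ (Fin d), P = translateTiles Q x

/-- The substitution forces its border. -/
def ForcesBorder : Prop :=
  ∃ n : ℕ, ∀ i : ι, ∀ T ∈ S.hull, ∀ T' ∈ S.hull, ∀ x x' : EuclideanSpace ℝ (Fin d),
    translateTiles (S.supertile n (i, 0)) x ⊆ T → translateTiles (S.supertile n (i, 0)) x' ⊆ T' →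
      translateTiles (S.tilesMeeting T
        (tileSupport S.shape (translateTiles (S.supertile n (i, 0)) x))) (-x) =
      translateTiles (S.tilesMeeting T'
        (tileSupport S.shape (translateTiles (S.supertile n (i, 0)) x'))) (-x')

/-- The tiling metric. -/
noncomputable def tilingDist (T T' : Set (Tile d ι)) : ℝ :=
  sInf ({1} ∪ {ε : ℝ | ∃ x x' : EuclideanSpace ℝ (Fin d), ‖x‖ < ε ∧ ‖x'‖ < ε ∧
    S.tilesMeeting (translateTiles T (-x)) (Metric.ball 0 (1 / ε)) =
      S.tilesMeeting (translateTiles T' (-x')) (Metric.ball 0 (1 / ε))})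

/-- The punctured hull: the tilings in the hull that have a tile with puncture at the origin. -/
def PuncturedHull : Type _ := {T : Set (Tile d ι) // T ∈ S.hull ∧ ∃ i, (i, 0) ∈ T}

/-- The topology of the tiling metric on the punctured hull. -/
instance : TopologicalSpace S.PuncturedHull where
  IsOpen U := ∀ T ∈ U, ∃ ε > 0, ∀ T', S.tilingDist T.1 T'.1 < ε → T' ∈ U
  isOpen_univ := fun _ _ => ⟨1, one_pos, fun _ _ => mem_univ _⟩
  isOpen_inter := by
    intro U V hU hV T hT
    obtain ⟨a, ha, hUa⟩ := hU T hT.1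
    obtain ⟨b, hb, hVb⟩ := hV T hT.2
    exact ⟨min a b, lt_min ha hb, fun T' h =>
      ⟨hUa T' (h.trans_le (min_le_left _ _)), hVb T' (h.trans_le (min_le_right _ _))⟩⟩
  isOpen_sUnion := by
    intro 𝒰 h𝒰 T hT
    obtain ⟨U, hU, hTU⟩ := hT
    obtain ⟨ε, hε, h⟩ := h𝒰 U hU T hTU
    exact ⟨ε, hε, fun T' hT' => ⟨U, hU, h T' hT'⟩⟩

lemma translateTiles_add (P : Set (Tile d ι)) (x y : EuclideanSpace ℝ (Fin d)) :
    translateTiles (translateTiles P x) y = translateTiles P (x + y) := by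
  simp only [translateTiles, image_image, add_assoc]

lemma translateTiles_zero (P : Set (Tile d ι)) : translateTiles P 0 = P := by
  simp [translateTiles]

/-- The arrows of `R_punc`: pairs of tilings in the punctured hull that are translates of each
other. -/
def PuncArrow : Type _ :=
  {p : S.PuncturedHull × S.PuncturedHull //
    ∃ x : EuclideanSpace ℝ (Fin d), p.2.1 = translateTiles p.1.1 x}

/-- The set `V(P, t₁, t₂)` of arrows `(T, T + x(t₁) - x(t₂))` with `P - x(t₁) ⊆ T`. -/
def basicSet (P : Set (Tile d ι)) (t₁ t₂ : Tile d ι) : Set S.PuncArrow :=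
  {γ | translateTiles P (-t₁.2) ⊆ γ.1.1.1 ∧ translateTiles P (-t₂.2) ⊆ γ.1.2.1 ∧
    γ.1.2.1 = translateTiles γ.1.1.1 (t₁.2 - t₂.2)}

/-- The topology of `R_punc`, generated by the sets `V(P, t₁, t₂)` where `P` is a patch of some
tiling in the hull and `t₁, t₂ ∈ P`. -/
instance : TopologicalSpace S.PuncArrow :=
  TopologicalSpace.generateFrom
    {V | ∃ T ∈ S.hull, ∃ P ⊆ T, P.Finite ∧ ∃ t₁ ∈ P, ∃ t₂ ∈ P, V = S.basicSet P t₁ t₂}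

/-- The groupoid `R_punc` of translational equivalence on the punctured hull. -/
def puncGroupoid : SetGroupoid S.PuncturedHull S.PuncArrow where
  r γ := γ.1.1
  s γ := γ.1.2
  one T := ⟨(T, T), 0, (translateTiles_zero _).symm⟩
  mul γ ξ h := ⟨(γ.1.1, ξ.1.2), by
    obtain ⟨x, hx⟩ := γ.2
    obtain ⟨y, hy⟩ := ξ.2
    refine ⟨x + y, ?_⟩
    rw [← translateTiles_add, ← hx]
    exact hy.trans (by rw [h])⟩
  inv γ := ⟨(γ.1.2, γ.1.1), by
    obtain ⟨x, hx⟩ := γ.2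
    refine ⟨-x, ?_⟩
    rw [hx, translateTiles_add, add_neg_cancel, translateTiles_zero]⟩
  r_one _ := rfl
  s_one _ := rfl
  r_mul _ _ _ := rfl
  s_mul _ _ _ := rfl
  r_inv _ := rfl
  s_inv _ := rfl
  mul_assoc _ _ _ _ _ := rfl
  one_mul _ := rfl
  mul_one _ := rfl
  mul_inv _ := rfl
  inv_mul _ := rfl

/-- `R_n`: the arrows `(T, T - x)` such that `0` and `x` are punctures of tiles in the same `n`-th
order supertile of the decomposition `T = ωⁿ(T₀)`, `T₀ ∈ Ω`. -/
def supertileArrows (n : ℕ) : Set S.PuncArrow :=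
  {γ | ∃ T₀ ∈ S.hull, S.omega^[n] T₀ = γ.1.1.1 ∧
    ∃ t ∈ T₀, ∃ (i j : ι) (x : EuclideanSpace ℝ (Fin d)),
      (i, 0) ∈ S.supertile n t ∧ (j, x) ∈ S.supertile n t ∧
        γ.1.2.1 = translateTiles γ.1.1.1 (-x)}

/-- `R_AF`, the union of the `R_n`. -/
def afArrows : Set S.PuncArrow := ⋃ n, S.supertileArrows n

/-! ### Symmetry groups -/

variable (G : Subgroup (EuclideanSpace ℝ (Fin d) ≃ₗᵢ[ℝ] EuclideanSpace ℝ (Fin d)))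
  [MulAction G ι]

/-- A group `G` of orthogonal transformations, acting on the labelled prototiles, is a symmetry group
if the tile labelled `g i` is the image under `g` of the tile labelled `i`, and the substitution
commutes with the action. -/
structure IsSymmetryGroup : Prop where
  shape_smul : ∀ (g : G) (i : ι), S.shape (g • i) = g.1 '' S.shape i
  subst_smul : ∀ (g : G) (i : ι),
    S.subst (g • i) = (fun t : Tile d ι => (g • t.1, g.1 t.2)) '' S.subst i

variable {G}

/-- The image `g P` of a set of tiles, where `g (p + x) = g p + g x`. -/
def act (g : G) (P : Set (Tile d ι)) : Set (Tile d ι) :=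
  (fun t => (g • t.1, g.1 t.2)) '' P

lemma act_mul (g h : G) (P : Set (Tile d ι)) : act (g * h) P = act g (act h P) := by
  simp only [act, image_image, mul_smul]
  rfl

lemma act_one (P : Set (Tile d ι)) : act (1 : G) P = P := by
  simp [act]

lemma act_translateTiles (g : G) (P : Set (Tile d ι)) (x : EuclideanSpace ℝ (Fin d)) :
    act g (translateTiles P x) = translateTiles (act g P) (g.1 x) := by
  simp only [act, translateTiles, image_image, map_add]

variable {S}

lemma tileSet_act (hG : S.IsSymmetryGroup G) (g : G) (t : Tile d ι) :
    tileSet S.shape (g • t.1, g.1 t.2) = g.1 '' tileSet S.shape t := by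
  simp only [tileSet, hG.shape_smul, image_image, map_add]

lemma omega_act (hG : S.IsSymmetryGroup G) (g : G) (P : Set (Tile d ι)) :
    S.omega (act g P) = act g (S.omega P) := by
  have h : ∀ t : Tile d ι, translateTiles (S.subst (g • t.1)) (S.scale • g.1 t.2) =
      act g (translateTiles (S.subst t.1) (S.scale • t.2)) := by
    intro t
    rw [act_translateTiles, map_smul, hG.subst_smul]
    rfl
  simp only [omega, act, biUnion_image, image_iUnion₂]
  exact iUnion₂_congr fun t _ => h t

lemma iterate_omega_act (hG : S.IsSymmetryGroup G) (g : G) (n : ℕ) (P : Set (Tile d ι)) :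
    S.omega^[n] (act g P) = act g (S.omega^[n] P) := by
  induction n with
  | zero => rfl
  | succ n ih => rw [Function.iterate_succ_apply', Function.iterate_succ_apply', ih, omega_act hG]

lemma supertile_act (hG : S.IsSymmetryGroup G) (g : G) (n : ℕ) (i : ι) :
    act g (S.supertile n (i, 0)) = S.supertile n (g • i, 0) := by
  rw [supertile, ← iterate_omega_act hG]
  simp [supertile, act]

lemma act_mem_hull (hG : S.IsSymmetryGroup G) (g : G) {T : Set (Tile d ι)} (hT : T ∈ S.hull) :
    act g T ∈ S.hull := by
  obtain ⟨h1, h2, h3⟩ := hT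
  refine ⟨?_, ?_, ?_⟩
  · rintro _ ⟨t, ht, rfl⟩ _ ⟨u, hu, rfl⟩ hne
    have hd := h1 ht hu (fun h => hne (by rw [h]))
    have key : ∀ A : Set (EuclideanSpace ℝ (Fin d)),
        interior (g.1 '' A) = g.1 '' interior A := fun A =>
      (g.1.toHomeomorph.image_interior A).symm
    simp only [tileSet_act hG, key]
    exact (disjoint_image_iff g.1.injective).2 hd
  · have : tileSupport S.shape (act g T) = g.1 '' tileSupport S.shape T := by
      simp only [tileSupport, act, biUnion_image, image_iUnion₂, tileSet_act hG]
    rw [this, h2, image_univ]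
    exact g.1.surjective.range_eq
  · intro P hP hfin
    have hsub : act g⁻¹ P ⊆ T := by
      have := image_mono (f := fun t : Tile d ι => (g⁻¹ • t.1, (g⁻¹).1 t.2)) hP
      change act g⁻¹ P ⊆ act g⁻¹ (act g T) at this
      rwa [← act_mul, inv_mul_cancel, act_one] at this
    obtain ⟨i, n, x, hx⟩ := h3 _ hsub (hfin.image _)
    refine ⟨g • i, n, g.1 x, ?_⟩
    have := image_mono (f := fun t : Tile d ι => (g • t.1, g.1 t.2)) hx
    change act g (act g⁻¹ P) ⊆ act g _ at this
    rwa [← act_mul, mul_inv_cancel, act_one, act_translateTiles, supertile_act hG] at this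

/-- The action of `G` on the punctured hull. -/
noncomputable def actHull (hG : S.IsSymmetryGroup G) : G →* Equiv.Perm S.PuncturedHull where
  toFun g :=
    { toFun := fun T => ⟨act g T.1, act_mem_hull hG g T.2.1, by
        obtain ⟨i, hi⟩ := T.2.2
        exact ⟨g • i, (i, 0), hi, by simp⟩⟩
      invFun := fun T => ⟨act g⁻¹ T.1, act_mem_hull hG g⁻¹ T.2.1, by
        obtain ⟨i, hi⟩ := T.2.2
        exact ⟨g⁻¹ • i, (i, 0), hi, by simp⟩⟩
      left_inv := fun T => Subtype.ext (by
        change act g⁻¹ (act g T.1) = T.1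
        rw [← act_mul, inv_mul_cancel, act_one])
      right_inv := fun T => Subtype.ext (by
        change act g (act g⁻¹ T.1) = T.1
        rw [← act_mul, mul_inv_cancel, act_one]) }
  map_one' := Equiv.ext fun T => Subtype.ext (act_one T.1)
  map_mul' g h := Equiv.ext fun T => Subtype.ext (act_mul g h T.1)

/-- The action `g (T, T') = (g T, g T')` of `G` on the arrows of `R_punc`. -/
noncomputable def actArrow (hG : S.IsSymmetryGroup G) : G →* Equiv.Perm S.PuncArrow where
  toFun g :=
    { toFun := fun γ => ⟨(actHull hG g γ.1.1, actHull hG g γ.1.2), by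
        obtain ⟨x, hx⟩ := γ.2
        refine ⟨g.1 x, ?_⟩
        change act g γ.1.2.1 = translateTiles (act g γ.1.1.1) (g.1 x)
        rw [hx, act_translateTiles]⟩
      invFun := fun γ => ⟨(actHull hG g⁻¹ γ.1.1, actHull hG g⁻¹ γ.1.2), by
        obtain ⟨x, hx⟩ := γ.2
        refine ⟨(g⁻¹).1 x, ?_⟩
        change act g⁻¹ γ.1.2.1 = translateTiles (act g⁻¹ γ.1.1.1) ((g⁻¹).1 x)
        rw [hx, act_translateTiles]⟩
      left_inv := fun γ => Subtype.ext (by simp)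
      right_inv := fun γ => Subtype.ext (by simp) }
  map_one' := Equiv.ext fun γ => Subtype.ext (by
    change (actHull hG 1 γ.1.1, actHull hG 1 γ.1.2) = γ.1
    simp)
  map_mul' g h := Equiv.ext fun γ => Subtype.ext (by
    change (actHull hG (g * h) γ.1.1, actHull hG (g * h) γ.1.2) =
      (actHull hG g (actHull hG h γ.1.1), actHull hG g (actHull hG h γ.1.2))
    simp)

/-- The action of `G` on the groupoid `R_punc`. -/
noncomputable def groupoidAction (hG : S.IsSymmetryGroup G) : S.puncGroupoid.Action G where
  onUnits := actHull hG
  onArrows := actArrow hG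
  r_map _ _ := rfl
  s_map _ _ := rfl
  one_map _ _ := rfl
  inv_map _ _ := rfl
  mul_map _ _ _ _ := rfl

/-- The groupoid `R_punc ⋊ G`. -/
noncomputable def puncSemidirect (hG : S.IsSymmetryGroup G) :
    SetGroupoid S.PuncturedHull (SetGroupoid.SemidirectArrow S.PuncArrow G) :=
  S.puncGroupoid.semidirect (groupoidAction hG)

variable (S G)

/-- The arrows `(γ, g)` of `R_AF ⋊ G`, i.e. those with `γ ∈ R_AF`, inside `R_punc ⋊ G`. -/
def afSemidirectArrows : Set (SetGroupoid.SemidirectArrow S.PuncArrow G) :=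
  {a | a.1 ∈ S.afArrows}

end SubstitutionSystem

/-! Arrows `(T, T + v)` are coordinatized by the range `T` and the vector `v`. Tilings in the hull
have no periods: a period `x` of `ωⁿ(T₀)` is `λⁿ` times a period of `T₀`, which for large `n` is too
short for disjoint interiors. So `v` is well defined and locally constant (`PuncArrow.vec`), the
topology of `R_punc` is that of patches of `T` together with `v`, and the étale structure follows
(`IsRegular.isOpen_iff`, `IsRegular.isCantor`). The unit space is compact because finite local
complexity lets tiles pass to ultrafilter limits, and perfect because patches recur; Brouwer's
theorem identifies it.

AF structure: compactness and injectivity of `ω` make desubstitution locally determined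
(`exists_patch_forcing`). Hence the tile `root n T` whose supertile of order `n` carries the origin
is locally constant in `T`, and an arrow lies in `R_n` exactly when the root moves by `λ⁻ⁿ v`. So
`R_n` is clopen, and compact since `v` is bounded on it. A group element acts on the label of the
root, so freeness on labels makes `R_n ⋊ G` principal.

Thinness: a source of an arrow in a compact set outside `R_AF ⋊ G` has, at bounded distance, a tile
that is in no supertile of the origin, so the origin is near the boundary of its supertiles of all
orders. Capacity `c < d` gives at most `C λ^(nc)` tiles near the boundary of `ωⁿ(p)`, against at
least a constant times `λ^(nd)` tiles in all. For large `n` a supertile has room for `N` disjoint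
copies of its boundary tiles, and moving to them gives the graphs (`IsRegular.isThin`).

Measures: by the same estimate, uniform distributions on large supertiles are almost translation
invariant. A weak limit, averaged over `G`, is invariant. All orbits are dense, so it has full
support and the closed invariant sets are trivial. -/

/-! ### Brouwer's characterization of the Cantor set -/

section Brouwer

variable {X : Type*}

/-- The cell of `x` after `n` steps of successively splitting along the sets `D`. -/
noncomputable def splitCell (D : Set X → ℕ → Set X) (x : X) : ℕ → Set X
  | 0 => univ
  | n + 1 => {y ∈ splitCell D x n | y ∈ D (splitCell D x n) n ↔ x ∈ D (splitCell D x n) n}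

/-- The cell with a given address. -/
def addressCell (D : Set X → ℕ → Set X) (f : ℕ → Bool) : ℕ → Set X
  | 0 => univ
  | n + 1 => {y ∈ addressCell D f n | y ∈ D (addressCell D f n) n ↔ f n = true}

open Classical in
/-- The address of a point. -/
noncomputable def splitAddress (D : Set X → ℕ → Set X) (x : X) (n : ℕ) : Bool :=
  decide (x ∈ D (splitCell D x n) n)

lemma mem_splitCell (D : Set X → ℕ → Set X) (x : X) (n : ℕ) : x ∈ splitCell D x n := by
  induction n with
  | zero => trivial
  | succ n ih => exact ⟨ih, Iff.rfl⟩

lemma splitCell_eq_addressCell (D : Set X → ℕ → Set X) (x : X) (n : ℕ) :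
    splitCell D x n = addressCell D (splitAddress D x) n := by
  induction n with
  | zero => rfl
  | succ n ih => simp [splitCell, addressCell, ← ih, splitAddress]

lemma splitCell_eq_of_mem (D : Set X → ℕ → Set X) {x y : X} {n : ℕ} (h : y ∈ splitCell D x n) :
    splitCell D y n = splitCell D x n := by
  induction n with
  | zero => rfl
  | succ n ih =>
    have := ih h.1
    simp only [splitCell, this]
    ext z
    simp only [mem_ofPred_eq, h.2]

lemma splitAddress_eq (D : Set X → ℕ → Set X) {f : ℕ → Bool} {x : X}
    (h : ∀ n, x ∈ addressCell D f n) : splitAddress D x = f := by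
  have key : ∀ n, splitCell D x n = addressCell D f n := by
    intro n
    induction n with
    | zero => rfl
    | succ n ih =>
      have := (h (n + 1)).2
      simp only [splitCell, addressCell, ih, this]
  funext n
  have := (h (n + 1)).2
  simp only [splitAddress, key, this, Bool.decide_eq_true]

/-- Brouwer's theorem: a nonempty compact space without isolated points in which countably many
clopen sets separate the points is homeomorphic to the Cantor set. -/
theorem nonempty_homeomorph_cantorSet [TopologicalSpace X] [CompactSpace X] [Nonempty X]
    {κ : Type*} [Countable κ] (U : κ → Set X) (hU : ∀ k, IsClopen (U k))
    (hsep : ∀ x y, x ≠ y → ∃ k, x ∈ U k ∧ y ∉ U k) (hperf : ∀ x : X, ¬ IsOpen {x}) :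
    Nonempty (X ≃ₜ cantorSet) := by
  classical
  obtain ⟨x₀⟩ := ‹Nonempty X›
  have hne : Nonempty κ := by
    by_contra hκ
    refine hperf x₀ ?_
    have : ({x₀} : Set X) = univ := by
      ext y
      simp only [mem_singleton_iff, mem_univ, iff_true]
      by_contra hy
      obtain ⟨k, -⟩ := hsep _ _ hy
      exact hκ ⟨k⟩
    rw [this]; exact isOpen_univ
  obtain ⟨e, he⟩ := exists_surjective_nat κ
  -- `D` splits `C` properly, and along `U (e k)` whenever that set splits `C`. The first property
  -- makes every address occur; the second makes addresses injective.
  have hD : ∀ (C : Set X) (k : ℕ), ∃ D : Set X, IsClopen D ∧ (IsOpen C → C.Nonempty →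
      (∃ x ∈ C, x ∈ D) ∧ (∃ x ∈ C, x ∉ D) ∧
      ∀ x ∈ C, ∀ y ∈ C, x ∈ U (e k) → y ∉ U (e k) → x ∈ D ∧ y ∉ D) := by
    intro C k
    by_cases h : ∃ x ∈ C, ∃ y ∈ C, x ∈ U (e k) ∧ y ∉ U (e k)
    · obtain ⟨x, hx, y, hy, hxU, hyU⟩ := h
      exact ⟨U (e k), hU _, fun _ _ => ⟨⟨x, hx, hxU⟩, ⟨y, hy, hyU⟩,
        fun _ _ _ _ h1 h2 => ⟨h1, h2⟩⟩⟩
    · by_cases hC : ∃ x ∈ C, ∃ y ∈ C, x ≠ y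
      · obtain ⟨x, hx, y, hy, hxy⟩ := hC
        obtain ⟨j, hj⟩ := hsep _ _ hxy
        refine ⟨U j, hU _, fun _ _ => ⟨⟨x, hx, hj.1⟩, ⟨y, hy, hj.2⟩, ?_⟩⟩
        intro x' hx' y' hy' h1 h2
        exact absurd ⟨x', hx', y', hy', h1, h2⟩ h
      · refine ⟨∅, isClopen_empty, fun hCo ⟨x, hx⟩ => ?_⟩
        push Not at hC
        exact absurd ((eq_singleton_iff_unique_mem.2 ⟨hx, fun y hy => hC y hy x hx⟩) ▸ hCo)
          (hperf x)
  choose D hDc hDs using hD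
  have hclopen : ∀ f n, IsClopen (addressCell D f n) := by
    intro f n
    induction n with
    | zero => exact isClopen_univ
    | succ n ih =>
      by_cases hf : f n = true
      · have : addressCell D f (n + 1) = addressCell D f n ∩ D (addressCell D f n) n := by
          ext y; simp [addressCell, hf]
        rw [this]; exact ih.inter (hDc _ _)
      · have : addressCell D f (n + 1) = addressCell D f n ∩ (D (addressCell D f n) n)ᶜ := by
          ext y; simp [addressCell, hf]
        rw [this]; exact ih.inter (hDc _ _).compl
  have hnonempty : ∀ f n, (addressCell D f n).Nonempty := by
    intro f n
    induction n with
    | zero => exact ⟨x₀, trivial⟩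
    | succ n ih =>
      obtain ⟨⟨x, hx, hxD⟩, ⟨y, hy, hyD⟩, -⟩ := hDs _ n (hclopen f n).isOpen ih
      by_cases hf : f n = true
      · exact ⟨x, hx, by simp [hf, hxD]⟩
      · exact ⟨y, hy, by simp [hf, hyD]⟩
  have hinj : Function.Injective (splitAddress D) := by
    intro x y hxy
    by_contra hne
    obtain ⟨k, hk⟩ := hsep _ _ hne
    obtain ⟨k, rfl⟩ := he k
    have hC : splitCell D x k = splitCell D y k := by
      rw [splitCell_eq_addressCell, splitCell_eq_addressCell, hxy]
    have hxm := mem_splitCell D x k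
    have hym := mem_splitCell D y k
    rw [← hC] at hym
    have hop : IsOpen (splitCell D x k) := by
      rw [splitCell_eq_addressCell]; exact (hclopen _ _).isOpen
    have := (hDs _ k hop ⟨x, hxm⟩).2.2 x hxm y hym hk.1 hk.2
    have h2 := congrFun hxy k
    simp [splitAddress, ← hC, this.1, this.2] at h2
  have hsurj : Function.Surjective (splitAddress D) := by
    intro f
    obtain ⟨x, hx⟩ := IsCompact.nonempty_iInter_of_sequence_nonempty_isCompact_isClosed
      (addressCell D f) (fun n => fun y hy => hy.1) (hnonempty f)
      (hclopen f 0).isClosed.isCompact (fun n => (hclopen f n).isClosed)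
    exact ⟨x, splitAddress_eq D fun n => mem_iInter.1 hx n⟩
  have hcont : Continuous (splitAddress D) := by
    refine continuous_pi fun n => ?_
    refine (IsLocallyConstant.iff_exists_open _).2 (fun x => ?_) |>.continuous
    refine ⟨splitCell D x (n + 1), ?_, mem_splitCell D x _, fun y hy => ?_⟩
    · rw [splitCell_eq_addressCell]; exact (hclopen _ _).isOpen
    · simp only [splitAddress, splitCell_eq_of_mem D hy.1, hy.2]
  exact ⟨(hcont.homeoOfEquivCompactToT2 (f := Equiv.ofBijective _ ⟨hinj, hsurj⟩)).trans
    cantorSetHomeomorphNatToBool.symm⟩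

end Brouwer

/-! ### Étale groupoids -/

lemma IsLocalHomeomorph.of_continuous_isOpenMap {X Y : Type*} [TopologicalSpace X]
    [TopologicalSpace Y] {f : X → Y} (hc : Continuous f) (ho : IsOpenMap f)
    (hinj : ∀ x, ∃ U : Set X, IsOpen U ∧ x ∈ U ∧ InjOn f U) : IsLocalHomeomorph f := by
  rw [isLocalHomeomorph_iff_isOpenEmbedding_restrict]
  intro x
  obtain ⟨U, hU, hx, hi⟩ := hinj x
  exact ⟨U, hU.mem_nhds hx, .of_continuous_injective_isOpenMap (hc.comp continuous_subtype_val)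
    (injOn_iff_injective.1 hi) (ho.comp hU.isOpenMap_subtype_val)⟩

lemma IsLocalHomeomorph.prod_discrete {X Y Z : Type*} [TopologicalSpace X] [TopologicalSpace Y]
    [DiscreteTopology Y] [TopologicalSpace Z] {f : X × Y → Z}
    (hf : ∀ y, IsLocalHomeomorph fun x => f (x, y)) : IsLocalHomeomorph f := by
  refine .of_continuous_isOpenMap (continuous_prod_of_discrete_right.2 fun y => (hf y).continuous)
    (fun U hU => ?_) fun ⟨x, y⟩ => ?_
  · have : f '' U = ⋃ y, (fun x => f (x, y)) '' ((fun x => (x, y)) ⁻¹' U) := by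
      ext z; simp only [mem_image, Prod.exists, mem_iUnion, mem_preimage]; exact exists_comm
    rw [this]
    exact isOpen_iUnion fun y => (hf y).isOpenMap _ (hU.preimage (by fun_prop))
  · obtain ⟨U, hU, he⟩ := isLocalHomeomorph_iff_isOpenEmbedding_restrict.1 (hf y) x
    obtain ⟨V, hVU, hV, hxV⟩ := mem_nhds_iff.1 hU
    refine ⟨V ×ˢ {y}, hV.prod (isOpen_discrete _), ⟨hxV, rfl⟩, ?_⟩
    rintro ⟨a, b⟩ ⟨ha, rfl⟩ ⟨a', b'⟩ ⟨ha', rfl⟩ h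
    exact Prod.ext (injOn_iff_injective.2 he.injective (hVU ha) (hVU ha') h) rfl

namespace SetGroupoid

variable {X Γ : Type*} {𝒢 : SetGroupoid X Γ} [TopologicalSpace X] [TopologicalSpace Γ]

lemma IsTopological.restrict (h : 𝒢.IsTopological) {H : Set Γ} (hH : 𝒢.IsSubgroupoid H) :
    (𝒢.restrict hH).IsTopological where
  continuous_r := h.continuous_r.comp continuous_subtype_val
  continuous_s := h.continuous_s.comp continuous_subtype_val
  continuous_one := h.continuous_one.subtype_mk _
  continuous_inv := (h.continuous_inv.comp continuous_subtype_val).subtype_mk _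
  continuous_mul := by
    refine Continuous.subtype_mk (h.continuous_mul.comp
      (f := fun p : {p : H × H // 𝒢.s p.1 = 𝒢.r p.2} => ⟨(p.1.1.1, p.1.2.1), p.2⟩) ?_) _
    fun_prop

lemma IsEtale.restrict (h : 𝒢.IsEtale) {H : Set Γ} (hH : 𝒢.IsSubgroupoid H) (ho : IsOpen H) :
    (𝒢.restrict hH).IsEtale where
  toIsTopological := h.toIsTopological.restrict hH
  locallyCompact := by
    have := h.locallyCompact
    exact ho.locallyCompactSpace
  t2 := by have := h.t2; infer_instance
  secondCountable := by have := h.secondCountable; infer_instance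
  isLocalHomeomorph_r := h.isLocalHomeomorph_r.comp ho.isOpenEmbedding_subtypeVal.isLocalHomeomorph
  isLocalHomeomorph_s := h.isLocalHomeomorph_s.comp ho.isOpenEmbedding_subtypeVal.isLocalHomeomorph

lemma IsCantor.restrict (h : 𝒢.IsCantor) {H : Set Γ} (hH : 𝒢.IsSubgroupoid H) (ho : IsOpen H) :
    (𝒢.restrict hH).IsCantor :=
  ⟨h.toIsEtale.restrict hH ho, h.units_homeomorph⟩

/-- An open subgroupoid of a Cantor groupoid that is the increasing union of compact open principal
subgroupoids is AF. -/
lemma IsCantor.isAF_restrict (h : 𝒢.IsCantor) {H : Set Γ} (hH : 𝒢.IsSubgroupoid H)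
    (K : ℕ → Set Γ) (hmono : Monotone K) (hunion : H = ⋃ n, K n)
    (hc : ∀ n, IsCompact (K n)) (ho : ∀ n, IsOpen (K n)) (hK : ∀ n, 𝒢.IsSubgroupoid (K n))
    (hp : ∀ n, ∀ a ∈ K n, ∀ b ∈ K n, 𝒢.r a = 𝒢.r b → 𝒢.s a = 𝒢.s b → a = b) :
    (𝒢.restrict hH).IsAF := by
  have hHo : IsOpen H := hunion ▸ isOpen_iUnion ho
  have hKH : ∀ n, K n ⊆ H := fun n => hunion ▸ subset_iUnion K n
  refine ⟨h.restrict hH hHo, fun n => Subtype.val ⁻¹' K n, fun m n hmn a ha => hmono hmn ha, ?_, ?_⟩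
  · rw [← preimage_iUnion, ← hunion]
    exact Subtype.coe_preimage_self H
  · intro n
    have hsub : (𝒢.restrict hH).IsSubgroupoid (Subtype.val ⁻¹' K n) :=
      ⟨fun x => (hK n).one_mem x, fun a b h ha hb => (hK n).mul_mem a b h ha hb,
        fun a ha => (hK n).inv_mem a ha⟩
    have hon : IsOpen (Subtype.val ⁻¹' K n : Set H) := (ho n).preimage continuous_subtype_val
    refine ⟨?_, hon, hsub, ?_, (h.restrict hH hHo).restrict hsub hon⟩
    · rw [Subtype.isCompact_iff, Subtype.image_preimage_coe, inter_eq_right.2 (hKH n)]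
      exact hc n
    · rintro ⟨⟨a, haH⟩, ha⟩ ⟨⟨b, hbH⟩, hb⟩ h1 h2
      exact Subtype.ext (Subtype.ext (hp n a ha b hb h1 h2))

variable {G : Type*} [Group G]

lemma IsEtale.semidirect [Countable G] (h : 𝒢.IsEtale) (α : 𝒢.Action G)
    (hα : ∀ g, Continuous (α.onArrows g)) : (𝒢.semidirect α).IsEtale := by
  let : TopologicalSpace G := ⊥
  have : DiscreteTopology G := ⟨rfl⟩
  -- Continuity on units follows from continuity on arrows by acting on identity arrows.
  have hunit : ∀ g, Continuous (α.onUnits g) := by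
    intro g
    have : ⇑(α.onUnits g) = 𝒢.r ∘ α.onArrows g ∘ 𝒢.one := by
      funext x; simp [α.r_map, 𝒢.r_one]
    rw [this]
    exact h.continuous_r.comp ((hα g).comp h.continuous_one)
  have hunit' : ∀ g, IsLocalHomeomorph (α.onUnits g) := fun g =>
    (Homeomorph.mk (α.onUnits g) (hunit g) (by
      have := hunit g⁻¹
      rwa [map_inv] at this)).isLocalHomeomorph
  have hr : IsLocalHomeomorph (fun a : Γ × G => 𝒢.r a.1) :=
    .prod_discrete fun g => h.isLocalHomeomorph_r
  have hs : IsLocalHomeomorph (fun a : Γ × G => α.onUnits a.2⁻¹ (𝒢.s a.1)) :=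
    .prod_discrete fun g => (hunit' g⁻¹).comp h.isLocalHomeomorph_s
  have hact : Continuous (fun a : Γ × G => α.onArrows a.2 a.1) :=
    continuous_prod_of_discrete_right.2 hα
  have hact' : Continuous (fun a : Γ × G => α.onArrows a.2⁻¹ a.1) :=
    continuous_prod_of_discrete_right.2 fun g => hα g⁻¹
  have := h.locallyCompact
  have := h.t2
  have := h.secondCountable
  exact
    { continuous_r := hr.continuous
      continuous_s := hs.continuous
      continuous_one := Continuous.prodMk h.continuous_one continuous_const
      continuous_inv := by
        change Continuous fun a : Γ × G => (α.onArrows a.2⁻¹ (𝒢.inv a.1), a.2⁻¹)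
        refine Continuous.prodMk
          (hact'.comp (f := fun a : Γ × G => (𝒢.inv a.1, a.2)) ?_) ?_
        · exact Continuous.prodMk (h.continuous_inv.comp continuous_fst) continuous_snd
        · exact continuous_of_discreteTopology.comp continuous_snd
      continuous_mul := by
        have key : ∀ p : {p : (Γ × G) × (Γ × G) //
            α.onUnits p.1.2⁻¹ (𝒢.s p.1.1) = 𝒢.r p.2.1},
            𝒢.s p.1.1.1 = 𝒢.r (α.onArrows p.1.1.2 p.1.2.1) := fun p => by
          rw [α.r_map, ← p.2, map_inv]; simp
        change Continuous fun p : {p : (Γ × G) × (Γ × G) //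
            α.onUnits p.1.2⁻¹ (𝒢.s p.1.1) = 𝒢.r p.2.1} =>
          (𝒢.mul p.1.1.1 (α.onArrows p.1.1.2 p.1.2.1) (key p), p.1.1.2 * p.1.2.2)
        refine Continuous.prodMk (h.continuous_mul.comp
          (f := fun p => ⟨(p.1.1.1, α.onArrows p.1.1.2 p.1.2.1), key p⟩) ?_) ?_
        · refine Continuous.subtype_mk (Continuous.prodMk (by fun_prop) ?_) _
          exact hact.comp (f := fun p : {p : (Γ × G) × (Γ × G) //
            α.onUnits p.1.2⁻¹ (𝒢.s p.1.1) = 𝒢.r p.2.1} => (p.1.2.1, p.1.1.2)) (by fun_prop)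
        · exact (continuous_of_discreteTopology (f := fun q : G × G => q.1 * q.2)).comp
            (f := fun p : {p : (Γ × G) × (Γ × G) //
            α.onUnits p.1.2⁻¹ (𝒢.s p.1.1) = 𝒢.r p.2.1} => (p.1.1.2, p.1.2.2)) (by fun_prop)
      locallyCompact := inferInstanceAs (LocallyCompactSpace (Γ × G))
      t2 := inferInstanceAs (T2Space (Γ × G))
      secondCountable := inferInstanceAs (SecondCountableTopology (Γ × G))
      isLocalHomeomorph_r := hr
      isLocalHomeomorph_s := hs }

end SetGroupoid

/-! ### Geometry of tiles and partial tilings -/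

section Tiles

variable {d : ℕ} {ι : Type*} {shape : ι → Set (EuclideanSpace ℝ (Fin d))}

lemma mem_translateTiles {P : Set (Tile d ι)} {x : EuclideanSpace ℝ (Fin d)} {t : Tile d ι} :
    t ∈ translateTiles P x ↔ (t.1, t.2 - x) ∈ P := by
  constructor
  · rintro ⟨u, hu, rfl⟩
    simpa using hu
  · intro h
    exact ⟨_, h, by simp⟩

lemma translateTiles_mono {P Q : Set (Tile d ι)} (h : P ⊆ Q) (x : EuclideanSpace ℝ (Fin d)) :
    translateTiles P x ⊆ translateTiles Q x := image_mono h

lemma translateTiles_subset_iff {P Q : Set (Tile d ι)} {x : EuclideanSpace ℝ (Fin d)} :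
    translateTiles P x ⊆ Q ↔ P ⊆ translateTiles Q (-x) := by
  constructor
  · intro h t ht
    rw [mem_translateTiles]
    exact h (mem_translateTiles.2 (by simpa using ht))
  · rintro h _ ⟨t, ht, rfl⟩
    have := mem_translateTiles.1 (h ht)
    simpa using this

lemma mem_tileSet {t : Tile d ι} {y : EuclideanSpace ℝ (Fin d)} :
    y ∈ tileSet shape t ↔ y - t.2 ∈ shape t.1 := by
  constructor
  · rintro ⟨z, hz, rfl⟩
    simpa using hz
  · intro h
    exact ⟨_, h, by simp⟩

lemma tileSet_eq_preimage (t : Tile d ι) :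
    tileSet shape t = (Homeomorph.subRight t.2) ⁻¹' shape t.1 := by
  ext y; rw [mem_tileSet]; rfl

lemma mem_interior_tileSet {t : Tile d ι} {y : EuclideanSpace ℝ (Fin d)} :
    y ∈ interior (tileSet shape t) ↔ y - t.2 ∈ interior (shape t.1) := by
  rw [tileSet_eq_preimage, ← Homeomorph.preimage_interior]; rfl

lemma mem_tileSupport {P : Set (Tile d ι)} {y : EuclideanSpace ℝ (Fin d)} :
    y ∈ tileSupport shape P ↔ ∃ t ∈ P, y ∈ tileSet shape t := by
  simp [tileSupport]

lemma mem_tileSupport_translate {P : Set (Tile d ι)} {x y : EuclideanSpace ℝ (Fin d)} :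
    y ∈ tileSupport shape (translateTiles P x) ↔ y - x ∈ tileSupport shape P := by
  simp only [mem_tileSupport, mem_tileSet]
  constructor
  · rintro ⟨_, ⟨t, ht, rfl⟩, h⟩
    exact ⟨t, ht, by simpa [sub_sub, add_comm] using h⟩
  · rintro ⟨t, ht, h⟩
    exact ⟨_, ⟨t, ht, rfl⟩, by simpa [sub_sub, add_comm] using h⟩

lemma IsPartialTiling.mono {P Q : Set (Tile d ι)} (hQ : IsPartialTiling shape Q) (h : P ⊆ Q) :
    IsPartialTiling shape P := Set.Pairwise.mono h hQ

lemma IsPartialTiling.eq_of_mem_interior {P : Set (Tile d ι)} (hP : IsPartialTiling shape P)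
    {t u : Tile d ι} (ht : t ∈ P) (hu : u ∈ P) {y : EuclideanSpace ℝ (Fin d)}
    (hyt : y ∈ interior (tileSet shape t)) (hyu : y ∈ interior (tileSet shape u)) : t = u := by
  by_contra hne
  exact Set.disjoint_left.1 (hP ht hu hne) hyt hyu

lemma IsPartialTiling.translate {P : Set (Tile d ι)} (hP : IsPartialTiling shape P)
    (x : EuclideanSpace ℝ (Fin d)) : IsPartialTiling shape (translateTiles P x) := by
  rintro _ ⟨t, ht, rfl⟩ _ ⟨u, hu, rfl⟩ hne
  refine Set.disjoint_left.2 fun y hy hy' => hne ?_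
  rw [hP.eq_of_mem_interior ht hu (y := y - x)]
  · rw [mem_interior_tileSet] at hy ⊢
    simpa [sub_sub, add_comm] using hy
  · rw [mem_interior_tileSet] at hy' ⊢
    simpa [sub_sub, add_comm] using hy'

/-- A finite form of Baire's theorem: if `U` is not inside one of the closed sets, removing that set
leaves a nonempty open set covered by the others. -/
lemma exists_interior_inter_nonempty {X : Type*} [TopologicalSpace X] {κ : Type*} {s : Set κ}
    (hs : s.Finite) (f : κ → Set X) (hf : ∀ i ∈ s, IsClosed (f i)) {U : Set X} (hU : IsOpen U)
    (hne : U.Nonempty) (hsub : U ⊆ ⋃ i ∈ s, f i) : ∃ i ∈ s, (interior (f i) ∩ U).Nonempty := by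
  induction s, hs using Set.Finite.induction_on generalizing U with
  | empty => obtain ⟨x, hx⟩ := hne; simpa using hsub hx
  | @insert a s _ _ ih =>
    by_cases h : U ⊆ f a
    · obtain ⟨x, hx⟩ := hne
      exact ⟨a, mem_insert _ _, x, mem_interior.2 ⟨U, h, hU, hx⟩, hx⟩
    · obtain ⟨x, hx, hxa⟩ := not_subset.1 h
      obtain ⟨i, hi, y, hy, hyU⟩ := ih (fun i hi => hf i (mem_insert_of_mem _ hi))
        (hU.sdiff (hf a (mem_insert _ _))) ⟨x, hx, hxa⟩ (by
          rintro y ⟨hy, hya⟩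
          have := hsub hy
          rw [biUnion_insert] at this
          exact this.resolve_left hya)
      exact ⟨i, mem_insert_of_mem _ hi, y, hy, hyU.1⟩

end Tiles

namespace SubstitutionSystem

lemma dim_pos {d : ℕ} {ι : Type*} (S : SubstitutionSystem d ι) : 0 < d := by
  obtain ⟨c, h0, hc, -⟩ := S.capacity_lt
  exact_mod_cast h0.trans_lt hc

variable {d : ℕ} {ι : Type*} (S : SubstitutionSystem d ι)

lemma scale_pos : 0 < S.scale := one_pos.trans S.one_lt_scale

lemma scale_ne : S.scale ≠ 0 := S.scale_pos.ne'

lemma scale_pow_pos (n : ℕ) : 0 < S.scale ^ n := pow_pos S.scale_pos n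

lemma scale_pow_ne (n : ℕ) : S.scale ^ n ≠ 0 := (S.scale_pow_pos n).ne'

lemma one_le_scale_pow (n : ℕ) : 1 ≤ S.scale ^ n := one_le_pow₀ S.one_lt_scale.le

lemma shape_isCompact (i : ι) : IsCompact (S.shape i) := by
  obtain ⟨e⟩ := S.shape_homeomorph i
  have := isCompact_iff_compactSpace.1
    (isCompact_closedBall (0 : EuclideanSpace ℝ (Fin d)) 1)
  exact isCompact_iff_compactSpace.2 e.symm.compactSpace

lemma tileSet_isClosed (t : Tile d ι) : IsClosed (tileSet S.shape t) := by
  rw [tileSet_eq_preimage]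
  exact (S.shape_isCompact _).isClosed.preimage (Homeomorph.continuous _)

lemma mem_interior_tileSet_self (t : Tile d ι) : t.2 ∈ interior (tileSet S.shape t) := by
  rw [mem_interior_tileSet, sub_self]
  exact S.zero_mem_interior _

lemma mem_tileSet_self (t : Tile d ι) : t.2 ∈ tileSet S.shape t :=
  interior_subset (S.mem_interior_tileSet_self t)

lemma eq_of_snd_eq {P : Set (Tile d ι)} (hP : IsPartialTiling S.shape P)
    {t u : Tile d ι} (ht : t ∈ P) (hu : u ∈ P) (h : t.2 = u.2) : t = u :=
  hP.eq_of_mem_interior ht hu (S.mem_interior_tileSet_self t) (h ▸ S.mem_interior_tileSet_self u)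

/-! ### Inner and outer radii of tiles; packing and covering. -/

section Radii

variable [Finite ι]

lemma exists_inradius : ∃ r : ℝ, 0 < r ∧ ∀ i, Metric.ball 0 r ⊆ interior (S.shape i) := by
  have : ∀ i, ∃ r : ℝ, 0 < r ∧ Metric.ball 0 r ⊆ interior (S.shape i) := fun i =>
    Metric.isOpen_iff.1 isOpen_interior _ (S.zero_mem_interior i)
  choose r hr hb using this
  cases isEmpty_or_nonempty ι
  · exact ⟨1, one_pos, fun i => isEmptyElim i⟩
  · obtain ⟨i, hi⟩ := Finite.exists_min r
    exact ⟨r i, hr i, fun j => (Metric.ball_subset_ball (hi j)).trans (hb j)⟩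

lemma exists_outradius : ∃ D : ℝ, 0 < D ∧ ∀ i, S.shape i ⊆ Metric.closedBall 0 D := by
  obtain ⟨D, hD⟩ := (isCompact_iUnion S.shape_isCompact).isBounded.subset_closedBall
    (0 : EuclideanSpace ℝ (Fin d))
  exact ⟨max D 1, by positivity, fun i => (subset_iUnion _ i).trans
    (hD.trans (Metric.closedBall_subset_closedBall (le_max_left _ _)))⟩

/-- A radius of balls about the punctures contained in the interiors of the tiles. -/
noncomputable def inradius : ℝ := S.exists_inradius.choose

/-- A radius of balls about the punctures containing the tiles. -/
noncomputable def outradius : ℝ := S.exists_outradius.choose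

lemma inradius_pos : 0 < S.inradius := S.exists_inradius.choose_spec.1

lemma outradius_pos : 0 < S.outradius := S.exists_outradius.choose_spec.1

variable {S}

lemma mem_interior_of_dist_lt {t : Tile d ι} {y : EuclideanSpace ℝ (Fin d)}
    (h : dist y t.2 < S.inradius) : y ∈ interior (tileSet S.shape t) := by
  rw [mem_interior_tileSet]
  exact S.exists_inradius.choose_spec.2 _ (by rwa [mem_ball_zero_iff, ← dist_eq_norm])

lemma dist_le_outradius {t : Tile d ι} {y : EuclideanSpace ℝ (Fin d)}
    (h : y ∈ tileSet S.shape t) : dist y t.2 ≤ S.outradius := by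
  have := S.exists_outradius.choose_spec.2 _ (mem_tileSet.1 h)
  rwa [mem_closedBall_zero_iff, ← dist_eq_norm] at this

lemma eq_of_dist_lt {P : Set (Tile d ι)} (hP : IsPartialTiling S.shape P)
    {t u : Tile d ι} (ht : t ∈ P) (hu : u ∈ P) (h : dist t.2 u.2 < S.inradius) : t = u :=
  hP.eq_of_mem_interior ht hu (S.mem_interior_tileSet_self t) (mem_interior_of_dist_lt h)

variable (S)

open MeasureTheory in
/-- The number of tiles with puncture in a ball is bounded in terms of the radius. -/
lemma exists_card_le (R : ℝ) : ∃ M : ℕ, ∀ P : Set (Tile d ι), IsPartialTiling S.shape P →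
    ∀ (z : EuclideanSpace ℝ (Fin d)) (Q : Finset (Tile d ι)), ↑Q ⊆ P →
      (∀ t ∈ Q, dist t.2 z ≤ R) → Q.card ≤ M := by
  set r := S.inradius
  have hr : 0 < r := S.inradius_pos
  set v := volume (Metric.ball (0 : EuclideanSpace ℝ (Fin d)) r)
  have hv : v ≠ 0 := (Metric.measure_ball_pos _ _ hr).ne'
  have hv' : v ≠ ⊤ := measure_ball_lt_top.ne
  set w := volume (Metric.ball (0 : EuclideanSpace ℝ (Fin d)) (R + r))
  have hw' : w ≠ ⊤ := measure_ball_lt_top.ne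
  -- Balls of radius `r` about the punctures are disjoint and lie in a ball of radius `R + r`;
  -- compare volumes.
  refine ⟨⌊(w / v).toReal⌋₊, fun P hP z Q hQ hz => Nat.le_floor ?_⟩
  have h1 : (Q.card : ENNReal) * v ≤ w := by
    calc (Q.card : ENNReal) * v = ∑ t ∈ Q, volume (Metric.ball t.2 r) := by
          rw [Finset.sum_congr rfl fun t _ => Measure.addHaar_ball_center volume t.2 r]
          simp [v]
      _ = volume (⋃ t ∈ Q, Metric.ball t.2 r) := by
          refine (measure_biUnion_finset ?_ fun _ _ => measurableSet_ball).symm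
          intro t ht u hu hne
          refine Set.disjoint_left.2 fun y hy hy' => hne ?_
          exact hP.eq_of_mem_interior (hQ ht) (hQ hu) (mem_interior_of_dist_lt hy)
            (mem_interior_of_dist_lt hy')
      _ ≤ volume (Metric.ball z (R + r)) := by
          refine measure_mono (iUnion₂_subset fun t ht => ?_)
          refine Metric.ball_subset_ball' ?_
          linarith [hz t ht]
      _ = w := Measure.addHaar_ball_center volume z _
  have h2 : (Q.card : ENNReal) ≤ w / v := by
    rwa [ENNReal.le_div_iff_mul_le (Or.inl hv) (Or.inl hv')]
  have := ENNReal.toReal_mono (ENNReal.div_ne_top hw' hv) h2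
  simpa using this

variable {S}

lemma finite_of_dist_le {P : Set (Tile d ι)} (hP : IsPartialTiling S.shape P)
    (z : EuclideanSpace ℝ (Fin d)) (R : ℝ) : {t ∈ P | dist t.2 z ≤ R}.Finite := by
  obtain ⟨M, hM⟩ := S.exists_card_le R
  by_contra hinf
  obtain ⟨Q, hQ, hc⟩ := Set.Infinite.exists_subset_card_eq hinf (M + 1)
  have := hM P hP z Q (fun t ht => (hQ ht).1) (fun t ht => (hQ ht).2)
  omega

/-- Near a point of `V` only finitely many closed tiles of `Q` do the covering, so one of them has
interior meeting `V`, hence meeting the interior of `t`; in a partial tiling it must be `t`. -/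
lemma mem_of_open_subset_support {T Q : Set (Tile d ι)} (hT : IsPartialTiling S.shape T)
    (hQ : Q ⊆ T) {t : Tile d ι} (ht : t ∈ T) {V : Set (EuclideanSpace ℝ (Fin d))} (hV : IsOpen V)
    (hne : V.Nonempty) (hVt : V ⊆ interior (tileSet S.shape t))
    (hVQ : V ⊆ tileSupport S.shape Q) : t ∈ Q := by
  obtain ⟨w, hw⟩ := hne
  have hfin := finite_of_dist_le (hT.mono hQ) w (S.outradius + 1)
  obtain ⟨q, hq, y, hyq, hy⟩ := exists_interior_inter_nonempty hfin (tileSet S.shape)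
    (fun _ _ => S.tileSet_isClosed _) (hV.inter Metric.isOpen_ball)
    ⟨w, hw, Metric.mem_ball_self one_pos⟩ (by
      rintro y ⟨hyV, hyw⟩
      obtain ⟨q, hq, hyq⟩ := mem_tileSupport.1 (hVQ hyV)
      refine mem_iUnion₂.2 ⟨q, ⟨hq, ?_⟩, hyq⟩
      have h1 := dist_le_outradius hyq
      have h2 := dist_triangle_left q.2 w y
      rw [Metric.mem_ball] at hyw
      linarith)
  rw [hT.eq_of_mem_interior ht (hQ hq.1) (hVt hy.1) hyq]
  exact hq.1

lemma mem_of_interior_subset_support {T Q : Set (Tile d ι)} (hT : IsPartialTiling S.shape T)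
    (hQ : Q ⊆ T) {t : Tile d ι} (ht : t ∈ T)
    (hVQ : interior (tileSet S.shape t) ⊆ tileSupport S.shape Q) : t ∈ Q :=
  mem_of_open_subset_support hT hQ ht isOpen_interior ⟨_, S.mem_interior_tileSet_self t⟩
    Subset.rfl hVQ

/-- Tilings are maximal among partial tilings, so to identify two tilings one inclusion suffices. -/
lemma eq_of_subset_of_support {T Q : Set (Tile d ι)} (hT : IsPartialTiling S.shape T)
    (hQ : Q ⊆ T) (hs : tileSupport S.shape Q = univ) : Q = T :=
  hQ.antisymm fun _ ht => mem_of_interior_subset_support hT hQ ht (hs ▸ subset_univ _)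

end Radii

/-! ### The substitution -/

variable {S}

lemma mem_omega {P : Set (Tile d ι)} {u : Tile d ι} :
    u ∈ S.omega P ↔ ∃ t ∈ P, (u.1, u.2 - S.scale • t.2) ∈ S.subst t.1 := by
  simp only [omega, mem_iUnion, mem_translateTiles, exists_prop]

lemma omega_mono {P Q : Set (Tile d ι)} (h : P ⊆ Q) : S.omega P ⊆ S.omega Q :=
  biUnion_mono h fun _ _ => Subset.rfl

lemma omega_translateTiles (P : Set (Tile d ι)) (x : EuclideanSpace ℝ (Fin d)) :
    S.omega (translateTiles P x) = translateTiles (S.omega P) (S.scale • x) := by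
  ext u
  simp only [mem_omega, mem_translateTiles]
  constructor
  · rintro ⟨t, ht, hu⟩
    exact ⟨_, ht, by simpa [smul_sub, sub_sub] using hu⟩
  · rintro ⟨t, ht, hu⟩
    exact ⟨(t.1, t.2 + x), by simpa using ht, by
      simpa [smul_add, sub_sub, add_comm] using hu⟩

lemma iterate_omega_translateTiles (n : ℕ) (P : Set (Tile d ι)) (x : EuclideanSpace ℝ (Fin d)) :
    S.omega^[n] (translateTiles P x) = translateTiles (S.omega^[n] P) (S.scale ^ n • x) := by
  induction n with
  | zero => simp
  | succ n ih =>
    rw [Function.iterate_succ_apply', Function.iterate_succ_apply', ih, omega_translateTiles,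
      smul_smul, pow_succ']

lemma iterate_omega_eq (n : ℕ) (P : Set (Tile d ι)) :
    S.omega^[n] P = ⋃ t ∈ P, S.supertile n t := by
  induction n with
  | zero => simp [supertile]
  | succ n ih =>
    simp only [supertile, Function.iterate_succ_apply'] at ih ⊢
    rw [ih]
    ext u
    simp only [mem_omega, mem_iUnion]
    tauto

lemma mem_iterate_omega {n : ℕ} {P : Set (Tile d ι)} {u : Tile d ι} :
    u ∈ S.omega^[n] P ↔ ∃ t ∈ P, u ∈ S.supertile n t := by
  rw [iterate_omega_eq]; simp

lemma supertile_subset_iterate {n : ℕ} {P : Set (Tile d ι)} {t : Tile d ι} (ht : t ∈ P) :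
    S.supertile n t ⊆ S.omega^[n] P := fun _ hu => mem_iterate_omega.2 ⟨t, ht, hu⟩

lemma supertile_add (m n : ℕ) (t : Tile d ι) :
    S.supertile (m + n) t = S.omega^[m] (S.supertile n t) := by
  rw [supertile, Function.iterate_add_apply]; rfl

lemma supertile_eq_translate (n : ℕ) (i : ι) (x : EuclideanSpace ℝ (Fin d)) :
    S.supertile n (i, x) = translateTiles (S.supertile n (i, 0)) (S.scale ^ n • x) := by
  have : ({(i, x)} : Set (Tile d ι)) = translateTiles {(i, 0)} x := by
    simp [translateTiles]
  rw [supertile, this, iterate_omega_translateTiles]; rfl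

lemma supertile_translate (n : ℕ) (t : Tile d ι) (x : EuclideanSpace ℝ (Fin d)) :
    S.supertile n (t.1, t.2 + x) = translateTiles (S.supertile n t) (S.scale ^ n • x) := by
  rw [supertile_eq_translate, smul_add, ← translateTiles_add, ← supertile_eq_translate]

lemma mem_tileSupport_omega {P : Set (Tile d ι)} {y : EuclideanSpace ℝ (Fin d)} :
    y ∈ tileSupport S.shape (S.omega P) ↔ S.scale⁻¹ • y ∈ tileSupport S.shape P := by
  have h : ∀ t : Tile d ι, y ∈ tileSupport S.shape
      (translateTiles (S.subst t.1) (S.scale • t.2)) ↔ S.scale⁻¹ • y ∈ tileSet S.shape t := by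
    intro t
    rw [mem_tileSupport_translate, S.subst_support, mem_tileSet]
    constructor
    · rintro ⟨z, hz, hy⟩
      simp only at hy
      rw [eq_add_of_sub_eq hy.symm, smul_add, inv_smul_smul₀ S.scale_ne,
        inv_smul_smul₀ S.scale_ne]
      simpa using hz
    · intro hz
      exact ⟨_, hz, by simp [smul_sub, smul_inv_smul₀ S.scale_ne]⟩
  rw [mem_tileSupport (P := P)]
  simp only [← h, omega]
  simp only [mem_tileSupport, mem_iUnion]
  tauto

lemma mem_tileSupport_iterate {n : ℕ} {P : Set (Tile d ι)} {y : EuclideanSpace ℝ (Fin d)} :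
    y ∈ tileSupport S.shape (S.omega^[n] P) ↔ (S.scale ^ n)⁻¹ • y ∈ tileSupport S.shape P := by
  induction n generalizing y with
  | zero => simp
  | succ n ih =>
    rw [Function.iterate_succ_apply', mem_tileSupport_omega, ih, smul_smul, pow_succ, mul_inv]

lemma mem_tileSupport_supertile {n : ℕ} {t : Tile d ι} {y : EuclideanSpace ℝ (Fin d)} :
    y ∈ tileSupport S.shape (S.supertile n t) ↔ (S.scale ^ n)⁻¹ • y ∈ tileSet S.shape t := by
  rw [supertile, mem_tileSupport_iterate]; simp [tileSupport]

/-- Division by `λⁿ` as a homeomorphism. -/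
noncomputable def shrink (S : SubstitutionSystem d ι) (n : ℕ) :
    EuclideanSpace ℝ (Fin d) ≃ₜ EuclideanSpace ℝ (Fin d) :=
  Homeomorph.smulOfNeZero (S.scale ^ n)⁻¹ (inv_ne_zero (S.scale_pow_ne n))

lemma shrink_apply (n : ℕ) (y : EuclideanSpace ℝ (Fin d)) :
    S.shrink n y = (S.scale ^ n)⁻¹ • y := rfl

/-- Tiles of `ωⁿ(t)` lie in `λⁿ t`, and scaling is a homeomorphism, so interiors go to interiors.
That supertiles of distinct tiles share no tile rests on this. -/
lemma mem_interior_of_mem_supertile {n : ℕ} {t u : Tile d ι} (hu : u ∈ S.supertile n t)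
    {y : EuclideanSpace ℝ (Fin d)} (hy : y ∈ interior (tileSet S.shape u)) :
    (S.scale ^ n)⁻¹ • y ∈ interior (tileSet S.shape t) := by
  have h1 : tileSet S.shape u ⊆ S.shrink n ⁻¹' tileSet S.shape t := fun z hz => by
    rw [mem_preimage, shrink_apply, ← mem_tileSupport_supertile]
    exact mem_tileSupport.2 ⟨u, hu, hz⟩
  have := interior_mono h1 hy
  rwa [← Homeomorph.preimage_interior] at this

lemma isPartialTiling_omega {P : Set (Tile d ι)} (hP : IsPartialTiling S.shape P) :
    IsPartialTiling S.shape (S.omega P) := by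
  intro u hu v hv hne
  refine Set.disjoint_left.2 fun y hyu hyv => hne ?_
  obtain ⟨t, ht, hut⟩ := mem_omega.1 hu
  obtain ⟨t', ht', hvt⟩ := mem_omega.1 hv
  have h1 : ∀ {u t : Tile d ι}, (u.1, u.2 - S.scale • t.2) ∈ S.subst t.1 →
      u ∈ S.supertile 1 t := by
    intro u t h
    exact mem_omega.2 ⟨t, rfl, h⟩
  have := hP.eq_of_mem_interior ht ht' (mem_interior_of_mem_supertile (h1 hut) hyu)
    (mem_interior_of_mem_supertile (h1 hvt) hyv)
  subst this
  exact ((S.subst_isPartialTiling t.1).translate (S.scale • t.2)).eq_of_mem_interior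
    (mem_translateTiles.2 hut) (mem_translateTiles.2 hvt) hyu hyv

lemma isPartialTiling_iterate (n : ℕ) {P : Set (Tile d ι)} (hP : IsPartialTiling S.shape P) :
    IsPartialTiling S.shape (S.omega^[n] P) := by
  induction n with
  | zero => exact hP
  | succ n ih => rw [Function.iterate_succ_apply']; exact isPartialTiling_omega ih

lemma isPartialTiling_supertile (n : ℕ) (t : Tile d ι) :
    IsPartialTiling S.shape (S.supertile n t) :=
  isPartialTiling_iterate n (Set.pairwise_singleton _ _)

lemma eq_of_mem_supertile {n : ℕ} {P : Set (Tile d ι)} (hP : IsPartialTiling S.shape P)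
    {t t' u : Tile d ι} (ht : t ∈ P) (ht' : t' ∈ P) (hu : u ∈ S.supertile n t)
    (hu' : u ∈ S.supertile n t') : t = t' :=
  hP.eq_of_mem_interior ht ht' (mem_interior_of_mem_supertile hu (S.mem_interior_tileSet_self u))
    (mem_interior_of_mem_supertile hu' (S.mem_interior_tileSet_self u))

lemma supertile_nonempty (n : ℕ) (t : Tile d ι) : (S.supertile n t).Nonempty := by
  have : S.scale ^ n • t.2 ∈ tileSupport S.shape (S.supertile n t) := by
    rw [mem_tileSupport_supertile, inv_smul_smul₀ (S.scale_pow_ne n)]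
    exact S.mem_tileSet_self t
  obtain ⟨u, hu, -⟩ := mem_tileSupport.1 this
  exact ⟨u, hu⟩

/-! ### Growth of supertiles and of their boundaries. -/

section Counting

variable [Finite ι]

lemma dist_le_of_mem_supertile {n : ℕ} {t u : Tile d ι} (hu : u ∈ S.supertile n t) :
    dist u.2 (S.scale ^ n • t.2) ≤ S.scale ^ n * S.outradius := by
  have h := dist_le_outradius (interior_subset
    (mem_interior_of_mem_supertile hu (S.mem_interior_tileSet_self u)))
  have h2 : u.2 = S.scale ^ n • ((S.scale ^ n)⁻¹ • u.2) := by
    rw [smul_inv_smul₀ (S.scale_pow_ne n)]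
  rw [h2, dist_smul₀, Real.norm_of_nonneg (S.scale_pow_pos n).le]
  exact mul_le_mul_of_nonneg_left h (S.scale_pow_pos n).le

lemma supertile_finite (n : ℕ) (t : Tile d ι) : (S.supertile n t).Finite :=
  (finite_of_dist_le (S.isPartialTiling_supertile n t) _ _).subset
    fun _ hu => ⟨hu, dist_le_of_mem_supertile hu⟩

/-- The tiles of `ωⁿ(pᵢ)` with puncture at distance at most `R` from the boundary of `λⁿ pᵢ`. -/
def nearBoundary (S : SubstitutionSystem d ι) (n : ℕ) (i : ι) (R : ℝ) : Set (Tile d ι) :=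
  {u ∈ S.supertile n (i, 0) | ∃ z ∈ frontier (S.shape i), dist u.2 (S.scale ^ n • z) ≤ R}

-- Volume comparison: `λⁿ pᵢ` contains a ball of radius `λⁿ * inradius` and is covered by one ball
-- of radius `outradius` per tile of the supertile.
open MeasureTheory in
lemma scale_pow_le_ncard (n : ℕ) (i : ι) :
    (S.scale ^ n * S.inradius) ^ d ≤ (S.supertile n (i, 0)).ncard * S.outradius ^ d := by
  have hfin := S.supertile_finite n (i, 0)
  set Q := hfin.toFinset
  have hcard : (S.supertile n (i, 0)).ncard = Q.card := Set.ncard_eq_toFinset_card _ hfin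
  have hr := S.inradius_pos
  have hD := S.outradius_pos
  have hl := S.scale_pow_pos n
  set v := volume (Metric.ball (0 : EuclideanSpace ℝ (Fin d)) 1)
  have hv : v ≠ 0 := (Metric.measure_ball_pos _ _ one_pos).ne'
  have hv' : v ≠ ⊤ := measure_ball_lt_top.ne
  have hdim : Module.finrank ℝ (EuclideanSpace ℝ (Fin d)) = d := by simp
  have h1 : volume (Metric.ball (0 : EuclideanSpace ℝ (Fin d)) (S.scale ^ n * S.inradius)) ≤
      Q.card * volume (Metric.closedBall (0 : EuclideanSpace ℝ (Fin d)) S.outradius) := by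
    calc _ ≤ volume (⋃ u ∈ Q, Metric.closedBall u.2 S.outradius) := by
          refine measure_mono fun y hy => ?_
          have : y ∈ tileSupport S.shape (S.supertile n (i, 0)) := by
            rw [mem_tileSupport_supertile]
            refine interior_subset (mem_interior_of_dist_lt ?_)
            rw [dist_zero_right, norm_smul, norm_inv, Real.norm_of_nonneg hl.le]
            rw [mem_ball_zero_iff] at hy
            rwa [inv_mul_lt_iff₀ hl]
          obtain ⟨u, hu, hyu⟩ := mem_tileSupport.1 this
          exact mem_iUnion₂.2 ⟨u, hfin.mem_toFinset.2 hu, dist_le_outradius hyu⟩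
      _ ≤ ∑ u ∈ Q, volume (Metric.closedBall u.2 S.outradius) := measure_biUnion_finset_le _ _
      _ = _ := by
          rw [Finset.sum_congr rfl fun t _ => Measure.addHaar_closedBall_center volume t.2 _]
          simp
  rw [Measure.addHaar_ball_of_pos _ _ (by positivity), Measure.addHaar_closedBall _ _ hD.le, hdim,
    ← mul_assoc, ENNReal.mul_le_mul_iff_left hv hv'] at h1
  rw [hcard, ← ENNReal.ofReal_le_ofReal_iff (by positivity), ENNReal.ofReal_mul (by positivity),
    ENNReal.ofReal_natCast]
  exact h1

/-- Cover the boundary of the prototile by balls of radius `λ⁻ⁿ`. Scaled by `λⁿ` they become at most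
a constant times `λ^(nc)` unit balls, and every counted puncture is within `R + 1` of one of the
centres, where packing bounds the number. -/
lemma exists_ncard_nearBoundary_le (R : ℝ) : ∃ c C : ℝ, c < d ∧ 0 ≤ C ∧ ∀ n i,
    ((S.nearBoundary n i R).ncard : ℝ) ≤ C * (S.scale ^ n) ^ c := by
  obtain ⟨c, hc0, hcd, K, hK⟩ := S.capacity_lt
  obtain ⟨M, hM⟩ := S.exists_card_le (R + 1)
  refine ⟨c, |K| * M, hcd, by positivity, fun n i => ?_⟩
  have hl := S.scale_pow_pos n
  obtain ⟨C, hC, hcov⟩ := hK i (S.scale ^ n)⁻¹ (by positivity)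
    (inv_le_one_of_one_le₀ (S.one_le_scale_pow n))
  rw [Real.inv_rpow hl.le, Real.rpow_neg hl.le, inv_inv] at hC
  have hfin : (S.nearBoundary n i R).Finite := (S.supertile_finite n (i, 0)).subset (sep_subset _ _)
  classical
  set Q := hfin.toFinset
  have hQ : Q ⊆ C.biUnion fun z => Q.filter fun u => dist u.2 (S.scale ^ n • z) ≤ R + 1 := by
    intro u hu
    obtain ⟨-, z, hz, hd⟩ := hfin.mem_toFinset.1 hu
    obtain ⟨z', hz', hzz⟩ := mem_iUnion₂.1 (hcov hz)
    refine Finset.mem_biUnion.2 ⟨z', hz', Finset.mem_filter.2 ⟨hu, ?_⟩⟩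
    have h1 : dist (S.scale ^ n • z) (S.scale ^ n • z') ≤ 1 := by
      rw [dist_smul₀, Real.norm_of_nonneg hl.le]
      rw [Metric.mem_ball] at hzz
      calc _ ≤ S.scale ^ n * (S.scale ^ n)⁻¹ := by gcongr
        _ = 1 := mul_inv_cancel₀ hl.ne'
    linarith [dist_triangle u.2 (S.scale ^ n • z) (S.scale ^ n • z')]
  have hcard : Q.card ≤ C.card * M := by
    refine (Finset.card_le_card hQ).trans (Finset.card_biUnion_le_card_mul _ _ _ fun z _ => ?_)
    refine hM _ (S.isPartialTiling_supertile n (i, 0)) (S.scale ^ n • z) _ (fun u hu => ?_)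
      (fun u hu => (Finset.mem_filter.1 hu).2)
    exact (hfin.mem_toFinset.1 (Finset.mem_filter.1 hu).1).1
  rw [Set.ncard_eq_toFinset_card _ hfin]
  calc (Q.card : ℝ) ≤ C.card * M := by exact_mod_cast hcard
    _ ≤ (|K| * (S.scale ^ n) ^ c) * M := by
        gcongr
        exact hC.trans (by gcongr; exact le_abs_self K)
    _ = _ := by ring

/-- The proportion of the tiles of a supertile near its boundary tends to zero. -/
lemma exists_nearBoundary_small (R : ℝ) {δ : ℝ} (hδ : 0 < δ) : ∃ n₀ : ℕ, ∀ n ≥ n₀, ∀ i,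
    ((S.nearBoundary n i R).ncard : ℝ) ≤ δ * (S.supertile n (i, 0)).ncard := by
  obtain ⟨c, C, hcd, hC, h⟩ := S.exists_ncard_nearBoundary_le R
  have hr := S.inradius_pos
  have hD := S.outradius_pos
  -- Up to constants this is the quotient of the boundary bound `λ^(nc)` by the total `λ^(nd)`.
  have hlim : Filter.Tendsto (fun n : ℕ => C * (S.scale ^ n) ^ (-(d - c)))
      Filter.atTop (nhds (C * 0)) :=
    ((tendsto_rpow_neg_atTop (sub_pos.2 hcd)).comp
      (tendsto_pow_atTop_atTop_of_one_lt S.one_lt_scale)).const_mul C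
  rw [mul_zero] at hlim
  have hpos : 0 < δ * (S.inradius / S.outradius) ^ d := by positivity
  obtain ⟨n₀, hn₀⟩ := Filter.eventually_atTop.1 (hlim.eventually (gt_mem_nhds hpos))
  refine ⟨n₀, fun n hn i => (h n i).trans ?_⟩
  have hl := S.scale_pow_pos n
  have h1 := hn₀ n hn
  have h2 := S.scale_pow_le_ncard n i
  have h3 : (S.scale ^ n) ^ c = (S.scale ^ n) ^ (-(d - c)) * (S.scale ^ n) ^ d := by
    rw [← Real.rpow_natCast (S.scale ^ n) d, ← Real.rpow_add hl]
    congr 1; ring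
  rw [h3, ← mul_assoc]
  calc _ ≤ δ * (S.inradius / S.outradius) ^ d * (S.scale ^ n) ^ d := by gcongr
    _ = δ * ((S.scale ^ n * S.inradius) ^ d / S.outradius ^ d) := by
        rw [div_pow, mul_pow]; ring
    _ ≤ _ := by
        gcongr
        rwa [div_le_iff₀ (by positivity)]

end Counting

end SubstitutionSystem

/-! ### The hull -/

namespace SubstitutionSystem

variable {d : ℕ} {ι : Type*} {S : SubstitutionSystem d ι}

/-- Every finite subset is contained in a translate of a supertile. -/
def IsLegal (S : SubstitutionSystem d ι) (T : Set (Tile d ι)) : Prop :=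
  ∀ P ⊆ T, P.Finite → ∃ (i : ι) (n : ℕ) (x : EuclideanSpace ℝ (Fin d)),
    P ⊆ translateTiles (S.supertile n (i, 0)) x

lemma isLegal_translate_supertile (n : ℕ) (i : ι) (x : EuclideanSpace ℝ (Fin d)) :
    S.IsLegal (translateTiles (S.supertile n (i, 0)) x) := fun _ hP _ => ⟨i, n, x, hP⟩

lemma IsLegal.omega {T : Set (Tile d ι)} (hT : S.IsLegal T) : S.IsLegal (S.omega T) := by
  intro P hP hfin
  have : ∀ u ∈ P, ∃ t ∈ T, (u.1, u.2 - S.scale • t.2) ∈ S.subst t.1 := fun u hu =>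
    mem_omega.1 (hP hu)
  choose! f hf hfu using this
  obtain ⟨i, n, x, hx⟩ := hT (f '' P) (by rintro _ ⟨u, hu, rfl⟩; exact hf u hu) (hfin.image f)
  refine ⟨i, n + 1, S.scale • x, fun u hu => ?_⟩
  rw [supertile, Function.iterate_succ_apply', ← omega_translateTiles]
  exact omega_mono hx (mem_omega.2 ⟨f u, mem_image_of_mem f hu, hfu u hu⟩)

lemma omega_mem_hull {T : Set (Tile d ι)} (hT : T ∈ S.hull) : S.omega T ∈ S.hull :=
  ⟨isPartialTiling_omega hT.1, eq_univ_of_forall fun y => by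
    rw [mem_tileSupport_omega, hT.2.1]; trivial, IsLegal.omega hT.2.2⟩

lemma iterate_omega_mem_hull (n : ℕ) {T : Set (Tile d ι)} (hT : T ∈ S.hull) :
    S.omega^[n] T ∈ S.hull := by
  induction n with
  | zero => exact hT
  | succ n ih => rw [Function.iterate_succ_apply']; exact omega_mem_hull ih

lemma translateTiles_mem_hull {T : Set (Tile d ι)} (hT : T ∈ S.hull)
    (x : EuclideanSpace ℝ (Fin d)) : translateTiles T x ∈ S.hull := by
  refine ⟨hT.1.translate x, eq_univ_of_forall fun y => ?_, fun P hP hfin => ?_⟩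
  · rw [mem_tileSupport_translate, hT.2.1]; trivial
  · obtain ⟨i, n, z, hz⟩ := hT.2.2 (translateTiles P (-x))
      (by simpa [translateTiles_subset_iff] using hP) (hfin.image _)
    refine ⟨i, n, z + x, ?_⟩
    rw [translateTiles_subset_iff, neg_neg, translateTiles_add] at hz
    exact hz

lemma exists_mem_tileSet {T : Set (Tile d ι)} (hT : T ∈ S.hull) (y : EuclideanSpace ℝ (Fin d)) :
    ∃ t ∈ T, y ∈ tileSet S.shape t :=
  mem_tileSupport.1 (hT.2.1 ▸ mem_univ y)

/-- Limits of tilings and patches along ultrafilters belong to the hull. -/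
lemma limit_mem_hull {I : Type*} (𝒰 : Ultrafilter I) (T : I → Set (Tile d ι))
    (hpt : ∀ k, IsPartialTiling S.shape (T k)) (hlegal : ∀ k, S.IsLegal (T k))
    (hcov : ∀ y, ∀ᶠ k in 𝒰, y ∈ tileSupport S.shape (T k))
    (hfin : ∀ y, ∃ F : Set (Tile d ι), F.Finite ∧
      ∀ᶠ k in 𝒰, ∀ t ∈ T k, y ∈ tileSet S.shape t → t ∈ F) :
    {t | ∀ᶠ k in 𝒰, t ∈ T k} ∈ S.hull := by
  refine ⟨fun t ht u hu hne => ?_, eq_univ_of_forall fun y => ?_, fun P hP hPf => ?_⟩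
  · obtain ⟨k, hk1, hk2⟩ := (Filter.Eventually.and ht hu).exists
    exact hpt k hk1 hk2 hne
  · obtain ⟨F, hF, hFk⟩ := hfin y
    -- The tile of `T k` covering `y` may vary with `k`, but within a finite set, so the ultrafilter
    -- selects a single one.
    have : ∀ᶠ k in 𝒰, ∃ t ∈ F, t ∈ T k ∧ y ∈ tileSet S.shape t := by
      filter_upwards [hFk, hcov y] with k hk hy
      obtain ⟨t, ht, hyt⟩ := mem_tileSupport.1 hy
      exact ⟨t, hk t ht hyt, ht, hyt⟩
    rw [Ultrafilter.eventually_exists_mem_iff hF] at this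
    obtain ⟨t, -, ht⟩ := this
    obtain ⟨k, -, hk⟩ := ht.exists
    exact mem_tileSupport.2 ⟨t, ht.mono fun k hk => hk.1, hk⟩
  · have : ∀ᶠ k in 𝒰, ∀ t ∈ P, t ∈ T k := (Filter.eventually_all_finite hPf).2 hP
    obtain ⟨k, hk⟩ := this.exists
    exact hlegal k P hk hPf

/-- Apply `ω^N` to any one tile of the supertile of order `n - N`. -/
lemma IsPrimitive.exists_forall_ge (hprim : S.IsPrimitive) : ∃ N : ℕ, ∀ n ≥ N, ∀ i j : ι,
    ∃ x : EuclideanSpace ℝ (Fin d), (j, x) ∈ S.supertile n (i, 0) := by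
  obtain ⟨N, hN⟩ := hprim
  refine ⟨N, fun n hn i j => ?_⟩
  obtain ⟨m, rfl⟩ := Nat.exists_eq_add_of_le hn
  obtain ⟨⟨k, z⟩, hu⟩ := S.supertile_nonempty m (i, 0)
  obtain ⟨x, hx⟩ := hN k j
  refine ⟨x + S.scale ^ N • z, ?_⟩
  rw [supertile_add]
  refine supertile_subset_iterate hu ?_
  rw [supertile_eq_translate, mem_translateTiles]
  simpa using hx

/-- A patch of a tiling in the hull occurs in all supertiles of sufficiently high order. -/
lemma exists_subset_supertile (hprim : S.IsPrimitive) {P : Set (Tile d ι)}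
    (hP : S.IsLegal P) (hfin : P.Finite) : ∃ M : ℕ, ∀ n ≥ M, ∀ i,
      ∃ x : EuclideanSpace ℝ (Fin d), P ⊆ translateTiles (S.supertile n (i, 0)) x := by
  obtain ⟨N, hN⟩ := hprim.exists_forall_ge
  obtain ⟨j, m, x, hx⟩ := hP P Subset.rfl hfin
  refine ⟨m + N, fun n hn i => ?_⟩
  obtain ⟨k, rfl⟩ := Nat.exists_eq_add_of_le (show m ≤ n by omega)
  -- The supertile of order `k = n - m` contains a tile labelled `j`; applying `ω^m` to it gives a
  -- translate of the supertile that contains `P`.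
  obtain ⟨z, hz⟩ := hN k (by omega) i j
  refine ⟨x - S.scale ^ m • z, hx.trans ?_⟩
  rw [translateTiles_subset_iff, translateTiles_add, supertile_add]
  refine (?_ : S.supertile m (j, 0) ⊆ translateTiles (S.supertile m (j, z)) _).trans
    (translateTiles_mono (supertile_subset_iterate hz) _)
  rw [supertile_eq_translate m j z, translateTiles_add,
    show S.scale ^ m • z + (x - S.scale ^ m • z + -x) = 0 by abel, translateTiles_zero]

lemma injOn_iterate_omega (hinj : InjOn S.omega S.hull) (n : ℕ) :
    InjOn (S.omega^[n]) S.hull :=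
  hinj.iterate (fun _ hT => omega_mem_hull hT) n

/-! ### Desubstitution, recurrence, aperiodicity and nonemptiness of the hull. -/

section Finite

variable [Finite ι]

/-- If a partial tiling contains the tiles of a tiling near `z`, then its tiles near `z` belong
to that tiling. -/
lemma mem_of_ball_subset {A U : Set (Tile d ι)} (hA : tileSupport S.shape A = univ)
    (hU : IsPartialTiling S.shape U) {z : EuclideanSpace ℝ (Fin d)} {ρ : ℝ}
    (hAU : ∀ a ∈ A, dist a.2 z ≤ ρ + 2 * S.outradius → a ∈ U) {u : Tile d ι} (hu : u ∈ U)
    (hz : dist u.2 z ≤ ρ) : u ∈ A := by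
  have : u ∈ {a ∈ A | dist a.2 z ≤ ρ + 2 * S.outradius} := by
    -- Points of `u` are within `ρ + outradius` of `z`, so the tiles of `A` covering them have
    -- punctures within `ρ + 2 * outradius` and belong to `U`. Being covered by such tiles, `u` is
    -- one of them.
    refine mem_of_interior_subset_support hU (fun a ha => hAU a ha.1 ha.2) hu fun y hy => ?_
    obtain ⟨a, ha, hya⟩ := mem_tileSupport.1 (hA ▸ mem_univ y)
    refine mem_tileSupport.2 ⟨a, ⟨ha, ?_⟩, hya⟩
    have h1 := dist_le_outradius hya
    have h2 := dist_le_outradius (interior_subset hy)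
    have h3 := dist_triangle_left a.2 z y
    have h4 := dist_triangle y u.2 z
    linarith
  exact this.1

/-- A parent is fixed by its label, one tile of its supertile, and the position of that tile in it.
-/
lemma finite_parents (n : ℕ) {A : Set (Tile d ι)} (hA : A.Finite) :
    {t : Tile d ι | ∃ u ∈ A, u ∈ S.supertile n t}.Finite := by
  refine (hA.biUnion fun u _ => Set.finite_iUnion fun i : ι =>
    (S.supertile_finite n (i, 0)).image fun w => (i, (S.scale ^ n)⁻¹ • (u.2 - w.2))).subset ?_
  rintro ⟨i, x⟩ ⟨u, hu, hut⟩
  rw [supertile_eq_translate, mem_translateTiles] at hut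
  refine mem_iUnion₂.2 ⟨u, hu, mem_iUnion.2 ⟨i, _, hut, ?_⟩⟩
  simp [inv_smul_smul₀ (S.scale_pow_ne n)]

/-- Limits of `n`-fold desubstitutions of patches or tilings converging to a tiling. -/
lemma limit_desubstitution {T : Set (Tile d ι)} (hT : T ∈ S.hull) (n : ℕ)
    (Q : ℕ → Set (Tile d ι)) (hpt : ∀ k, IsPartialTiling S.shape (Q k))
    (hlegal : ∀ k, S.IsLegal (Q k))
    (hQ : ∀ k : ℕ, ∀ t ∈ T, dist t.2 0 ≤ (k : ℝ) → t ∈ S.omega^[n] (Q k)) :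
    ∃ L ∈ S.hull, S.omega^[n] L = T ∧ ∀ t ∈ L, ∃ k, t ∈ Q k := by
  have hnear : ∀ k : ℕ, ∀ ρ : ℝ, ρ + 2 * S.outradius ≤ k → ∀ u ∈ S.omega^[n] (Q k),
      dist u.2 0 ≤ ρ → u ∈ T := fun k ρ hk u hu hz =>
    mem_of_ball_subset hT.2.1 (isPartialTiling_iterate n (hpt k))
      (fun a ha h => hQ k a ha (h.trans hk)) hu hz
  set 𝒰 : Ultrafilter ℕ := Ultrafilter.of Filter.atTop
  have h𝒰 : ∀ R : ℝ, ∀ᶠ k : ℕ in 𝒰, R ≤ k := fun R =>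
    Ultrafilter.of_le _ (tendsto_natCast_atTop_atTop.eventually (Filter.eventually_ge_atTop R))
  have hL : {t | ∀ᶠ k in 𝒰, t ∈ Q k} ∈ S.hull := by
    refine limit_mem_hull 𝒰 Q hpt hlegal (fun y => ?_) fun y => ?_
    · obtain ⟨t, ht, hyt⟩ := exists_mem_tileSet hT (S.scale ^ n • y)
      filter_upwards [h𝒰 (dist t.2 0)] with k hk
      have := mem_tileSupport.2 ⟨t, hQ k t ht hk, hyt⟩
      rwa [mem_tileSupport_iterate, inv_smul_smul₀ (S.scale_pow_ne n)] at this
    -- If `t` covers `y`, the punctures of its supertile lie within `ρ` of the origin. For large `k`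
    -- these tiles belong to `T`, so `t` is a parent of one of finitely many tiles.
    · set ρ := S.scale ^ n * S.outradius + S.scale ^ n * (S.outradius + ‖y‖)
      refine ⟨_, finite_parents (S := S) n (finite_of_dist_le hT.1 0 ρ), ?_⟩
      filter_upwards [h𝒰 (ρ + 2 * S.outradius)] with k hk t ht hyt
      obtain ⟨u, hu⟩ := S.supertile_nonempty n t
      have h1 := dist_le_of_mem_supertile hu
      have h2 : dist (S.scale ^ n • t.2) 0 ≤ S.scale ^ n * (S.outradius + ‖y‖) := by
        rw [dist_zero_right, norm_smul, Real.norm_of_nonneg (S.scale_pow_pos n).le]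
        refine mul_le_mul_of_nonneg_left ?_ (S.scale_pow_pos n).le
        have h3 := dist_le_outradius hyt
        have h4 := dist_triangle_left t.2 0 y
        rw [dist_zero_right, dist_zero_right] at h4
        linarith
      have h5 : dist u.2 0 ≤ ρ := by linarith [dist_triangle u.2 (S.scale ^ n • t.2) 0]
      exact ⟨u, ⟨hnear k ρ hk u (supertile_subset_iterate ht hu) h5, h5⟩, hu⟩
  refine ⟨_, hL, ?_, fun t ht => Filter.Eventually.exists ht⟩
  refine eq_of_subset_of_support hT.1 (fun u hu => ?_) (iterate_omega_mem_hull n hL).2.1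
  obtain ⟨t, ht, hut⟩ := mem_iterate_omega.1 hu
  obtain ⟨k, hk1, hk2⟩ := (Filter.Eventually.and ht (h𝒰 (dist u.2 0 + 2 * S.outradius))).exists
  exact hnear k _ hk2 u (supertile_subset_iterate hk1 hut) le_rfl

/-- Surjectivity of `ω` on the hull: each central patch of `T` lies in a supertile of positive
order, that is, in `ω` of a supertile, and a limit of the latter is a preimage. -/
lemma exists_omega_eq (hprim : S.IsPrimitive) {T : Set (Tile d ι)} (hT : T ∈ S.hull) :
    ∃ T₀ ∈ S.hull, S.omega T₀ = T := by
  obtain ⟨t, ht, -⟩ := exists_mem_tileSet hT 0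
  have : ∀ k : ℕ, ∃ (n : ℕ) (x : EuclideanSpace ℝ (Fin d)),
      {t ∈ T | dist t.2 0 ≤ (k : ℝ)} ⊆ S.omega (translateTiles (S.supertile n (t.1, 0)) x) := by
    intro k
    have hfin := finite_of_dist_le hT.1 0 (k : ℝ)
    obtain ⟨M, hM⟩ := exists_subset_supertile hprim
      (fun Q hQ => hT.2.2 Q (hQ.trans (sep_subset _ _))) hfin
    obtain ⟨x, hx⟩ := hM (M + 1) (by omega) t.1
    refine ⟨M, S.scale⁻¹ • x, ?_⟩
    rwa [omega_translateTiles, smul_inv_smul₀ S.scale_ne, supertile,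
      ← Function.iterate_succ_apply' (f := S.omega)]
  choose n x hnx using this
  obtain ⟨L, hL, h, -⟩ := limit_desubstitution hT 1
    (fun k => translateTiles (S.supertile (n k) (t.1, 0)) (x k))
    (fun k => (isPartialTiling_supertile _ _).translate _)
    (fun k => isLegal_translate_supertile _ _ _) (fun k u hu hd => hnx k ⟨hu, hd⟩)
  exact ⟨L, hL, h⟩

lemma exists_iterate_omega_eq (hprim : S.IsPrimitive) (n : ℕ) {T : Set (Tile d ι)}
    (hT : T ∈ S.hull) : ∃ T₀ ∈ S.hull, S.omega^[n] T₀ = T := by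
  induction n with
  | zero => exact ⟨T, hT, rfl⟩
  | succ n ih =>
    obtain ⟨T₁, hT₁, rfl⟩ := ih
    obtain ⟨T₀, hT₀, rfl⟩ := exists_omega_eq hprim hT₁
    exact ⟨T₀, hT₀, rfl⟩

lemma exists_pair_mem {T : Set (Tile d ι)} (hT : T ∈ S.hull) : ∃ t ∈ T, ∃ u ∈ T, t ≠ u := by
  obtain ⟨t, ht, -⟩ := exists_mem_tileSet hT 0
  have := S.dim_pos
  have : Nonempty (Fin d) := ⟨⟨0, this⟩⟩
  obtain ⟨x, hx⟩ := NormedSpace.exists_lt_norm ℝ (EuclideanSpace ℝ (Fin d)) S.outradius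
  obtain ⟨u, hu, hxu⟩ := exists_mem_tileSet hT (t.2 + x)
  refine ⟨t, ht, u, hu, ?_⟩
  rintro rfl
  have := dist_le_outradius hxu
  rw [dist_eq_norm, add_sub_cancel_left] at this
  linarith

/-- A patch of a tiling in the hull occurs at least twice in every tiling in the hull. -/
lemma exists_translates_subset (hprim : S.IsPrimitive) {P : Set (Tile d ι)} (hP : S.IsLegal P)
    (hfin : P.Finite) (hne : P.Nonempty) {T : Set (Tile d ι)} (hT : T ∈ S.hull) :
    ∃ x y, x ≠ y ∧ translateTiles P x ⊆ T ∧ translateTiles P y ⊆ T := by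
  obtain ⟨M, hM⟩ := exists_subset_supertile hprim hP hfin
  obtain ⟨T₀, hT₀, rfl⟩ := exists_iterate_omega_eq hprim M hT
  -- Two distinct tiles of `T₀` will give two copies of `P`, which differ because the two supertiles
  -- share no tile.
  have key : ∀ t ∈ T₀, ∃ x, translateTiles P x ⊆ S.supertile M t := by
    rintro ⟨i, z⟩ -
    obtain ⟨x, hx⟩ := hM M le_rfl i
    refine ⟨S.scale ^ M • z - x, ?_⟩
    rw [supertile_eq_translate, translateTiles_subset_iff, translateTiles_add]
    simpa using hx
  obtain ⟨t, ht, u, hu, htu⟩ := exists_pair_mem hT₀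
  obtain ⟨x, hx⟩ := key t ht
  obtain ⟨y, hy⟩ := key u hu
  refine ⟨x, y, ?_, hx.trans (supertile_subset_iterate ht), hy.trans (supertile_subset_iterate hu)⟩
  rintro rfl
  obtain ⟨p, hp⟩ := hne
  exact htu (eq_of_mem_supertile hT₀.1 ht hu (hx (mem_image_of_mem _ hp))
    (hy (mem_image_of_mem _ hp)))

/-- Tilings in the hull have no periods. -/
lemma eq_zero_of_translateTiles_eq (hprim : S.IsPrimitive) (hinj : InjOn S.omega S.hull)
    {T : Set (Tile d ι)} (hT : T ∈ S.hull) {x : EuclideanSpace ℝ (Fin d)}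
    (hx : translateTiles T x = T) : x = 0 := by
  -- By injectivity `T₀` has the period `λ⁻ⁿ x`. This `n` makes it shorter than `inradius`, so a
  -- tile coincides with its translate.
  obtain ⟨n, hn⟩ := pow_unbounded_of_one_lt (‖x‖ / S.inradius) S.one_lt_scale
  obtain ⟨T₀, hT₀, rfl⟩ := exists_iterate_omega_eq hprim n hT
  have h1 : translateTiles T₀ ((S.scale ^ n)⁻¹ • x) = T₀ := by
    refine injOn_iterate_omega hinj n (translateTiles_mem_hull hT₀ _) hT₀ ?_
    rw [iterate_omega_translateTiles, smul_inv_smul₀ (S.scale_pow_ne n), hx]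
  obtain ⟨t, ht, -⟩ := exists_mem_tileSet hT₀ 0
  have h2 : (t.1, t.2 + (S.scale ^ n)⁻¹ • x) ∈ T₀ := by
    rw [← h1]; exact mem_image_of_mem _ ht
  have h3 := eq_of_dist_lt hT₀.1 h2 ht (by
    rw [dist_eq_norm, add_sub_cancel_left, norm_smul, norm_inv,
      Real.norm_of_nonneg (S.scale_pow_pos n).le, inv_mul_lt_iff₀ (S.scale_pow_pos n)]
    rwa [div_lt_iff₀ S.inradius_pos] at hn)
  have h4 := congrArg Prod.snd h3
  simpa [S.scale_ne] using h4

/-- The tiles of tilings with a puncture at the origin. -/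
def returnTiles (S : SubstitutionSystem d ι) : Set (Tile d ι) :=
  {t | ∃ T ∈ S.hull, (∃ j, (j, 0) ∈ T) ∧ t ∈ T}

lemma diam_tileSupport_le {P : Set (Tile d ι)} {z : EuclideanSpace ℝ (Fin d)} {R : ℝ} (hR : 0 ≤ R)
    (hP : ∀ t ∈ P, dist t.2 z ≤ R) :
    Metric.diam (tileSupport S.shape P) ≤ 2 * (R + S.outradius) := by
  refine Metric.diam_le_of_subset_closedBall (x := z) (by linarith [S.outradius_pos])
    fun y hy => ?_
  obtain ⟨t, ht, hyt⟩ := mem_tileSupport.1 hy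
  rw [Metric.mem_closedBall]
  linarith [dist_le_outradius hyt, hP t ht, dist_triangle y t.2 z]

/-- Finite local complexity, uniformly over the hull. -/
lemma finite_returnTiles (hprim : S.IsPrimitive) (hflc : S.HasFLC) (R : ℝ) :
    {t ∈ S.returnTiles | dist t.2 0 ≤ R}.Finite := by
  by_cases hne : S.hull.Nonempty
  swap
  · refine Set.finite_empty.subset ?_
    rintro t ⟨⟨T, hT, -⟩, -⟩
    exact hne ⟨T, hT⟩
  obtain ⟨T, hT⟩ := hne
  obtain ⟨F, hF, h⟩ := hflc T hT (2 * (|R| + S.outradius) + 1)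
    (by linarith [S.outradius_pos, abs_nonneg R])
  -- Finite local complexity concerns one tiling at a time. But the pair of `t` and the tile at the
  -- origin recurs in the fixed `T`, so it is a translate of some `Q ∈ F`; recentring `Q` at each of
  -- its tiles recovers `t`.
  have hF' : ((⋃ Q ∈ {Q ∈ F | Q.Finite}, ⋃ q ∈ Q, translateTiles Q (-q.2)) :
      Set (Tile d ι)).Finite :=
    (hF.subset (sep_subset _ _)).biUnion fun Q hQ => hQ.2.biUnion fun q _ => hQ.2.image _
  refine hF'.subset ?_
  rintro t ⟨⟨T', hT', ⟨j, hj⟩, ht⟩, htR⟩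
  have hfin : ({(j, 0), t} : Set (Tile d ι)).Finite := by simp
  obtain ⟨x, -, -, hx, -⟩ := exists_translates_subset hprim (P := {(j, 0), t})
    (fun Q hQ => hT'.2.2 Q (hQ.trans (by rintro _ (rfl | rfl) <;> assumption))) hfin (by simp) hT
  obtain ⟨Q, hQ, y, hy⟩ := h _ hx (hfin.image _) (by
    refine (diam_tileSupport_le (z := x) (abs_nonneg R) ?_).trans_lt (lt_add_one _)
    rintro _ ⟨u, (rfl | rfl), rfl⟩
    · simp
    · simp only [dist_add_self_left, ← dist_zero_right]
      exact htR.trans (le_abs_self R))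
  have hQ' : Q = translateTiles {(j, 0), t} (x - y) := by
    rw [sub_eq_add_neg, ← translateTiles_add, hy, translateTiles_add, add_neg_cancel,
      translateTiles_zero]
  have h1 : (j, x - y) ∈ Q := by rw [hQ', mem_translateTiles]; simp
  refine mem_iUnion₂.2 ⟨Q, ⟨hQ, hQ' ▸ hfin.image _⟩, mem_iUnion₂.2 ⟨_, h1, ?_⟩⟩
  rw [mem_translateTiles, hQ', mem_translateTiles]
  right
  exact Prod.ext rfl (by simp only; abel)

lemma countable_returnTiles (hprim : S.IsPrimitive) (hflc : S.HasFLC) :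
    S.returnTiles.Countable := by
  refine (countable_iUnion fun n : ℕ => (finite_returnTiles hprim hflc n).countable).mono ?_
  intro t ht
  obtain ⟨n, hn⟩ := exists_nat_ge (dist t.2 0)
  exact mem_iUnion.2 ⟨n, ht, hn⟩

/-- The `n`-fold desubstitution is locally determined. -/
lemma exists_patch_forcing (hinj : InjOn S.omega S.hull) (n : ℕ) {T₀ : Set (Tile d ι)}
    (hT₀ : T₀ ∈ S.hull) {t : Tile d ι} (ht : t ∈ T₀) :
    ∃ P ⊆ S.omega^[n] T₀, P.Finite ∧ ∀ T₁ ∈ S.hull, P ⊆ S.omega^[n] T₁ → t ∈ T₁ := by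
  -- Otherwise there are tilings `Q k` in the hull without `t` whose images contain ever larger
  -- patches of `ωⁿ(T₀)`. A limit `L` of them has `ωⁿ(L) = ωⁿ(T₀)`, so `L = T₀` by injectivity; but
  -- every tile of `L` belongs to some `Q k`.
  by_contra! hcon
  have hT := iterate_omega_mem_hull n hT₀
  have : ∀ k : ℕ, ∃ T₁ ∈ S.hull,
      {u ∈ S.omega^[n] T₀ | dist u.2 0 ≤ (k : ℝ)} ⊆ S.omega^[n] T₁ ∧ t ∉ T₁ := fun k =>
    hcon _ (sep_subset _ _) (finite_of_dist_le hT.1 0 k)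
  choose Q hQ hsub hnot using this
  obtain ⟨L, hL, hLT, hLQ⟩ := limit_desubstitution hT n Q (fun k => (hQ k).1)
    (fun k => (hQ k).2.2) (fun k u hu hd => hsub k ⟨hu, hd⟩)
  rw [injOn_iterate_omega hinj n hL hT₀ hLT] at hLQ
  obtain ⟨k, hk⟩ := hLQ t ht
  exact hnot k hk

/-- Take a tile `q` of `ω^(n+1)(p)` over the origin, with `n` so large that the unit neighbourhood
of `q` stays inside `λ^(n+1) p`, and then a copy of `p` in `ω^N(q)`. Iterating this inclusion of `p`
in its own supertile with a margin produces nested supertiles that exhaust `ℝᵈ`. -/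
lemma exists_supertile_thickening [Nonempty ι] (hprim : S.IsPrimitive) :
    ∃ (M : ℕ) (p : ι) (y : EuclideanSpace ℝ (Fin d)), 0 < M ∧ (p, y) ∈ S.supertile M (p, 0) ∧
      ∀ w ∈ tileSet S.shape (p, y), ∀ z, dist z w < 1 → (S.scale ^ M)⁻¹ • z ∈ S.shape p := by
  obtain ⟨p⟩ := ‹Nonempty ι›
  obtain ⟨N, hN⟩ := hprim
  have hr := S.inradius_pos
  have hD := S.outradius_pos
  obtain ⟨n, hn⟩ := pow_unbounded_of_one_lt ((2 * S.outradius + 1) / S.inradius) S.one_lt_scale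
  rw [div_lt_iff₀ hr] at hn
  have hl := S.scale_pow_pos (n + 1)
  have hlN := S.scale_pow_pos N
  have hn' : 2 * S.outradius + 1 < S.scale ^ (n + 1) * S.inradius :=
    hn.trans_le (by gcongr; exacts [S.one_lt_scale.le, Nat.le_succ n])
  have h0 : (0 : EuclideanSpace ℝ (Fin d)) ∈ tileSupport S.shape (S.supertile (n + 1) (p, 0)) := by
    rw [mem_tileSupport_supertile, smul_zero]
    exact S.mem_tileSet_self (p, 0)
  obtain ⟨⟨q, x⟩, hq, hq0⟩ := mem_tileSupport.1 h0
  obtain ⟨x', hx'⟩ := hN q p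
  have hpy : (p, x' + S.scale ^ N • x) ∈ S.supertile N (q, x) := by
    rw [supertile_eq_translate, mem_translateTiles]; simpa using hx'
  refine ⟨N + (n + 1), p, x' + S.scale ^ N • x, by omega, ?_, fun w hw z hz => ?_⟩
  · rw [supertile_add]
    exact supertile_subset_iterate hq hpy
  · have h1 : (S.scale ^ N)⁻¹ • w ∈ tileSet S.shape (q, x) :=
      mem_tileSupport_supertile.1 (mem_tileSupport.2 ⟨_, hpy, hw⟩)
    have h2 : ‖(S.scale ^ N)⁻¹ • w‖ ≤ 2 * S.outradius := by
      have h3 := dist_le_outradius h1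
      have h4 := dist_le_outradius hq0
      rw [← dist_zero_right]
      linarith [dist_triangle_right ((S.scale ^ N)⁻¹ • w) 0 x]
    have h3 : ‖(S.scale ^ N)⁻¹ • z - (S.scale ^ N)⁻¹ • w‖ ≤ 1 := by
      rw [← smul_sub, norm_smul, norm_inv, Real.norm_of_nonneg hlN.le, ← dist_eq_norm,
        inv_mul_le_iff₀ hlN]
      linarith [S.one_le_scale_pow N]
    have h4 : ‖(S.scale ^ N)⁻¹ • z‖ ≤ 2 * S.outradius + 1 := by
      linarith [norm_le_norm_add_norm_sub' ((S.scale ^ N)⁻¹ • z) ((S.scale ^ N)⁻¹ • w)]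
    have h5 : (S.scale ^ (N + (n + 1)))⁻¹ • z ∈ interior (tileSet S.shape (p, 0)) := by
      refine mem_interior_of_dist_lt ?_
      rw [dist_zero_right, pow_add, mul_inv_rev, mul_smul, norm_smul, norm_inv,
        Real.norm_of_nonneg hl.le, inv_mul_lt_iff₀ hl]
      linarith
    simpa using mem_tileSet.1 (interior_subset h5)

/-- The hull is nonempty. -/
lemma hull_nonempty [Nonempty ι] (hprim : S.IsPrimitive) : S.hull.Nonempty := by
  obtain ⟨M, p, y, hM, hpy, hthick⟩ := exists_supertile_thickening hprim
  -- The offset is chosen so that `P k` is the supertile of order `k * M` of the tile `(p, y)`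
  -- inside the next one; hence the `P k` increase.
  let a : ℕ → EuclideanSpace ℝ (Fin d) := fun k =>
    Nat.rec 0 (fun k b => b + S.scale ^ (k * M) • y) k
  have ha : ∀ k, a (k + 1) = a k + S.scale ^ (k * M) • y := fun k => rfl
  let P : ℕ → Set (Tile d ι) := fun k => translateTiles (S.supertile (k * M) (p, 0)) (-a k)
  have hmono : Monotone P := by
    refine monotone_nat_of_le_succ fun k => ?_
    change translateTiles _ _ ⊆ translateTiles _ _
    rw [translateTiles_subset_iff, translateTiles_add, ha, Nat.succ_mul, supertile_add]
    have := translateTiles_mono (supertile_subset_iterate (S := S) (n := k * M) hpy)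
      (-(S.scale ^ (k * M) • y))
    rw [supertile_eq_translate, translateTiles_add, add_neg_cancel, translateTiles_zero] at this
    convert this using 2
    abel
  have h0 : ∀ k, (0 : EuclideanSpace ℝ (Fin d)) ∈ tileSupport S.shape (P k) := fun k =>
    mem_tileSupport.2 ⟨(p, 0), hmono (Nat.zero_le k) (by simp [P, a, supertile, translateTiles]),
      S.mem_tileSet_self (p, 0)⟩
  -- The margin `1` of the thickening becomes `λ^(kM)` after scaling.
  have hcov : ∀ k z, ‖z‖ < S.scale ^ (k * M) → z ∈ tileSupport S.shape (P (k + 1)) := by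
    intro k z hz
    have hl := S.scale_pow_pos (k * M)
    have h1 := h0 k
    rw [mem_tileSupport_translate, mem_tileSupport_supertile, mem_tileSet] at h1
    simp only [zero_sub, neg_neg, sub_zero] at h1
    have h2 := hthick ((S.scale ^ (k * M))⁻¹ • a k + y) (mem_tileSet.2 (by simpa using h1))
      ((S.scale ^ (k * M))⁻¹ • (z + a (k + 1))) (by
        rw [ha, smul_add, smul_add, inv_smul_smul₀ hl.ne', dist_eq_norm, add_sub_cancel_right,
          norm_smul, norm_inv, Real.norm_of_nonneg hl.le, inv_mul_lt_iff₀ hl]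
        linarith)
    rw [mem_tileSupport_translate, mem_tileSupport_supertile, mem_tileSet, Nat.succ_mul, pow_add,
      mul_inv_rev, mul_smul]
    simpa using h2
  refine ⟨⋃ k, P k, ?_, eq_univ_of_forall fun z => ?_, fun Q hQ hfin => ?_⟩
  · intro t ht u hu hne
    obtain ⟨k, hk⟩ := mem_iUnion.1 ht
    obtain ⟨l, hl⟩ := mem_iUnion.1 hu
    exact ((isPartialTiling_supertile _ _).translate _) (hmono (le_max_left k l) hk)
      (hmono (le_max_right k l) hl) hne
  · obtain ⟨k, hk⟩ := pow_unbounded_of_one_lt ‖z‖ S.one_lt_scale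
    have := hcov k z (hk.trans_le (pow_le_pow_right₀ S.one_lt_scale.le
      (Nat.le_mul_of_pos_right k hM)))
    obtain ⟨t, ht, hz⟩ := mem_tileSupport.1 this
    exact mem_tileSupport.2 ⟨t, mem_iUnion.2 ⟨_, ht⟩, hz⟩
  · have : ∀ t ∈ Q, ∃ k, t ∈ P k := fun t ht => mem_iUnion.1 (hQ ht)
    choose! k hk using this
    obtain ⟨K, hK⟩ := (hfin.image k).bddAbove
    exact ⟨p, K * M, -a K, fun t ht => hmono (hK (mem_image_of_mem k ht)) (hk t ht)⟩

end Finite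

end SubstitutionSystem

/-! ### The punctured hull -/

namespace SubstitutionSystem

open Filter Topology

variable {d : ℕ} {ι : Type*} {S : SubstitutionSystem d ι}

/-- Primitivity, finite local complexity and injectivity on the hull. -/
structure IsRegular (S : SubstitutionSystem d ι) : Prop where
  prim : S.IsPrimitive
  flc : S.HasFLC
  inj : InjOn S.omega S.hull

/-- The tilings containing a given set of tiles. -/
def cylinder (S : SubstitutionSystem d ι) (P : Set (Tile d ι)) : Set S.PuncturedHull :=
  {T | P ⊆ T.1}

lemma mem_cylinder {P : Set (Tile d ι)} {T : S.PuncturedHull} : T ∈ S.cylinder P ↔ P ⊆ T.1 :=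
  Iff.rfl

lemma PuncturedHull.mem_returnTiles (T : S.PuncturedHull) {t : Tile d ι} (ht : t ∈ T.1) :
    t ∈ S.returnTiles := ⟨T.1, T.2.1, T.2.2, ht⟩

/-- The translate of a tiling in the punctured hull which moves a puncture to the origin. -/
def shift (T : S.PuncturedHull) (v : EuclideanSpace ℝ (Fin d)) (h : ∃ j, (j, -v) ∈ T.1) :
    S.PuncturedHull :=
  ⟨translateTiles T.1 v, translateTiles_mem_hull T.2.1 v, by
    obtain ⟨j, hj⟩ := h
    exact ⟨j, mem_translateTiles.2 (by simpa using hj)⟩⟩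

variable [Finite ι]

/-- Close tilings agree a priori only up to small translations `x` and `x'`. Both have a puncture at
the origin, and distinct punctures of a tiling are at least `inradius` apart, so `x = x'`. -/
lemma exists_forall_tilingDist_lt_imp (T : S.PuncturedHull) {P : Set (Tile d ι)} (hP : P ⊆ T.1)
    (hfin : P.Finite) :
    ∃ ε > 0, ∀ T' : S.PuncturedHull, S.tilingDist T.1 T'.1 < ε → P ⊆ T'.1 := by
  obtain ⟨R, hR⟩ := (hfin.image fun t => ‖t.2‖).bddAbove
  have hr := S.inradius_pos
  -- The bound `1` excludes the default value in `tilingDist`, `inradius / 2` forces `x = x'`, and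
  -- `1 / (|R| + 1)` lets the ball of agreement reach the punctures of `P`.
  refine ⟨min (min 1 (S.inradius / 2)) (1 / (|R| + 1)), by positivity, fun T' hT' => ?_⟩
  obtain ⟨e, he, hlt⟩ := exists_lt_of_csInf_lt ⟨1, mem_union_left _ (mem_singleton 1)⟩ hT'
  have h1 : e < 1 := hlt.trans_le ((min_le_left _ _).trans (min_le_left _ _))
  have h2 : e < S.inradius / 2 := hlt.trans_le ((min_le_left _ _).trans (min_le_right _ _))
  have h3 : e < 1 / (|R| + 1) := hlt.trans_le (min_le_right _ _)
  rcases he with he | ⟨x, x', hx, hx', heq⟩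
  · exact absurd he h1.ne
  have he0 : 0 < e := (norm_nonneg x).trans_lt hx
  have h4 : 1 < 1 / e := one_lt_one_div he0 h1
  have h5 : |R| + 1 < 1 / e := by
    rw [lt_one_div (by positivity) he0]; exact h3
  have key : ∀ t ∈ T.1, ‖t.2 - x‖ < 1 / e → (t.1, t.2 - x + x') ∈ T'.1 := by
    intro t ht hn
    have : (t.1, t.2 - x) ∈ S.tilesMeeting (translateTiles T'.1 (-x')) (Metric.ball 0 (1 / e)) := by
      rw [← heq]
      exact ⟨mem_translateTiles.2 (by simpa using ht), _, S.mem_tileSet_self _,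
        mem_ball_zero_iff.2 hn⟩
    simpa using mem_translateTiles.1 this.1
  obtain ⟨i, hi⟩ := T.2.2
  obtain ⟨j, hj⟩ := T'.2.2
  have hxx : x = x' := by
    have h6 := key _ hi (by rw [zero_sub, norm_neg]; linarith)
    have h7 := eq_of_dist_lt T'.2.1.1 h6 hj (by
      simp only [zero_sub, dist_zero_right]
      linarith [norm_add_le (-x) x', norm_neg x])
    have h8 := congrArg Prod.snd h7
    simp only [zero_sub, neg_add_eq_zero] at h8
    exact h8
  intro t ht
  have := key t (hP ht) (by
    have := hR (mem_image_of_mem _ ht)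
    linarith [norm_sub_le t.2 x, le_abs_self R])
  simpa [← hxx] using this

lemma exists_cylinder_tilingDist_lt (T : S.PuncturedHull) {ε : ℝ} (hε : 0 < ε) :
    ∃ P ⊆ T.1, P.Finite ∧ ∀ T' ∈ S.cylinder P, S.tilingDist T.1 T'.1 < ε := by
  -- Tiles meeting the ball of radius `1 / (ε / 2)` have punctures within `ρ`. Prescribing the tiles
  -- up to `ρ + 2 * outradius` also prevents `T'` from having other tiles there.
  set ρ := 1 / (ε / 2) + S.outradius
  refine ⟨_, sep_subset _ _, finite_of_dist_le T.2.1.1 0 (ρ + 2 * S.outradius), fun T' hT' => ?_⟩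
  refine (csInf_le (a := ε / 2) ?_ (mem_union_right {1} ?_)).trans_lt (half_lt_self hε)
  · refine ⟨0, ?_⟩
    rintro e (he | ⟨x, -, hx, -⟩)
    · rw [he]; exact zero_le_one
    · exact (norm_nonneg x).trans hx.le
  · refine ⟨0, 0, by simpa using hε, by simpa using hε, ?_⟩
    rw [neg_zero, translateTiles_zero, translateTiles_zero]
    have hmeet : ∀ t : Tile d ι, (tileSet S.shape t ∩ Metric.ball 0 (1 / (ε / 2))).Nonempty →
        dist t.2 0 ≤ ρ := by
      rintro t ⟨y, hy, hyb⟩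
      have h1 := dist_le_outradius hy
      rw [Metric.mem_ball] at hyb
      change dist t.2 0 ≤ 1 / (ε / 2) + S.outradius
      linarith [dist_triangle_left t.2 0 y]
    ext t
    constructor
    · rintro ⟨ht, hm⟩
      refine ⟨hT' ⟨ht, ?_⟩, hm⟩
      linarith [hmeet t hm, S.outradius_pos]
    · rintro ⟨ht, hm⟩
      exact ⟨mem_of_ball_subset T.2.1.2.1 T'.2.1.1 (fun a ha h => hT' ⟨ha, h⟩) ht (hmeet t hm), hm⟩

/-- The topology is that of finite patches, which replaces the metric in everything that follows. -/
lemma isOpen_iff_cylinder {U : Set S.PuncturedHull} :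
    IsOpen U ↔ ∀ T ∈ U, ∃ P ⊆ T.1, P.Finite ∧ S.cylinder P ⊆ U := by
  constructor
  · intro h T hT
    obtain ⟨ε, hε, hU⟩ := h T hT
    obtain ⟨P, hP, hfin, hPε⟩ := exists_cylinder_tilingDist_lt T hε
    exact ⟨P, hP, hfin, fun T' hT' => hU T' (hPε T' hT')⟩
  · intro h T hT
    obtain ⟨P, hP, hfin, hU⟩ := h T hT
    obtain ⟨ε, hε, hPε⟩ := exists_forall_tilingDist_lt_imp T hP hfin
    exact ⟨ε, hε, fun T' hT' => hU (hPε T' hT')⟩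

lemma isOpen_cylinder {P : Set (Tile d ι)} (hP : P.Finite) : IsOpen (S.cylinder P) :=
  isOpen_iff_cylinder.2 fun _ hT => ⟨P, hT, hP, Subset.rfl⟩

lemma cylinder_mem_nhds {P : Set (Tile d ι)} (hP : P.Finite) {T : S.PuncturedHull}
    (hT : P ⊆ T.1) : S.cylinder P ∈ 𝓝 T := (isOpen_cylinder hP).mem_nhds hT

lemma mem_nhds_iff_cylinder {U : Set S.PuncturedHull} {T : S.PuncturedHull} :
    U ∈ 𝓝 T ↔ ∃ P ⊆ T.1, P.Finite ∧ S.cylinder P ⊆ U := by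
  constructor
  · intro h
    obtain ⟨V, hVU, hV, hT⟩ := mem_nhds_iff.1 h
    obtain ⟨P, hP, hfin, hPV⟩ := isOpen_iff_cylinder.1 hV T hT
    exact ⟨P, hP, hfin, hPV.trans hVU⟩
  · rintro ⟨P, hP, hfin, hU⟩
    exact mem_of_superset (cylinder_mem_nhds hfin hP) hU

/-- Absence of `t` is also witnessed by a patch: the tiles of `T` within `2 * outradius` of its
puncture cover its place and leave no room for it. -/
lemma isClopen_cylinder_singleton (t : Tile d ι) : IsClopen (S.cylinder {t}) := by
  refine ⟨⟨isOpen_iff_cylinder.2 fun T hT => ?_⟩, isOpen_cylinder (finite_singleton t)⟩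
  refine ⟨_, sep_subset _ _, finite_of_dist_le T.2.1.1 t.2 (0 + 2 * S.outradius),
    fun T' hT' ht => hT ?_⟩
  rw [mem_cylinder, singleton_subset_iff] at ht ⊢
  exact mem_of_ball_subset T.2.1.2.1 T'.2.1.1 (fun a ha h => hT' ⟨ha, h⟩) ht (dist_self _).le

lemma isClopen_cylinder {P : Set (Tile d ι)} (hP : P.Finite) : IsClopen (S.cylinder P) := by
  have : S.cylinder P = ⋂ t ∈ P, S.cylinder {t} := by
    ext T; simp [mem_cylinder, subset_def]
  rw [this]
  exact hP.isClopen_biInter fun t _ => isClopen_cylinder_singleton t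

lemma PuncturedHull.eq_of_subset {T T' : S.PuncturedHull} (h : T.1 ⊆ T'.1) : T = T' :=
  Subtype.ext (eq_of_subset_of_support T'.2.1.1 h T.2.1.2.1)

/-- Distinct tilings are separated by a tile of the first. -/
lemma PuncturedHull.exists_mem_cylinder_notMem {T T' : S.PuncturedHull} (h : T ≠ T') :
    ∃ t ∈ T.1, T' ∉ S.cylinder {t} := by
  by_contra! hcon
  exact h (PuncturedHull.eq_of_subset fun t ht => by simpa [mem_cylinder] using hcon t ht)

/-- The limit along an ultrafilter consists of the tiles belonging to almost all tilings; uniform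
finite local complexity leaves finitely many candidates over each point, so the limit is a tiling.
-/
lemma IsRegular.compactSpace (hS : S.IsRegular) : CompactSpace S.PuncturedHull := by
  refine ⟨isCompact_iff_ultrafilter_le_nhds.2 fun f _ => ?_⟩
  have hL : {t | ∀ᶠ T : S.PuncturedHull in f, t ∈ T.1} ∈ S.hull := by
    refine limit_mem_hull f (fun T => T.1) (fun T => T.2.1.1) (fun T => T.2.1.2.2)
      (fun y => .of_forall fun T => T.2.1.2.1 ▸ mem_univ y) fun y => ?_
    refine ⟨_, finite_returnTiles hS.prim hS.flc (S.outradius + ‖y‖), .of_forall fun T t ht hy => ?_⟩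
    refine ⟨T.mem_returnTiles ht, ?_⟩
    have := dist_le_outradius hy
    have h2 := dist_triangle_left t.2 0 y
    rw [dist_zero_right y] at h2
    linarith
  have h0 : ∃ j, (j, 0) ∈ {t | ∀ᶠ T : S.PuncturedHull in f, t ∈ T.1} := by
    have : ∀ᶠ T : S.PuncturedHull in f, ∃ j ∈ (univ : Set ι), (j, 0) ∈ T.1 :=
      .of_forall fun T => by simpa using T.2.2
    obtain ⟨j, -, hj⟩ := (Ultrafilter.eventually_exists_mem_iff finite_univ).1 this
    exact ⟨j, hj⟩
  refine ⟨⟨_, hL, h0⟩, mem_univ _, fun U hU => ?_⟩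
  obtain ⟨P, hP, hfin, hPU⟩ := mem_nhds_iff_cylinder.1 hU
  have : ∀ᶠ T : S.PuncturedHull in f, ∀ t ∈ P, t ∈ T.1 := (eventually_all_finite hfin).2 hP
  filter_upwards [this] with T hT using hPU hT

/-- If a patch determined `T`, its two occurrences in `T` would give translates equal to `T`, so
both translations would vanish by aperiodicity. -/
lemma IsRegular.not_isOpen_singleton (hS : S.IsRegular) (T : S.PuncturedHull) :
    ¬ IsOpen {T} := by
  intro h
  obtain ⟨P, hP, hfin, hPT⟩ := isOpen_iff_cylinder.1 h T rfl
  obtain ⟨j, hj⟩ := T.2.2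
  obtain ⟨x, y, hxy, hx, hy⟩ := exists_translates_subset hS.prim (P := insert (j, 0) P)
    (fun Q hQ => T.2.1.2.2 Q (hQ.trans (insert_subset hj hP))) (hfin.insert _) (by simp) T.2.1
  have key : ∀ z, translateTiles (insert (j, 0) P) z ⊆ T.1 → z = 0 := by
    intro z hz
    rw [translateTiles_subset_iff] at hz
    have h1 : (j, -(-z)) ∈ T.1 := by simpa [mem_translateTiles] using hz (mem_insert _ _)
    have h2 : shift T (-z) ⟨j, h1⟩ ∈ S.cylinder P := (subset_insert _ _).trans hz
    have h3 := congrArg Subtype.val (hPT h2)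
    simpa using eq_zero_of_translateTiles_eq hS.prim hS.inj T.2.1 h3
  exact hxy ((key x hx).trans (key y hy).symm)

lemma IsRegular.nonempty [Nonempty ι] (hS : S.IsRegular) : Nonempty S.PuncturedHull := by
  obtain ⟨T, hT⟩ := hull_nonempty hS.prim
  obtain ⟨t, ht, -⟩ := exists_mem_tileSet hT 0
  exact ⟨⟨translateTiles T (-t.2), translateTiles_mem_hull hT _, t.1, by
    simpa [mem_translateTiles] using ht⟩⟩

/-- Countably many cylinders of single tiles separate points, so Brouwer's theorem applies. The
Hausdorff property and second countability are read off from the homeomorphism. -/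
lemma IsRegular.nonempty_homeomorph [Nonempty ι] (hS : S.IsRegular) :
    Nonempty (S.PuncturedHull ≃ₜ cantorSet) := by
  have := hS.compactSpace
  have := hS.nonempty
  have := (countable_returnTiles hS.prim hS.flc).to_subtype
  refine nonempty_homeomorph_cantorSet (fun t : S.returnTiles => S.cylinder {t.1})
    (fun t => isClopen_cylinder_singleton _) (fun T T' hne => ?_) hS.not_isOpen_singleton
  obtain ⟨t, ht, htT'⟩ := PuncturedHull.exists_mem_cylinder_notMem hne
  exact ⟨⟨t, T.mem_returnTiles ht⟩, singleton_subset_iff.2 ht, htT'⟩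

lemma IsRegular.t2Space [Nonempty ι] (hS : S.IsRegular) : T2Space S.PuncturedHull :=
  hS.nonempty_homeomorph.some.isEmbedding.t2Space

lemma IsRegular.secondCountable [Nonempty ι] (hS : S.IsRegular) :
    SecondCountableTopology S.PuncturedHull :=
  hS.nonempty_homeomorph.some.secondCountableTopology

end SubstitutionSystem

/-! ### The groupoid of the punctured hull -/

namespace SubstitutionSystem

open Filter Topology

variable {d : ℕ} {ι : Type*} {S : SubstitutionSystem d ι}

/-- The translation vector of an arrow. -/
noncomputable def PuncArrow.vec (γ : S.PuncArrow) : EuclideanSpace ℝ (Fin d) := γ.2.choose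

lemma PuncArrow.eq_translate (γ : S.PuncArrow) : γ.1.2.1 = translateTiles γ.1.1.1 γ.vec :=
  γ.2.choose_spec

lemma PuncArrow.exists_mem (γ : S.PuncArrow) : ∃ j, (j, -γ.vec) ∈ γ.1.1.1 := by
  obtain ⟨j, hj⟩ := γ.1.2.2.2
  rw [γ.eq_translate, mem_translateTiles] at hj
  exact ⟨j, by simpa using hj⟩

/-- The arrow from a tiling to its translate. -/
def shiftArrow (T : S.PuncturedHull) (v : EuclideanSpace ℝ (Fin d)) (h : ∃ j, (j, -v) ∈ T.1) :
    S.PuncArrow := ⟨(T, shift T v h), v, rfl⟩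

lemma PuncArrow.ext_vec {γ γ' : S.PuncArrow} (h : γ.1.1 = γ'.1.1) (hv : γ.vec = γ'.vec) :
    γ = γ' := by
  refine Subtype.ext (Prod.ext h (Subtype.ext ?_))
  rw [γ.eq_translate, γ'.eq_translate, h, hv]

section

variable {G : Subgroup (EuclideanSpace ℝ (Fin d) ≃ₗᵢ[ℝ] EuclideanSpace ℝ (Fin d))}
  [MulAction G ι]

lemma mem_act {g : G} {P : Set (Tile d ι)} {t : Tile d ι} :
    t ∈ act g P ↔ (g⁻¹ • t.1, g⁻¹.1 t.2) ∈ P := by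
  constructor
  · rintro ⟨u, hu, rfl⟩
    simpa using hu
  · intro h
    exact ⟨_, h, by simp⟩

lemma act_mono (g : G) {P Q : Set (Tile d ι)} (h : P ⊆ Q) : act g P ⊆ act g Q := image_mono h

lemma act_subset_iff {g : G} {P Q : Set (Tile d ι)} : act g⁻¹ P ⊆ Q ↔ P ⊆ act g Q := by
  constructor
  · intro h
    have := act_mono g h
    rwa [← act_mul, mul_inv_cancel, act_one] at this
  · intro h
    have := act_mono g⁻¹ h
    rwa [← act_mul, inv_mul_cancel, act_one] at this

end

variable [Finite ι]

/-- Aperiodicity makes the chosen vector the only one, so `vec` is additive on products. -/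
lemma IsRegular.vec_eq (hS : S.IsRegular) {γ : S.PuncArrow} {v : EuclideanSpace ℝ (Fin d)}
    (h : γ.1.2.1 = translateTiles γ.1.1.1 v) : γ.vec = v := by
  have h1 := γ.eq_translate
  rw [h] at h1
  have h2 : translateTiles γ.1.1.1 (γ.vec - v) = γ.1.1.1 := by
    rw [sub_eq_add_neg, ← translateTiles_add, ← h1, translateTiles_add, add_neg_cancel,
      translateTiles_zero]
  exact sub_eq_zero.1 (eq_zero_of_translateTiles_eq hS.prim hS.inj γ.1.1.2.1 h2)

lemma IsRegular.vec_shiftArrow (hS : S.IsRegular) (T : S.PuncturedHull)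
    (v : EuclideanSpace ℝ (Fin d)) (h : ∃ j, (j, -v) ∈ T.1) : (shiftArrow T v h).vec = v :=
  hS.vec_eq rfl

lemma IsRegular.mem_basicSet (hS : S.IsRegular) {P : Set (Tile d ι)} {t₁ t₂ : Tile d ι}
    {γ : S.PuncArrow} : γ ∈ S.basicSet P t₁ t₂ ↔
      translateTiles P (-t₁.2) ⊆ γ.1.1.1 ∧ γ.vec = t₁.2 - t₂.2 := by
  constructor
  · rintro ⟨h1, -, h2⟩
    exact ⟨h1, hS.vec_eq h2⟩
  · rintro ⟨h1, h2⟩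
    have h3 := γ.eq_translate
    rw [h2] at h3
    refine ⟨h1, ?_, h3⟩
    rw [h3, ← sub_add_cancel_left t₁.2 t₂.2, sub_eq_add_neg, ← translateTiles_add,
      translateTiles_subset_iff, translateTiles_add] 
    simpa [translateTiles_subset_iff, translateTiles_add] using h1

/-- In terms of range and vector, the topology is induced from `Ω_punc × ℝᵈ` with `ℝᵈ` discrete.
Continuity, openness and compactness of sets of arrows all reduce to this. -/
lemma IsRegular.isOpen_iff (hS : S.IsRegular) {U : Set S.PuncArrow} :
    IsOpen U ↔ ∀ γ ∈ U, ∃ P ⊆ γ.1.1.1, P.Finite ∧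
      ∀ γ' : S.PuncArrow, P ⊆ γ'.1.1.1 → γ'.vec = γ.vec → γ' ∈ U := by
  constructor
  · intro h
    induction h with
    | basic V hV =>
      obtain ⟨T, hT, P, hPT, hfin, t₁, h₁, t₂, h₂, rfl⟩ := hV
      intro γ hγ
      rw [hS.mem_basicSet] at hγ
      exact ⟨_, hγ.1, hfin.image _, fun γ' h1 h2 => hS.mem_basicSet.2 ⟨h1, h2.trans hγ.2⟩⟩
    | univ => exact fun γ _ => ⟨∅, empty_subset _, finite_empty, fun _ _ _ => trivial⟩
    | inter V W _ _ ihV ihW =>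
      intro γ hγ
      obtain ⟨P, hP, hPf, hPV⟩ := ihV γ hγ.1
      obtain ⟨Q, hQ, hQf, hQW⟩ := ihW γ hγ.2
      exact ⟨P ∪ Q, union_subset hP hQ, hPf.union hQf, fun γ' h1 h2 =>
        ⟨hPV γ' (subset_union_left.trans h1) h2, hQW γ' (subset_union_right.trans h1) h2⟩⟩
    | sUnion 𝒱 _ ih =>
      rintro γ ⟨V, hV, hγ⟩
      obtain ⟨P, hP, hPf, hPV⟩ := ih V hV γ hγ
      exact ⟨P, hP, hPf, fun γ' h1 h2 => ⟨V, hV, hPV γ' h1 h2⟩⟩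
  · intro h
    refine isOpen_iff_forall_mem_open.2 fun γ hγ => ?_
    obtain ⟨P, hP, hfin, hU⟩ := h γ hγ
    obtain ⟨i, hi⟩ := γ.1.1.2.2
    obtain ⟨j, hj⟩ := γ.exists_mem
    -- A generating set needs both punctures to be punctures of the patch, so the tiles at `0` and
    -- `-γ.vec` are added to `P`.
    have hopen : IsOpen (S.basicSet (insert (i, 0) (insert (j, -γ.vec) P)) (i, 0) (j, -γ.vec)) := by
      refine TopologicalSpace.isOpen_generateFrom_of_mem ?_
      exact ⟨γ.1.1.1, γ.1.1.2.1, _, insert_subset hi (insert_subset hj hP),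
        (hfin.insert _).insert _, _, mem_insert _ _, _, mem_insert_of_mem _ (mem_insert _ _), rfl⟩
    refine ⟨_, fun γ' hγ' => ?_, hopen, ?_⟩
    · rw [hS.mem_basicSet] at hγ'
      simp only [neg_zero, translateTiles_zero, zero_sub, neg_neg] at hγ'
      exact hU γ' (((subset_insert _ _).trans (subset_insert _ _)).trans hγ'.1) hγ'.2
    · rw [hS.mem_basicSet]
      simp only [neg_zero, translateTiles_zero, zero_sub, neg_neg, and_true]
      exact insert_subset hi (insert_subset hj hP)

lemma IsRegular.mem_nhds_arrow (hS : S.IsRegular) {P : Set (Tile d ι)} (hfin : P.Finite)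
    {γ : S.PuncArrow} (hP : P ⊆ γ.1.1.1) :
    {γ' : S.PuncArrow | P ⊆ γ'.1.1.1 ∧ γ'.vec = γ.vec} ∈ 𝓝 γ := by
  refine IsOpen.mem_nhds (hS.isOpen_iff.2 fun ξ hξ => ?_) ⟨hP, rfl⟩
  exact ⟨P, hξ.1, hfin, fun _ h1 h2 => ⟨h1, h2.trans hξ.2⟩⟩

lemma IsRegular.eventually_vec_eq (hS : S.IsRegular) (γ : S.PuncArrow) :
    ∀ᶠ γ' in 𝓝 γ, γ'.vec = γ.vec := by
  filter_upwards [hS.mem_nhds_arrow finite_empty (empty_subset γ.1.1.1)] with γ' h using h.2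

lemma IsRegular.isLocallyConstant_vec (hS : S.IsRegular) :
    IsLocallyConstant (PuncArrow.vec (S := S)) :=
  (IsLocallyConstant.iff_eventually_eq _).2 hS.eventually_vec_eq

lemma IsRegular.continuous_range (hS : S.IsRegular) :
    Continuous fun γ : S.PuncArrow => γ.1.1 := by
  refine continuous_iff_continuousAt.2 fun γ U hU => ?_
  obtain ⟨P, hP, hfin, hPU⟩ := mem_nhds_iff_cylinder.1 hU
  refine mem_map.2 ?_
  filter_upwards [hS.mem_nhds_arrow hfin hP] with γ' h using hPU h.1

lemma IsRegular.continuous_source (hS : S.IsRegular) :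
    Continuous fun γ : S.PuncArrow => γ.1.2 := by
  refine continuous_iff_continuousAt.2 fun γ U hU => ?_
  obtain ⟨P, hP, hfin, hPU⟩ := mem_nhds_iff_cylinder.1 hU
  have hP' : translateTiles P (-γ.vec) ⊆ γ.1.1.1 := by
    rw [γ.eq_translate] at hP
    rwa [translateTiles_subset_iff, neg_neg]
  refine mem_map.2 ?_
  filter_upwards [hS.mem_nhds_arrow (hfin.image _) hP'] with γ' h
  refine hPU ?_
  rw [mem_cylinder, γ'.eq_translate, h.2, ← neg_neg γ.vec, ← translateTiles_subset_iff]
  exact h.1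

/-- A map into the arrows is continuous if its range is continuous and its translation vector
locally constant. -/
lemma IsRegular.continuous_of_range (hS : S.IsRegular) {Y : Type*} [TopologicalSpace Y]
    {f : Y → S.PuncArrow} (hr : Continuous fun y => (f y).1.1)
    (hv : ∀ y, ∀ᶠ y' in 𝓝 y, (f y').vec = (f y).vec) : Continuous f := by
  refine continuous_def.2 fun U hU => isOpen_iff_mem_nhds.2 fun y hy => ?_
  obtain ⟨P, hP, hfin, hPU⟩ := hS.isOpen_iff.1 hU (f y) hy
  filter_upwards [hv y, hr.continuousAt (cylinder_mem_nhds hfin hP)] with y' h1 h2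
  exact hPU _ h2 h1

lemma IsRegular.vec_one (hS : S.IsRegular) (T : S.PuncturedHull) :
    (S.puncGroupoid.one T).vec = 0 := hS.vec_eq (translateTiles_zero _).symm

lemma IsRegular.vec_inv (hS : S.IsRegular) (γ : S.PuncArrow) :
    (S.puncGroupoid.inv γ).vec = -γ.vec := by
  refine hS.vec_eq ?_
  change γ.1.1.1 = translateTiles γ.1.2.1 (-γ.vec)
  rw [γ.eq_translate, translateTiles_add, add_neg_cancel, translateTiles_zero]

lemma IsRegular.vec_mul (hS : S.IsRegular) (γ ξ : S.PuncArrow)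
    (h : S.puncGroupoid.s γ = S.puncGroupoid.r ξ) :
    (S.puncGroupoid.mul γ ξ h).vec = γ.vec + ξ.vec := by
  refine hS.vec_eq ?_
  change ξ.1.2.1 = translateTiles γ.1.1.1 _
  rw [ξ.eq_translate, ← translateTiles_add, ← γ.eq_translate]
  exact congrArg (fun T : S.PuncturedHull => translateTiles T.1 ξ.vec) h.symm

lemma IsRegular.isTopological (hS : S.IsRegular) : S.puncGroupoid.IsTopological where
  continuous_r := hS.continuous_range
  continuous_s := hS.continuous_source
  continuous_one := hS.continuous_of_range continuous_id
    fun T => .of_forall fun T' => by rw [hS.vec_one, hS.vec_one]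
  continuous_inv := hS.continuous_of_range hS.continuous_source fun γ => by
    filter_upwards [hS.eventually_vec_eq γ] with γ' h
    rw [hS.vec_inv, hS.vec_inv, h]
  continuous_mul := by
    refine hS.continuous_of_range ?_ fun p => ?_
    · change Continuous fun p : {p : S.PuncArrow × S.PuncArrow //
        S.puncGroupoid.s p.1 = S.puncGroupoid.r p.2} => p.1.1.1.1
      exact hS.continuous_range.comp (continuous_fst.comp continuous_subtype_val)
    have h1 := (continuous_fst.comp continuous_subtype_val).continuousAt.eventually
      (hS.eventually_vec_eq (Prod.fst (Subtype.val p)))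
    have h2 := (continuous_snd.comp continuous_subtype_val).continuousAt.eventually
      (hS.eventually_vec_eq (Prod.snd (Subtype.val p)))
    filter_upwards [h1, h2] with q hq1 hq2
    rw [hS.vec_mul, hS.vec_mul]
    exact congrArg₂ _ hq1 hq2

lemma IsRegular.isOpenMap_range (hS : S.IsRegular) :
    IsOpenMap fun γ : S.PuncArrow => γ.1.1 := by
  intro U hU
  refine isOpen_iff_cylinder.2 ?_
  rintro _ ⟨γ, hγ, rfl⟩
  obtain ⟨P, hP, hfin, hPU⟩ := hS.isOpen_iff.1 hU γ hγ
  obtain ⟨j, hj⟩ := γ.exists_mem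
  refine ⟨insert (j, -γ.vec) P, insert_subset hj hP, hfin.insert _, fun T hT => ?_⟩
  exact ⟨shiftArrow T γ.vec ⟨j, hT (mem_insert _ _)⟩,
    hPU _ ((subset_insert _ _).trans hT) (hS.vec_shiftArrow _ _ _), rfl⟩

lemma IsRegular.isLocalHomeomorph_range (hS : S.IsRegular) :
    IsLocalHomeomorph fun γ : S.PuncArrow => γ.1.1 :=
  .of_continuous_isOpenMap hS.continuous_range hS.isOpenMap_range fun γ =>
    ⟨{γ' | γ'.vec = γ.vec}, hS.isLocallyConstant_vec.isOpen_fiber _, rfl,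
      fun _ h1 _ h2 h => PuncArrow.ext_vec h (h1.trans h2.symm)⟩

/-- Inversion of arrows as a homeomorphism. -/
def IsRegular.invHomeomorph (hS : S.IsRegular) : S.PuncArrow ≃ₜ S.PuncArrow where
  toFun := S.puncGroupoid.inv
  invFun := S.puncGroupoid.inv
  left_inv _ := rfl
  right_inv _ := rfl
  continuous_toFun := hS.isTopological.continuous_inv
  continuous_invFun := hS.isTopological.continuous_inv

lemma IsRegular.isClopen_vec_fiber (hS : S.IsRegular) (v : EuclideanSpace ℝ (Fin d)) :
    IsClopen {γ : S.PuncArrow | γ.vec = v} := hS.isLocallyConstant_vec.isClopen_fiber v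

lemma isClopen_setOf_exists_mem (v : EuclideanSpace ℝ (Fin d)) :
    IsClopen {T : S.PuncturedHull | ∃ j, (j, v) ∈ T.1} := by
  have : {T : S.PuncturedHull | ∃ j, (j, v) ∈ T.1} = ⋃ j, S.cylinder {(j, v)} := by
    ext T; simp [mem_cylinder]
  rw [this]
  exact isClopen_iUnion_of_finite fun j => isClopen_cylinder_singleton _

lemma IsRegular.continuous_shiftArrow (hS : S.IsRegular) (v : EuclideanSpace ℝ (Fin d)) :
    Continuous fun T : {T : S.PuncturedHull | ∃ j, (j, -v) ∈ T.1} => shiftArrow T.1 v T.2 :=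
  hS.continuous_of_range continuous_subtype_val fun T => .of_forall fun T' => by
    rw [hS.vec_shiftArrow, hS.vec_shiftArrow]

lemma IsRegular.isCompact_vec_fiber (hS : S.IsRegular) (v : EuclideanSpace ℝ (Fin d)) :
    IsCompact {γ : S.PuncArrow | γ.vec = v} := by
  have := hS.compactSpace
  have := isCompact_iff_compactSpace.1 (isClopen_setOf_exists_mem (S := S) (-v)).isClosed.isCompact
  convert isCompact_range (hS.continuous_shiftArrow v)
  ext γ
  constructor
  · rintro rfl
    exact ⟨⟨γ.1.1, γ.exists_mem⟩, PuncArrow.ext_vec rfl (hS.vec_shiftArrow _ _ _)⟩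
  · rintro ⟨T, rfl⟩
    exact hS.vec_shiftArrow _ _ _

lemma IsRegular.finite_vec (hS : S.IsRegular) (R : ℝ) :
    {v : EuclideanSpace ℝ (Fin d) | ‖v‖ ≤ R ∧ ∃ γ : S.PuncArrow, γ.vec = v}.Finite := by
  refine ((finite_returnTiles hS.prim hS.flc R).image fun t => -t.2).subset ?_
  rintro v ⟨hv, γ, rfl⟩
  obtain ⟨j, hj⟩ := γ.exists_mem
  exact ⟨_, ⟨γ.1.1.mem_returnTiles hj, by simpa using hv⟩, by simp⟩

lemma IsRegular.isCompact_vec_le (hS : S.IsRegular) (R : ℝ) :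
    IsCompact {γ : S.PuncArrow | ‖γ.vec‖ ≤ R} := by
  have : {γ : S.PuncArrow | ‖γ.vec‖ ≤ R} =
      ⋃ v ∈ {v : EuclideanSpace ℝ (Fin d) | ‖v‖ ≤ R ∧ ∃ γ : S.PuncArrow, γ.vec = v},
        {γ : S.PuncArrow | γ.vec = v} := by
    ext γ
    simp only [mem_iUnion]
    exact ⟨fun h => ⟨γ.vec, ⟨h, γ, rfl⟩, rfl⟩, fun ⟨v, hv, h⟩ => by
      rw [← h] at hv; exact hv.1⟩
  rw [this]
  exact (hS.finite_vec R).isCompact_biUnion fun v _ => hS.isCompact_vec_fiber v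

/-- `V(P, t₁, t₂)` depends only on `P - x(t₁)` and `x(t₂) - x(t₁)`, which are made of return tiles;
so the given subbase is itself countable. -/
lemma IsRegular.secondCountable_arrow (hS : S.IsRegular) :
    SecondCountableTopology S.PuncArrow := by
  refine ⟨_, ?_, rfl⟩
  have hc := countable_returnTiles hS.prim hS.flc
  have hc' := (countable_ofPred_finite_subset hc).prod hc
  refine (hc'.image fun q : Set (Tile d ι) × Tile d ι =>
    {γ : S.PuncArrow | q.1 ⊆ γ.1.1.1 ∧ γ.vec = -q.2.2}).mono ?_
  rintro _ ⟨T, hT, P, hP, hfin, t₁, h₁, t₂, h₂, rfl⟩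
  have hT' : (t₁.1, 0) ∈ translateTiles T (-t₁.2) := by simpa [mem_translateTiles] using hP h₁
  have key : ∀ t ∈ P, (t.1, t.2 + -t₁.2) ∈ S.returnTiles := fun t ht =>
    ⟨translateTiles T (-t₁.2), translateTiles_mem_hull hT _, ⟨_, hT'⟩, _, hP ht, rfl⟩
  refine ⟨(translateTiles P (-t₁.2), (t₂.1, t₂.2 + -t₁.2)), ⟨⟨hfin.image _, ?_⟩, key _ h₂⟩, ?_⟩
  · rintro _ ⟨t, ht, rfl⟩
    exact key t ht
  · ext γ
    rw [hS.mem_basicSet]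
    simp [sub_eq_add_neg]

lemma IsRegular.isCantor [Nonempty ι] (hS : S.IsRegular) : S.puncGroupoid.IsCantor := by
  have := hS.t2Space
  have hT2 : T2Space S.PuncArrow := .of_injective_continuous
    (f := fun γ : S.PuncArrow => (γ.1.1, γ.vec))
    (fun γ γ' h => PuncArrow.ext_vec (Prod.ext_iff.1 h).1 (Prod.ext_iff.1 h).2)
    (hS.continuous_range.prodMk hS.isLocallyConstant_vec.continuous)
  have : WeaklyLocallyCompactSpace S.PuncArrow :=
    ⟨fun γ => ⟨_, hS.isCompact_vec_fiber γ.vec, (hS.isClopen_vec_fiber _).isOpen.mem_nhds rfl⟩⟩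
  exact
    { toIsTopological := hS.isTopological
      locallyCompact := inferInstance
      t2 := hT2
      secondCountable := hS.secondCountable_arrow
      isLocalHomeomorph_r := hS.isLocalHomeomorph_range
      isLocalHomeomorph_s := hS.isLocalHomeomorph_range.comp hS.invHomeomorph.isLocalHomeomorph
      units_homeomorph := hS.nonempty_homeomorph }

/-! ### Symmetries -/

variable {G : Subgroup (EuclideanSpace ℝ (Fin d) ≃ₗᵢ[ℝ] EuclideanSpace ℝ (Fin d))}
  [MulAction G ι]

lemma continuous_actHull (hG : S.IsSymmetryGroup G) (g : G) : Continuous (actHull hG g) := by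
  refine continuous_iff_continuousAt.2 fun T U hU => ?_
  obtain ⟨P, hP, hfin, hPU⟩ := mem_nhds_iff_cylinder.1 hU
  have hP' : act g⁻¹ P ⊆ T.1 := act_subset_iff.2 hP
  refine mem_map.2 ?_
  filter_upwards [cylinder_mem_nhds (hfin.image _) hP'] with T' hT'
  exact hPU (act_subset_iff.1 hT')

lemma IsRegular.vec_actArrow (hS : S.IsRegular) (hG : S.IsSymmetryGroup G) (g : G)
    (γ : S.PuncArrow) : (actArrow hG g γ).vec = g.1 γ.vec := by
  refine hS.vec_eq ?_
  change act g γ.1.2.1 = translateTiles (act g γ.1.1.1) (g.1 γ.vec)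
  rw [γ.eq_translate, act_translateTiles]

lemma IsRegular.continuous_actArrow (hS : S.IsRegular) (hG : S.IsSymmetryGroup G) (g : G) :
    Continuous (actArrow hG g) :=
  hS.continuous_of_range ((continuous_actHull hG g).comp hS.continuous_range) fun γ => by
    filter_upwards [hS.eventually_vec_eq γ] with γ' h
    rw [hS.vec_actArrow, hS.vec_actArrow, h]

lemma IsRegular.isCantor_semidirect [Nonempty ι] [Finite G] (hS : S.IsRegular)
    (hG : S.IsSymmetryGroup G) : (puncSemidirect hG).IsCantor :=
  ⟨hS.isCantor.toIsEtale.semidirect _ (hS.continuous_actArrow hG), hS.nonempty_homeomorph⟩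

end SubstitutionSystem

/-! ### The AF subgroupoid -/

namespace SubstitutionSystem

open Filter Topology

variable {d : ℕ} {ι : Type*} {S : SubstitutionSystem d ι}

/-- `t` is the tile of the `n`-fold desubstitution of `T` whose supertile has a tile with puncture
at the origin. -/
def IsRoot (n : ℕ) (T : S.PuncturedHull) (t : Tile d ι) : Prop :=
  ∃ T₀ ∈ S.hull, S.omega^[n] T₀ = T.1 ∧ t ∈ T₀ ∧ ∃ i, (i, 0) ∈ S.supertile n t

lemma IsRoot.supertile_subset {n : ℕ} {T : S.PuncturedHull} {t : Tile d ι} (h : IsRoot n T t) :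
    S.supertile n t ⊆ T.1 := by
  obtain ⟨T₀, -, hT, ht, -⟩ := h
  exact hT ▸ supertile_subset_iterate ht

/-- Injectivity makes `T₀` unique, and the tile at the origin lies in the supertile of only one tile
of `T₀`. -/
lemma IsRegular.isRoot_unique (hS : S.IsRegular) {n : ℕ} {T : S.PuncturedHull} {t t' : Tile d ι}
    (h : IsRoot n T t) (h' : IsRoot n T t') : t = t' := by
  have hs := h.supertile_subset
  have hs' := h'.supertile_subset
  obtain ⟨T₀, hT₀, hT, ht, i, hi⟩ := h
  obtain ⟨T₁, hT₁, hT', ht', j, hj⟩ := h'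
  obtain rfl : T₀ = T₁ := injOn_iterate_omega hS.inj n hT₀ hT₁ (hT.trans hT'.symm)
  have := S.eq_of_snd_eq T.2.1.1 (hs hi) (hs' hj) rfl
  rw [this] at hi
  exact eq_of_mem_supertile hT₀.1 ht ht' hi hj

section

variable {G : Subgroup (EuclideanSpace ℝ (Fin d) ≃ₗᵢ[ℝ] EuclideanSpace ℝ (Fin d))}

/-- The arrows of `R_n ⋊ G`. -/
def supertileSemidirectArrows (S : SubstitutionSystem d ι)
    (G : Subgroup (EuclideanSpace ℝ (Fin d) ≃ₗᵢ[ℝ] EuclideanSpace ℝ (Fin d))) (n : ℕ) :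
    Set (SetGroupoid.SemidirectArrow S.PuncArrow G) := {a | a.1 ∈ S.supertileArrows n}

lemma afSemidirectArrows_eq : S.afSemidirectArrows G = ⋃ n, S.supertileSemidirectArrows G n := by
  ext a; simp [afSemidirectArrows, afArrows, supertileSemidirectArrows]

lemma continuous_semidirect_fst :
    Continuous fun a : SetGroupoid.SemidirectArrow S.PuncArrow G => a.1 := by
  let : TopologicalSpace G := ⊥
  exact continuous_fst

end

variable [Finite ι]

lemma IsRegular.exists_isRoot (hS : S.IsRegular) (n : ℕ) (T : S.PuncturedHull) :
    ∃ t, IsRoot n T t := by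
  obtain ⟨T₀, hT₀, h⟩ := exists_iterate_omega_eq hS.prim n T.2.1
  obtain ⟨i, hi⟩ := T.2.2
  rw [← h, mem_iterate_omega] at hi
  obtain ⟨t, ht, hit⟩ := hi
  exact ⟨t, T₀, hT₀, h, ht, i, hit⟩

/-- The tile of the `n`-fold desubstitution whose supertile has a tile with puncture at the
origin. -/
noncomputable def IsRegular.root (hS : S.IsRegular) (n : ℕ) (T : S.PuncturedHull) : Tile d ι :=
  (hS.exists_isRoot n T).choose

lemma IsRegular.isRoot_root (hS : S.IsRegular) (n : ℕ) (T : S.PuncturedHull) :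
    IsRoot n T (hS.root n T) := (hS.exists_isRoot n T).choose_spec

lemma IsRegular.root_eq (hS : S.IsRegular) {n : ℕ} {T : S.PuncturedHull} {t : Tile d ι}
    (h : IsRoot n T t) : hS.root n T = t := hS.isRoot_unique (hS.isRoot_root n T) h

/-- A finite patch of `T` forces the root tile into the desubstitution of every tiling containing
the patch. -/
lemma IsRegular.isLocallyConstant_root (hS : S.IsRegular) (n : ℕ) :
    IsLocallyConstant (hS.root n) := by
  refine (IsLocallyConstant.iff_eventually_eq _).2 fun T => ?_
  obtain ⟨T₀, hT₀, hT, ht, i, hi⟩ := hS.isRoot_root n T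
  obtain ⟨P, hP, hfin, hforce⟩ := exists_patch_forcing hS.inj n hT₀ ht
  filter_upwards [cylinder_mem_nhds hfin (hP.trans hT.subset)] with T' hT'
  obtain ⟨T₁, hT₁, h⟩ := exists_iterate_omega_eq hS.prim n T'.2.1
  exact hS.root_eq ⟨T₁, hT₁, h, hforce T₁ hT₁ (h ▸ hT'), i, hi⟩

/-- Translating a tiling by `v` translates its desubstitution by `λ⁻ⁿ v`, so `0` and `-v` share a
supertile exactly when the root moves along. In this form products and inverses are vector
arithmetic, and clopenness is local constancy. -/
lemma IsRegular.mem_supertileArrows_iff (hS : S.IsRegular) {n : ℕ} {γ : S.PuncArrow} :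
    γ ∈ S.supertileArrows n ↔ hS.root n γ.1.2 =
      ((hS.root n γ.1.1).1, (hS.root n γ.1.1).2 + (S.scale ^ n)⁻¹ • γ.vec) := by
  constructor
  · rintro ⟨T₀, hT₀, hT, t, ht, i, j, x, hi, hj, hx⟩
    rw [hS.root_eq ⟨T₀, hT₀, hT, ht, i, hi⟩, hS.vec_eq hx]
    refine hS.root_eq ⟨translateTiles T₀ ((S.scale ^ n)⁻¹ • -x), translateTiles_mem_hull hT₀ _,
      ?_, mem_image_of_mem _ ht, j, ?_⟩
    · rw [iterate_omega_translateTiles, smul_inv_smul₀ (S.scale_pow_ne n), hT, hx]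
    · rw [supertile_translate, smul_inv_smul₀ (S.scale_pow_ne n), mem_translateTiles]
      simpa using hj
  · intro h
    obtain ⟨T₀, hT₀, hT, ht, i, hi⟩ := hS.isRoot_root n γ.1.1
    obtain ⟨-, -, -, -, j, hj⟩ := hS.isRoot_root n γ.1.2
    rw [h, supertile_translate, smul_inv_smul₀ (S.scale_pow_ne n), mem_translateTiles] at hj
    refine ⟨T₀, hT₀, hT, _, ht, i, j, -γ.vec, hi, by simpa using hj, ?_⟩
    rw [neg_neg]; exact γ.eq_translate

lemma IsRegular.mem_supertileArrows_of_mem (hS : S.IsRegular) {n : ℕ} {γ : S.PuncArrow} {j : ι}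
    (h : (j, -γ.vec) ∈ S.supertile n (hS.root n γ.1.1)) : γ ∈ S.supertileArrows n := by
  obtain ⟨T₀, hT₀, hT, ht, i, hi⟩ := hS.isRoot_root n γ.1.1
  exact ⟨T₀, hT₀, hT, _, ht, i, j, -γ.vec, hi, h, by rw [neg_neg]; exact γ.eq_translate⟩

lemma IsRegular.isClopen_supertileArrows (hS : S.IsRegular) (n : ℕ) :
    IsClopen (S.supertileArrows n) := by
  have h1 : IsLocallyConstant fun γ : S.PuncArrow =>
      (hS.root n γ.1.2, hS.root n γ.1.1, γ.vec) :=
    ((hS.isLocallyConstant_root n).comp_continuous hS.continuous_source).prodMk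
      (((hS.isLocallyConstant_root n).comp_continuous hS.continuous_range).prodMk
        hS.isLocallyConstant_vec)
  have h2 : S.supertileArrows n = (fun γ : S.PuncArrow =>
      (hS.root n γ.1.2, hS.root n γ.1.1, γ.vec)) ⁻¹'
        {p | p.1 = (p.2.1.1, p.2.1.2 + (S.scale ^ n)⁻¹ • p.2.2)} := by
    ext γ; exact hS.mem_supertileArrows_iff
  rw [h2]
  exact ⟨⟨h1 {p | p.1 = (p.2.1.1, p.2.1.2 + (S.scale ^ n)⁻¹ • p.2.2)}ᶜ⟩, h1 _⟩

lemma IsRegular.isCompact_supertileArrows (hS : S.IsRegular) (n : ℕ) :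
    IsCompact (S.supertileArrows n) := by
  refine (hS.isCompact_vec_le (2 * (S.scale ^ n * S.outradius))).of_isClosed_subset
    (hS.isClopen_supertileArrows n).isClosed ?_
  rintro γ ⟨T₀, hT₀, hT, t, ht, i, j, x, hi, hj, hx⟩
  change ‖γ.vec‖ ≤ _
  rw [hS.vec_eq hx, norm_neg, ← dist_zero_right]
  have h1 := dist_le_of_mem_supertile hi
  have h2 := dist_le_of_mem_supertile hj
  linarith [dist_triangle_right x 0 (S.scale ^ n • t.2)]

lemma monotone_supertileArrows (hprim : S.IsPrimitive) : Monotone S.supertileArrows := by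
  refine monotone_nat_of_le_succ fun n => ?_
  rintro γ ⟨T₀, hT₀, hT, t, ht, i, j, x, hi, hj, hx⟩
  obtain ⟨T₁, hT₁, rfl⟩ := exists_omega_eq hprim hT₀
  obtain ⟨t₁, ht₁, htt⟩ := (mem_iterate_omega (n := 1)).1 ht
  have hsub : S.supertile n t ⊆ S.supertile (n + 1) t₁ := by
    rw [supertile_add]; exact supertile_subset_iterate htt
  exact ⟨T₁, hT₁, hT, t₁, ht₁, i, j, x, hsub hi, hsub hj, hx⟩

lemma IsRegular.one_mem_supertileArrows (hS : S.IsRegular) (n : ℕ) (T : S.PuncturedHull) :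
    S.puncGroupoid.one T ∈ S.supertileArrows n := by
  rw [hS.mem_supertileArrows_iff, hS.vec_one, smul_zero, add_zero]; rfl

lemma IsRegular.inv_mem_supertileArrows (hS : S.IsRegular) {n : ℕ} {γ : S.PuncArrow}
    (h : γ ∈ S.supertileArrows n) : S.puncGroupoid.inv γ ∈ S.supertileArrows n := by
  rw [hS.mem_supertileArrows_iff] at h ⊢
  rw [hS.vec_inv]
  change hS.root n γ.1.1 = ((hS.root n γ.1.2).1, (hS.root n γ.1.2).2 + _)
  rw [h]
  simp

lemma IsRegular.mul_mem_supertileArrows (hS : S.IsRegular) {n : ℕ} {γ ξ : S.PuncArrow}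
    (h : S.puncGroupoid.s γ = S.puncGroupoid.r ξ) (hγ : γ ∈ S.supertileArrows n)
    (hξ : ξ ∈ S.supertileArrows n) : S.puncGroupoid.mul γ ξ h ∈ S.supertileArrows n := by
  rw [hS.mem_supertileArrows_iff] at hγ hξ ⊢
  rw [hS.vec_mul]
  change γ.1.2 = ξ.1.1 at h
  change hS.root n ξ.1.2 = ((hS.root n γ.1.1).1, (hS.root n γ.1.1).2 + _)
  rw [hξ, ← h, hγ, smul_add, add_assoc]

/-! ### The symmetry group acting on the AF filtration. -/

section Symmetry

variable {G : Subgroup (EuclideanSpace ℝ (Fin d) ≃ₗᵢ[ℝ] EuclideanSpace ℝ (Fin d))}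

lemma monotone_supertileSemidirectArrows (hprim : S.IsPrimitive) :
    Monotone (S.supertileSemidirectArrows G) :=
  fun _ _ hmn _ ha => monotone_supertileArrows hprim hmn ha

lemma IsRegular.isOpen_supertileSemidirectArrows (hS : S.IsRegular) (n : ℕ) :
    IsOpen (S.supertileSemidirectArrows G n) :=
  (hS.isClopen_supertileArrows n).isOpen.preimage continuous_semidirect_fst

lemma IsRegular.isCompact_supertileSemidirectArrows [Finite G] (hS : S.IsRegular) (n : ℕ) :
    IsCompact (S.supertileSemidirectArrows G n) := by
  let : TopologicalSpace G := ⊥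
  have : S.supertileSemidirectArrows G n = (S.supertileArrows n) ×ˢ (univ : Set G) := by
    ext a; exact ⟨fun h => ⟨h, trivial⟩, fun h => h.1⟩
  rw [this]
  exact (hS.isCompact_supertileArrows n).prod isCompact_univ

variable [MulAction G ι]

lemma IsRegular.root_actHull (hS : S.IsRegular) (hG : S.IsSymmetryGroup G) (g : G) (n : ℕ)
    (T : S.PuncturedHull) : hS.root n (actHull hG g T) =
      (g • (hS.root n T).1, g.1 (hS.root n T).2) := by
  obtain ⟨T₀, hT₀, hT, ht, i, hi⟩ := hS.isRoot_root n T
  refine hS.root_eq ⟨act g T₀, act_mem_hull hG g hT₀, ?_, mem_image_of_mem _ ht, g • i, ?_⟩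
  · rw [iterate_omega_act hG, hT]; rfl
  · have : S.supertile n (g • (hS.root n T).1, g.1 (hS.root n T).2) =
        act g (S.supertile n (hS.root n T)) := by
      rw [supertile, supertile, ← iterate_omega_act hG]
      simp [act]
    rw [this]
    exact ⟨_, hi, by simp⟩

lemma IsRegular.act_mem_supertileArrows (hS : S.IsRegular) (hG : S.IsSymmetryGroup G) (g : G)
    {n : ℕ} {γ : S.PuncArrow} (h : γ ∈ S.supertileArrows n) :
    actArrow hG g γ ∈ S.supertileArrows n := by
  rw [hS.mem_supertileArrows_iff] at h ⊢
  rw [hS.vec_actArrow]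
  change hS.root n (actHull hG g γ.1.2) = ((hS.root n (actHull hG g γ.1.1)).1,
    (hS.root n (actHull hG g γ.1.1)).2 + _)
  rw [hS.root_actHull, hS.root_actHull, h]
  simp

lemma IsRegular.isSubgroupoid_supertile (hS : S.IsRegular) (hG : S.IsSymmetryGroup G) (n : ℕ) :
    (puncSemidirect hG).IsSubgroupoid (S.supertileSemidirectArrows G n) where
  one_mem T := hS.one_mem_supertileArrows n T
  mul_mem a b h ha hb := by
    have hb' := hS.act_mem_supertileArrows hG a.2 (γ := b.1) hb
    have hab : S.puncGroupoid.s a.1 = S.puncGroupoid.r (actArrow hG a.2 b.1) := by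
      change _ = actHull hG a.2 ((puncSemidirect hG).r b)
      rw [← h]
      change _ = actHull hG a.2 (actHull hG a.2⁻¹ (S.puncGroupoid.s a.1))
      simp
    exact hS.mul_mem_supertileArrows hab ha hb'
  inv_mem a ha := hS.act_mem_supertileArrows hG _ (hS.inv_mem_supertileArrows (γ := a.1) ha)

lemma IsRegular.isSubgroupoid_af (hS : S.IsRegular) (hG : S.IsSymmetryGroup G) :
    (puncSemidirect hG).IsSubgroupoid (S.afSemidirectArrows G) := by
  rw [afSemidirectArrows_eq]
  refine ⟨fun T => mem_iUnion.2 ⟨0, (hS.isSubgroupoid_supertile hG 0).one_mem T⟩,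
    fun a b h ha hb => ?_, fun a ha => ?_⟩
  · obtain ⟨m, hm⟩ := mem_iUnion.1 ha
    obtain ⟨n, hn⟩ := mem_iUnion.1 hb
    exact mem_iUnion.2 ⟨max m n, (hS.isSubgroupoid_supertile hG _).mul_mem a b h
      (monotone_supertileSemidirectArrows hS.prim (le_max_left m n) hm)
      (monotone_supertileSemidirectArrows hS.prim (le_max_right m n) hn)⟩
  · obtain ⟨m, hm⟩ := mem_iUnion.1 ha
    exact mem_iUnion.2 ⟨m, (hS.isSubgroupoid_supertile hG _).inv_mem a hm⟩

/-- Arrows of `R_n` keep the label `i` of the root, and then `g⁻¹` acts on it. Equal ranges and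
sources thus give `g⁻¹ i = h⁻¹ i`, and freeness gives `g = h`. -/
lemma IsRegular.principal_supertile (hS : S.IsRegular) (hG : S.IsSymmetryGroup G)
    (hfree : ∀ (g : G) (i : ι), g • i = i → g = 1) (n : ℕ)
    {a b : SetGroupoid.SemidirectArrow S.PuncArrow G} (ha : a ∈ S.supertileSemidirectArrows G n)
    (hb : b ∈ S.supertileSemidirectArrows G n)
    (hr : (puncSemidirect hG).r a = (puncSemidirect hG).r b)
    (hs : (puncSemidirect hG).s a = (puncSemidirect hG).s b) : a = b := by
  obtain ⟨γ, g⟩ := a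
  obtain ⟨ξ, h⟩ := b
  change γ.1.1 = ξ.1.1 at hr
  change actHull hG g⁻¹ γ.1.2 = actHull hG h⁻¹ ξ.1.2 at hs
  have h1 := hS.mem_supertileArrows_iff.1 ha
  have h2 := hS.mem_supertileArrows_iff.1 hb
  have h3 := congrArg (fun T => (hS.root n T).1) hs
  simp only [hS.root_actHull, h1, h2, hr] at h3
  have hgh : h * g⁻¹ = 1 := hfree _ (hS.root n ξ.1.1).1 (by rw [mul_smul, h3, smul_inv_smul])
  obtain rfl : h = g := mul_inv_eq_one.1 hgh
  have h4 := (actHull hG h⁻¹).injective hs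
  exact Prod.ext (Subtype.ext (Prod.ext hr h4)) rfl

lemma IsRegular.isAF [Nonempty ι] [Finite G] (hS : S.IsRegular) (hG : S.IsSymmetryGroup G)
    (hfree : ∀ (g : G) (i : ι), g • i = i → g = 1) :
    ((puncSemidirect hG).restrict (hS.isSubgroupoid_af hG)).IsAF :=
  (hS.isCantor_semidirect hG).isAF_restrict _ (S.supertileSemidirectArrows G)
    (monotone_supertileSemidirectArrows hS.prim) afSemidirectArrows_eq
    hS.isCompact_supertileSemidirectArrows hS.isOpen_supertileSemidirectArrows
    (hS.isSubgroupoid_supertile hG)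
    fun n _ ha _ hb hr hs => hS.principal_supertile hG hfree n ha hb hr hs

end Symmetry

end SubstitutionSystem

/-! ### Thin sets -/

namespace SubstitutionSystem

open Filter Topology

variable {d : ℕ} {ι : Type*} {S : SubstitutionSystem d ι}

/-- The label of the tile with puncture at the origin. -/
noncomputable def PuncturedHull.label (T : S.PuncturedHull) : ι := T.2.2.choose

lemma PuncturedHull.label_mem (T : S.PuncturedHull) : (T.label, 0) ∈ T.1 := T.2.2.choose_spec

variable [Finite ι]

/-- The segment from a tile of a supertile to a tile outside of it meets the boundary of the
supertile. -/
lemma exists_frontier_dist_le {T : Set (Tile d ι)} (hT : IsPartialTiling S.shape T) {n : ℕ}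
    {t : Tile d ι} (ht : S.supertile n t ⊆ T) {u w : Tile d ι} (hu : u ∈ S.supertile n t)
    (hw : w ∈ T) (hwt : w ∉ S.supertile n t) :
    ∃ z ∈ frontier (S.shape t.1), dist (u.2 - S.scale ^ n • t.2) (S.scale ^ n • z) ≤
      dist u.2 w.2 := by
  set B := tileSupport S.shape (S.supertile n t) with hB
  have hu' : u.2 ∈ interior B := mem_interior.2 ⟨interior (tileSet S.shape u), fun y hy =>
    mem_tileSupport.2 ⟨u, hu, interior_subset hy⟩, isOpen_interior, S.mem_interior_tileSet_self u⟩
  -- Otherwise the supertile would cover an open part of `w` and hence contain `w`.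
  have hw' : w.2 ∉ interior B := fun h => hwt <|
    mem_of_open_subset_support hT ht hw (isOpen_interior.inter isOpen_interior)
      ⟨w.2, h, S.mem_interior_tileSet_self w⟩ inter_subset_right
      (inter_subset_left.trans interior_subset)
  have hseg : ∃ p ∈ segment ℝ u.2 w.2, p ∈ frontier B := by
    by_contra! hcon
    refine hw' ((convex_segment u.2 w.2).isPreconnected.subset_left_of_subset_union
      isOpen_interior (isOpen_interior (s := Bᶜ)) ?_ (fun p hp => ?_)
      ⟨u.2, left_mem_segment ℝ _ _, hu'⟩ (right_mem_segment ℝ _ _))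
    · exact Set.disjoint_left.2 fun p hp hp' => interior_subset hp' (interior_subset hp)
    · by_contra h
      rw [mem_union, not_or, interior_compl, mem_compl_iff, not_not] at h
      exact hcon p hp ⟨h.2, h.1⟩
  obtain ⟨p, hp, hpB⟩ := hseg
  have hBeq : B = S.shrink n ⁻¹' (Homeomorph.subRight t.2 ⁻¹' S.shape t.1) := by
    ext y
    rw [hB, mem_tileSupport_supertile, tileSet_eq_preimage]; rfl
  rw [hBeq, ← Homeomorph.preimage_frontier, ← Homeomorph.preimage_frontier] at hpB
  refine ⟨_, hpB, ?_⟩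
  change dist _ (S.scale ^ n • ((S.scale ^ n)⁻¹ • p - t.2)) ≤ _
  rw [smul_sub, smul_inv_smul₀ (S.scale_pow_ne n), dist_sub_right, dist_comm]
  exact Metric.mem_closedBall.1 (segment_subset_closedBall_left _ _ hp)

lemma sub_mem_nearBoundary {T : Set (Tile d ι)} (hT : IsPartialTiling S.shape T) {n : ℕ}
    {t : Tile d ι} (ht : S.supertile n t ⊆ T) {u w : Tile d ι} (hu : u ∈ S.supertile n t)
    (hw : w ∈ T) (hwt : w ∉ S.supertile n t) {R : ℝ} (hR : dist u.2 w.2 ≤ R) :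
    (u.1, u.2 - S.scale ^ n • t.2) ∈ S.nearBoundary n t.1 R := by
  obtain ⟨z, hz, hd⟩ := exists_frontier_dist_le hT ht hu hw hwt
  refine ⟨?_, z, hz, hd.trans hR⟩
  rw [← Prod.mk.eta (p := t), supertile_eq_translate, mem_translateTiles] at hu
  exact hu

/-- Disjoint copies of the tiles near the boundary inside a supertile. -/
lemma exists_copies (N : ℕ) (R : ℝ) : ∃ (n : ℕ) (φ : ι → Fin N × Tile d ι → Tile d ι), ∀ i,
    (∀ k, ∀ u ∈ S.nearBoundary n i R, φ i (k, u) ∈ S.supertile n (i, 0)) ∧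
    InjOn (φ i) (univ ×ˢ S.nearBoundary n i R) := by
  -- With this `δ`, `N` times the number of tiles near the boundary is at most the number of all
  -- tiles, so an injection exists.
  obtain ⟨n, hn⟩ := S.exists_nearBoundary_small R (δ := 1 / (N + 1)) (by positivity)
  have : ∀ i, ∃ φ : Fin N × Tile d ι → Tile d ι,
      univ ×ˢ S.nearBoundary n i R ⊆ φ ⁻¹' S.supertile n (i, 0) ∧
        InjOn φ (univ ×ˢ S.nearBoundary n i R) := by
    intro i
    have : Nonempty (Tile d ι) := ⟨(i, 0)⟩
    have hfin := S.supertile_finite n (i, 0)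
    have hfin' : (S.nearBoundary n i R).Finite := hfin.subset (sep_subset _ _)
    have hfin'' : ((univ : Set (Fin N)) ×ˢ S.nearBoundary n i R).Finite := finite_univ.prod hfin'
    refine hfin''.exists_injOn_of_encard_le ?_
    rw [← hfin''.cast_ncard_eq, ← hfin.cast_ncard_eq, Nat.cast_le, Set.ncard_prod]
    simp only [Set.ncard_univ, Nat.card_eq_fintype_card, Fintype.card_fin]
    have h := hn n le_rfl i
    rw [div_mul_eq_mul_div, one_mul, le_div_iff₀ (by positivity)] at h
    have h' : (S.nearBoundary n i R).ncard * (N + 1) ≤ (S.supertile n (i, 0)).ncard := by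
      exact_mod_cast h
    nlinarith
  choose φ h1 h2 using this
  exact ⟨n, φ, fun i => ⟨fun k u hu => h1 i (show (k, u) ∈ univ ×ˢ _ from ⟨trivial, hu⟩), h2 i⟩⟩

lemma isLocallyConstant_label : IsLocallyConstant (PuncturedHull.label (S := S)) := by
  refine (IsLocallyConstant.iff_eventually_eq _).2 fun T => ?_
  filter_upwards [cylinder_mem_nhds (finite_singleton _) (singleton_subset_iff.2 T.label_mem)]
    with T' hT'
  exact congrArg Prod.fst (S.eq_of_snd_eq T'.2.1.1 T'.label_mem (hT' rfl) rfl)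

lemma IsRegular.label_mem_supertile (hS : S.IsRegular) (n : ℕ) (T : S.PuncturedHull) :
    (T.label, 0) ∈ S.supertile n (hS.root n T) := by
  have h := (hS.isRoot_root n T).supertile_subset
  obtain ⟨-, -, -, -, i, hi⟩ := hS.isRoot_root n T
  rwa [← S.eq_of_snd_eq T.2.1.1 (h hi) T.label_mem rfl]

/-- The position of the tile at the origin within its supertile. -/
noncomputable def IsRegular.position (hS : S.IsRegular) (n : ℕ) (T : S.PuncturedHull) : Tile d ι :=
  (T.label, -(S.scale ^ n • (hS.root n T).2))

/-- The unit `T` lies at distance at most `R` from the boundary of its supertiles of all orders. -/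
def IsRegular.NearAllBoundaries (hS : S.IsRegular) (R : ℝ) (T : S.PuncturedHull) : Prop :=
  ∃ w ∈ T.1, ‖w.2‖ ≤ R ∧ ∀ n, w ∉ S.supertile n (hS.root n T)

lemma IsRegular.NearAllBoundaries.position_mem {hS : S.IsRegular} {R : ℝ} {T : S.PuncturedHull}
    (h : hS.NearAllBoundaries R T) (n : ℕ) :
    hS.position n T ∈ S.nearBoundary n (hS.root n T).1 R := by
  obtain ⟨w, hw, hR, hwn⟩ := h
  have := sub_mem_nearBoundary T.2.1.1 (hS.isRoot_root n T).supertile_subset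
    (hS.label_mem_supertile n T) hw (hwn n) (R := R) (by simpa using hR)
  simpa [IsRegular.position] using this

variable {G : Subgroup (EuclideanSpace ℝ (Fin d) ≃ₗᵢ[ℝ] EuclideanSpace ℝ (Fin d))}
  [MulAction G ι]

/-- A compact set of units which stay near the boundaries of their supertiles is thin. -/
lemma IsRegular.isThin (hS : S.IsRegular) (hG : S.IsSymmetryGroup G) {A : Set S.PuncturedHull}
    (hA : IsCompact A) {R : ℝ} (hR : ∀ T ∈ A, hS.NearAllBoundaries R T) :
    ((puncSemidirect hG).restrict (hS.isSubgroupoid_af hG)).IsThin A := by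
  refine ⟨hA, fun N => ?_⟩
  obtain ⟨n, φ, hφ⟩ := exists_copies (S := S) N R
  -- `q k T` is the place, relative to the supertile, that `φ` assigns to the `k`-th copy of the
  -- tile at the origin; translation by `v k T` brings it to the origin.
  let q : Fin N → S.PuncturedHull → Tile d ι := fun k T =>
    φ (hS.root n T).1 (k, hS.position n T)
  let v : Fin N → S.PuncturedHull → EuclideanSpace ℝ (Fin d) := fun k T =>
    -((q k T).2 + S.scale ^ n • (hS.root n T).2)
  have hq : ∀ k, ∀ T ∈ A, q k T ∈ S.supertile n ((hS.root n T).1, 0) := fun k T hT =>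
    (hφ _).1 k _ ((hR T hT).position_mem n)
  have hqv : ∀ k, ∀ T ∈ A, ((q k T).1, -v k T) ∈ S.supertile n (hS.root n T) := fun k T hT => by
    rw [← Prod.mk.eta (p := hS.root n T), supertile_eq_translate, mem_translateTiles]
    simpa [v] using hq k T hT
  have hv : ∀ k, ∀ T ∈ A, ∃ j, (j, -v k T) ∈ T.1 := fun k T hT =>
    ⟨_, (hS.isRoot_root n T).supertile_subset (hqv k T hT)⟩
  let σ : Fin N → A → S.PuncArrow := fun k T => shiftArrow T.1 (v k T) (hv k T T.2)
  have hvec : ∀ k T, (σ k T).vec = v k T := fun k T => hS.vec_shiftArrow _ _ _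
  have hσn : ∀ k T, σ k T ∈ S.supertileArrows n := fun k T =>
    hS.mem_supertileArrows_of_mem (j := (q k T).1) (by rw [hvec]; exact hqv k T T.2)
  -- The vector depends only on the root and the label, both locally constant.
  have hvlc : ∀ k, IsLocallyConstant (v k) := fun k =>
    (((hS.isLocallyConstant_root n).prodMk isLocallyConstant_label).comp
      fun p : Tile d ι × ι => -((φ p.1.1 (k, (p.2, -(S.scale ^ n • p.1.2)))).2 +
        S.scale ^ n • p.1.2))
  have hσc : ∀ k, Continuous (σ k) := fun k => hS.continuous_of_range continuous_subtype_val
    fun T => by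
      filter_upwards [continuous_subtype_val.continuousAt.eventually
        ((IsLocallyConstant.iff_eventually_eq _).1 (hvlc k) T.1)] with T' hT'
      rw [hvec, hvec]; exact hT'
  have hroot : ∀ k T, hS.root n (σ k T).1.2 =
      ((hS.root n T.1).1, -((S.scale ^ n)⁻¹ • (q k T).2)) := fun k T => by
    rw [hS.mem_supertileArrows_iff.1 (hσn k T), hvec]
    refine Prod.ext rfl ?_
    change (hS.root n T.1).2 + (S.scale ^ n)⁻¹ • -((q k T).2 + S.scale ^ n • (hS.root n T.1).2) = _
    rw [smul_neg, smul_add, inv_smul_smul₀ (S.scale_pow_ne n), neg_add_rev, add_neg_cancel_left]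
  -- The root of the endpoint gives the label of the supertile and `q k T`. Injectivity of `φ`
  -- recovers `k` and the position of the origin in the supertile, hence the vector and `T`.
  have key : ∀ k l T T', (σ k T).1.2 = (σ l T').1.2 → k = l ∧ T = T' := by
    intro k l T T' h
    have h1 := congrArg (hS.root n) h
    rw [hroot, hroot, Prod.mk.injEq, neg_inj,
      smul_right_inj (inv_ne_zero (S.scale_pow_ne n))] at h1
    have h2 : q k T = q l T' := by
      refine S.eq_of_snd_eq (isPartialTiling_supertile n ((hS.root n T.1).1, 0)) (hq k T T.2) ?_ h1.2
      rw [h1.1]; exact hq l T' T'.2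
    have h3 := (hR T T.2).position_mem n
    have h4 := (hR T' T'.2).position_mem n
    change φ (hS.root n T.1).1 _ = φ (hS.root n T'.1).1 _ at h2
    rw [← h1.1] at h2 h4
    have h5 := (hφ _).2 (show (k, _) ∈ univ ×ˢ _ from ⟨trivial, h3⟩)
      (show (l, _) ∈ univ ×ˢ _ from ⟨trivial, h4⟩) h2
    rw [Prod.mk.injEq] at h5
    have h6 : (hS.root n T.1).2 = (hS.root n T'.1).2 := by
      have := congrArg Prod.snd h5.2
      simpa [IsRegular.position, S.scale_ne] using this
    have h7 : v k T = v l T' := by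
      change -((q k T).2 + _) = -((q l T').2 + _)
      rw [h1.2, h6]
    refine ⟨h5.1, Subtype.ext ?_⟩
    have h8 := congrArg Subtype.val h
    rw [(σ k T).eq_translate, (σ l T').eq_translate, hvec, hvec, h7] at h8
    have h9 := congrArg (fun P => translateTiles P (-v l T')) h8
    simp only [translateTiles_add, add_neg_cancel, translateTiles_zero] at h9
    exact Subtype.ext h9
  let f : Fin N → A → S.afSemidirectArrows G := fun k T =>
    ⟨(S.puncGroupoid.inv (σ k T), 1),
      mem_iUnion.2 ⟨n, hS.inv_mem_supertileArrows (hσn k T)⟩⟩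
  have hfs : ∀ k T, ((puncSemidirect hG).restrict (hS.isSubgroupoid_af hG)).s (f k T) = T.1 := by
    intro k T
    change actHull hG (1 : G)⁻¹ T.1 = T.1
    simp
  have hfr : ∀ k T, ((puncSemidirect hG).restrict (hS.isSubgroupoid_af hG)).r (f k T) =
      (σ k T).1.2 := fun k T => rfl
  have hfc : ∀ k, Continuous (f k) := fun k => by
    let : TopologicalSpace G := ⊥
    refine Continuous.subtype_mk ?_ _
    exact Continuous.prodMk (hS.isTopological.continuous_inv.comp (hσc k)) continuous_const
  have := isCompact_iff_compactSpace.1 hA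
  refine ⟨fun k => range (f k), fun k => ⟨isCompact_range (hfc k), ⟨?_, ?_⟩, ?_⟩, ?_⟩
  · rintro _ ⟨T, rfl⟩ _ ⟨T', rfl⟩ h
    rw [hfr, hfr] at h
    rw [(key k k T T' h).2]
  · rintro _ ⟨T, rfl⟩ _ ⟨T', rfl⟩ h
    rw [hfs, hfs] at h
    rw [Subtype.ext h]
  · ext T
    constructor
    · rintro ⟨_, ⟨T', rfl⟩, rfl⟩
      rw [hfs]; exact T'.2
    · exact fun hT => ⟨_, ⟨⟨T, hT⟩, rfl⟩, hfs k _⟩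
  · intro k l hkl
    refine Set.disjoint_left.2 ?_
    rintro _ ⟨_, ⟨T, rfl⟩, rfl⟩ ⟨_, ⟨T', rfl⟩, h⟩
    rw [hfr, hfr] at h
    exact hkl (key l k T' T h).1.symm

/-- Compactness bounds the vectors by some `R`. From a source unit, the inverse arrow leads to a
puncture within `R` of the origin; if that puncture shared a supertile with the origin, the arrow
would lie in `R_AF ⋊ G`. -/
lemma IsRegular.isThin_source (hS : S.IsRegular) (hG : S.IsSymmetryGroup G)
    {K : Set (SetGroupoid.SemidirectArrow S.PuncArrow G)} (hK : IsCompact K)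
    (hsub : K ⊆ (S.afSemidirectArrows G)ᶜ) (hs : Continuous (puncSemidirect hG).s) :
    ((puncSemidirect hG).restrict (hS.isSubgroupoid_af hG)).IsThin ((puncSemidirect hG).s '' K) := by
  obtain ⟨R, hR⟩ := (hK.image
    (hS.isLocallyConstant_vec.continuous.comp continuous_semidirect_fst)).isBounded.exists_norm_le
  refine hS.isThin hG (hK.image hs) (R := R) ?_
  rintro _ ⟨⟨γ, g⟩, hγK, rfl⟩
  set ξ := actArrow hG g⁻¹ (S.puncGroupoid.inv γ)
  have hvec : ξ.vec = g⁻¹.1 (-γ.vec) := by rw [hS.vec_actArrow, hS.vec_inv]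
  change hS.NearAllBoundaries R ξ.1.1
  obtain ⟨j, hj⟩ := ξ.exists_mem
  refine ⟨_, hj, ?_, fun n hn => hsub hγK ?_⟩
  · simp only [hvec, norm_neg, LinearIsometryEquiv.norm_map]
    exact hR _ ⟨(γ, g), hγK, rfl⟩
  · have h1 := hS.act_mem_supertileArrows hG g (hS.mem_supertileArrows_of_mem hn)
    rw [show actArrow hG g ξ = S.puncGroupoid.inv γ by simp [ξ]] at h1
    exact mem_iUnion.2 ⟨n, hS.inv_mem_supertileArrows h1⟩

end SubstitutionSystem

/-! ### Invariant measures -/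

section GroupoidMeasure

open MeasureTheory

/-- Invariance of a measure may be checked on the members of a countable partition of the arrows
into open sets. -/
lemma SetGroupoid.isInvariantMeasure_of_partition {X Γ : Type*} [TopologicalSpace X]
    [TopologicalSpace Γ] [MeasurableSpace X] [BorelSpace X] {𝒢 : SetGroupoid X Γ}
    (h : 𝒢.IsEtale) (μ : Measure X) {κ : Type*} [Countable κ] (B : κ → Set Γ)
    (hB : ∀ k, IsOpen (B k)) (hdisj : Pairwise fun k l => Disjoint (B k) (B l))
    (hcov : ⋃ k, B k = univ)
    (hμ : ∀ k, ∀ V ⊆ B k, IsOpen V → μ (𝒢.r '' V) = μ (𝒢.s '' V)) : 𝒢.IsInvariantMeasure μ := by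
  intro V hV hgraph
  have key : ∀ f : Γ → X, IsOpenMap f → InjOn f V → μ (f '' V) = ∑' k, μ (f '' (V ∩ B k)) := by
    intro f hf hinj
    rw [← measure_iUnion, ← image_iUnion, ← inter_iUnion, hcov, inter_univ]
    · intro k l hkl
      refine Set.disjoint_left.2 ?_
      rintro _ ⟨a, ha, rfl⟩ ⟨b, hb, hab⟩
      rw [hinj hb.1 ha.1 hab] at hb
      exact Set.disjoint_left.1 (hdisj hkl) ha.2 hb.2
    · exact fun k => (hf _ (hV.inter (hB k))).measurableSet
  rw [key 𝒢.r h.isLocalHomeomorph_r.isOpenMap hgraph.1,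
    key 𝒢.s h.isLocalHomeomorph_s.isOpenMap hgraph.2]
  exact tsum_congr fun k => hμ k _ inter_subset_right (hV.inter (hB k))

end GroupoidMeasure

namespace SubstitutionSystem

open Filter Topology MeasureTheory

variable {d : ℕ} {ι : Type*} {S : SubstitutionSystem d ι}

/-- The translates by `v`, as far as they belong to the punctured hull, of the tilings in `C`. -/
def shiftSet (v : EuclideanSpace ℝ (Fin d)) (C : Set S.PuncturedHull) : Set S.PuncturedHull :=
  {T | ∃ T' ∈ C, T.1 = translateTiles T'.1 v}

lemma mem_shiftSet_iff {v : EuclideanSpace ℝ (Fin d)} {C : Set S.PuncturedHull}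
    {T : S.PuncturedHull} :
    T ∈ shiftSet v C ↔ ∃ h : ∃ j, (j, -(-v)) ∈ T.1, shift T (-v) h ∈ C := by
  constructor
  · rintro ⟨T', hT', h⟩
    obtain ⟨j, hj⟩ := T'.2.2
    refine ⟨⟨j, ?_⟩, ?_⟩
    · rw [h, neg_neg, mem_translateTiles]; simpa using hj
    · convert hT'
      refine Subtype.ext ?_
      change translateTiles T.1 (-v) = _
      rw [h, translateTiles_add, add_neg_cancel, translateTiles_zero]
  · rintro ⟨h, hC⟩
    refine ⟨_, hC, ?_⟩
    change _ = translateTiles (translateTiles T.1 (-v)) v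
    rw [translateTiles_add, neg_add_cancel, translateTiles_zero]

/-- The tilings whose translate by `v` belongs to the punctured hull. -/
def shiftDomain (S : SubstitutionSystem d ι) (v : EuclideanSpace ℝ (Fin d)) :
    Set S.PuncturedHull := {T | ∃ j, (j, -v) ∈ T.1}

lemma shiftSet_shiftSet {v : EuclideanSpace ℝ (Fin d)} {C : Set S.PuncturedHull}
    (hC : C ⊆ S.shiftDomain v) : shiftSet (-v) (shiftSet v C) = C := by
  ext T
  constructor
  · rintro ⟨T', ⟨T'', hT'', h'⟩, h⟩
    rw [h', translateTiles_add, add_neg_cancel, translateTiles_zero] at h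
    rwa [Subtype.ext h]
  · intro hT
    refine ⟨shift T v (hC hT), ⟨T, hT, rfl⟩, ?_⟩
    change _ = translateTiles (translateTiles T.1 v) (-v)
    rw [translateTiles_add, add_neg_cancel, translateTiles_zero]

lemma shiftSet_subset_domain (v : EuclideanSpace ℝ (Fin d)) (C : Set S.PuncturedHull) :
    shiftSet v C ⊆ S.shiftDomain (-v) := fun _ hT => (mem_shiftSet_iff.1 hT).1

open Classical in
/-- The translate by `v` if it belongs to the punctured hull. -/
noncomputable def shiftOrSelf (T : S.PuncturedHull) (v : EuclideanSpace ℝ (Fin d)) :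
    S.PuncturedHull := if h : ∃ j, (j, -v) ∈ T.1 then shift T v h else T

lemma shiftOrSelf_val {T : S.PuncturedHull} {u : Tile d ι} (hu : u ∈ T.1) :
    (shiftOrSelf T (-u.2)).1 = translateTiles T.1 (-u.2) := by
  have h : ∃ j, (j, -(-u.2)) ∈ T.1 := ⟨u.1, by simpa using hu⟩
  rw [shiftOrSelf, dif_pos h]; rfl

section

variable {G : Subgroup (EuclideanSpace ℝ (Fin d) ≃ₗᵢ[ℝ] EuclideanSpace ℝ (Fin d))}
  [MulAction G ι]

lemma preimage_actHull_shiftSet (hG : S.IsSymmetryGroup G) (g : G)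
    (v : EuclideanSpace ℝ (Fin d)) (U : Set S.PuncturedHull) :
    actHull hG g ⁻¹' shiftSet v U = shiftSet (g⁻¹.1 v) (actHull hG g ⁻¹' U) := by
  ext T
  constructor
  · rintro ⟨T', hT', h⟩
    refine ⟨actHull hG g⁻¹ T', by simpa using hT', ?_⟩
    change T.1 = translateTiles (act g⁻¹ T'.1) (g⁻¹.1 v)
    rw [← act_translateTiles, ← h]
    change T.1 = act g⁻¹ (act g T.1)
    rw [← act_mul, inv_mul_cancel, act_one]
  · rintro ⟨T', hT', h⟩
    refine ⟨_, hT', ?_⟩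
    change act g T.1 = translateTiles (act g T'.1) v
    rw [h, act_translateTiles]
    simp

lemma preimage_actHull_subset_domain (hG : S.IsSymmetryGroup G) (g : G)
    {v : EuclideanSpace ℝ (Fin d)} {U : Set S.PuncturedHull} (hU : U ⊆ S.shiftDomain v) :
    actHull hG g ⁻¹' U ⊆ S.shiftDomain (g⁻¹.1 v) := by
  intro T hT
  obtain ⟨j, hj⟩ := hU hT
  exact ⟨g⁻¹ • j, by simpa using mem_act.1 hj⟩

end

variable [Finite ι]

lemma isOpen_shiftDomain (v : EuclideanSpace ℝ (Fin d)) : IsOpen (S.shiftDomain v) :=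
  (isClopen_setOf_exists_mem (-v)).isOpen

lemma IsRegular.shiftSet_eq_image (hS : S.IsRegular) (v : EuclideanSpace ℝ (Fin d))
    (C : Set S.PuncturedHull) :
    shiftSet v C = (fun γ : S.PuncArrow => γ.1.2) '' {γ | γ.1.1 ∈ C ∧ γ.vec = v} := by
  ext T
  constructor
  · rintro ⟨T', hT', h⟩
    exact ⟨⟨(T', T), v, h⟩, ⟨hT', hS.vec_eq h⟩, rfl⟩
  · rintro ⟨γ, ⟨h1, rfl⟩, rfl⟩
    exact ⟨_, h1, γ.eq_translate⟩

lemma IsRegular.isOpen_shiftSet [Nonempty ι] (hS : S.IsRegular) (v : EuclideanSpace ℝ (Fin d))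
    {C : Set S.PuncturedHull} (hC : IsOpen C) : IsOpen (shiftSet v C) := by
  rw [hS.shiftSet_eq_image]
  exact hS.isCantor.isLocalHomeomorph_s.isOpenMap _
    ((hC.preimage hS.continuous_range).inter (hS.isClopen_vec_fiber v).isOpen)

lemma IsRegular.isClopen_shiftSet [Nonempty ι] (hS : S.IsRegular)
    (v : EuclideanSpace ℝ (Fin d)) {C : Set S.PuncturedHull} (hC : IsClopen C) :
    IsClopen (shiftSet v C) := by
  refine ⟨?_, hS.isOpen_shiftSet v hC.isOpen⟩
  have := hS.t2Space
  rw [hS.shiftSet_eq_image]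
  refine (((hS.isCompact_vec_fiber v).inter_left
    (hC.isClosed.preimage hS.continuous_range)).image hS.continuous_source).isClosed

/-- Every orbit meets every nonempty open set. -/
lemma IsRegular.exists_arrow_mem (hS : S.IsRegular) (T : S.PuncturedHull)
    {U : Set S.PuncturedHull} (hU : IsOpen U) (hne : U.Nonempty) :
    ∃ γ : S.PuncArrow, γ.1.1 = T ∧ γ.1.2 ∈ U := by
  obtain ⟨T', hT'⟩ := hne
  obtain ⟨P, hP, hfin, hPU⟩ := isOpen_iff_cylinder.1 hU T' hT'
  obtain ⟨j, hj⟩ := T'.2.2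
  obtain ⟨x, -, -, hx, -⟩ := exists_translates_subset hS.prim (P := insert (j, 0) P)
    (fun Q hQ => T'.2.1.2.2 Q (hQ.trans (insert_subset hj hP))) (hfin.insert _) (by simp) T.2.1
  rw [translateTiles_subset_iff] at hx
  have h1 : (j, -(-x)) ∈ T.1 := by simpa [mem_translateTiles] using hx (mem_insert _ _)
  exact ⟨shiftArrow T (-x) ⟨j, h1⟩, rfl, hPU ((subset_insert _ _).trans hx)⟩

/-- The tiles of the `n`-th order supertile at the origin. -/
noncomputable def IsRegular.sample (hS : S.IsRegular) (T : S.PuncturedHull) (n : ℕ) :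
    Finset (Tile d ι) := (S.supertile_finite n (hS.root n T)).toFinset

lemma IsRegular.mem_sample {hS : S.IsRegular} {T : S.PuncturedHull} {n : ℕ} {u : Tile d ι} :
    u ∈ hS.sample T n ↔ u ∈ S.supertile n (hS.root n T) := Finite.mem_toFinset _

lemma IsRegular.sample_nonempty (hS : S.IsRegular) (T : S.PuncturedHull) (n : ℕ) :
    (hS.sample T n).Nonempty :=
  ⟨_, IsRegular.mem_sample.2 (hS.label_mem_supertile n T)⟩

lemma IsRegular.card_sample_pos (hS : S.IsRegular) (T : S.PuncturedHull) (n : ℕ) :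
    (0 : ℝ) < (hS.sample T n).card := by
  exact_mod_cast (hS.sample_nonempty T n).card_pos

lemma IsRegular.sample_subset {hS : S.IsRegular} {T : S.PuncturedHull} {n : ℕ} {u : Tile d ι}
    (hu : u ∈ hS.sample T n) : u ∈ T.1 :=
  (hS.isRoot_root n T).supertile_subset (IsRegular.mem_sample.1 hu)

open Classical in
/-- The number of visits of `C` from the tiles of a supertile. -/
noncomputable def IsRegular.visits (hS : S.IsRegular) (T : S.PuncturedHull) (n : ℕ)
    (C : Set S.PuncturedHull) : Finset (Tile d ι) :=
  (hS.sample T n).filter fun u => shiftOrSelf T (-u.2) ∈ C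

lemma IsRegular.mem_visits {hS : S.IsRegular} {T : S.PuncturedHull} {n : ℕ}
    {C : Set S.PuncturedHull} {u : Tile d ι} :
    u ∈ hS.visits T n C ↔ u ∈ hS.sample T n ∧ shiftOrSelf T (-u.2) ∈ C := by
  classical
  exact Finset.mem_filter

/-- A visit of `C` at `u` yields a visit of the translate at `u - v`, unless `u - v` leaves the
supertile; then `u` is within `‖v‖` of the boundary. -/
lemma IsRegular.card_visits_le (hS : S.IsRegular) (T : S.PuncturedHull) (n : ℕ)
    (v : EuclideanSpace ℝ (Fin d)) {C : Set S.PuncturedHull} (hC : C ⊆ S.shiftDomain v) :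
    (hS.visits T n C).card ≤ (hS.visits T n (shiftSet v C)).card +
      (S.nearBoundary n (hS.root n T).1 ‖v‖).ncard := by
  classical
  set t := hS.root n T
  have ht := (hS.isRoot_root n T).supertile_subset
  have hnear : (S.nearBoundary n t.1 ‖v‖).Finite :=
    (S.supertile_finite n (t.1, 0)).subset (sep_subset _ _)
  have hw : ∀ u ∈ hS.visits T n C, ∃ j, (j, u.2 - v) ∈ T.1 := by
    intro u hu
    have hu := IsRegular.mem_visits.1 hu
    obtain ⟨j, hj⟩ := hC hu.2
    rw [shiftOrSelf_val (IsRegular.sample_subset hu.1), mem_translateTiles] at hj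
    exact ⟨j, by simpa [sub_eq_add_neg, add_comm] using hj⟩
  have : Nonempty ι := ⟨t.1⟩
  choose! j hj using hw
  set D := (hS.visits T n C).filter fun u => (j u, u.2 - v) ∈ hS.sample T n
  set D' := (hS.visits T n C).filter fun u => (j u, u.2 - v) ∉ hS.sample T n
  rw [← Finset.card_filter_add_card_filter_not (s := hS.visits T n C)
    fun u => (j u, u.2 - v) ∈ hS.sample T n]
  have hinj : ∀ u ∈ hS.visits T n C, ∀ u' ∈ hS.visits T n C, u.2 = u'.2 → u = u' :=
    fun u hu u' hu' h => S.eq_of_snd_eq T.2.1.1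
      (IsRegular.sample_subset (IsRegular.mem_visits.1 hu).1)
      (IsRegular.sample_subset (IsRegular.mem_visits.1 hu').1) h
  refine add_le_add ?_ ?_
  · refine Finset.card_le_card_of_injOn (fun u => (j u, u.2 - v)) (fun u hu => ?_)
      fun u hu u' hu' h => ?_
    · obtain ⟨hu1, hu2⟩ := Finset.mem_filter.1 hu
      refine IsRegular.mem_visits.2 ⟨hu2, shiftOrSelf T (-u.2), (IsRegular.mem_visits.1 hu1).2, ?_⟩
      rw [shiftOrSelf_val (hj u hu1),
        shiftOrSelf_val (IsRegular.sample_subset (IsRegular.mem_visits.1 hu1).1),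
        translateTiles_add]
      congr 1
      simp only [neg_sub]; abel
    · exact hinj u (Finset.mem_filter.1 hu).1 u' (Finset.mem_filter.1 hu').1
        (sub_left_injective (Prod.ext_iff.1 h).2)
  · rw [Set.ncard_eq_toFinset_card _ hnear]
    refine Finset.card_le_card_of_injOn (fun u => (u.1, u.2 - S.scale ^ n • t.2)) (fun u hu => ?_)
      fun u hu u' hu' h => ?_
    · obtain ⟨hu1, hu2⟩ := Finset.mem_filter.1 hu
      rw [hnear.coe_toFinset]
      refine sub_mem_nearBoundary T.2.1.1 ht (IsRegular.mem_sample.1 (IsRegular.mem_visits.1 hu1).1)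
        (hj u hu1) (fun h => hu2 (IsRegular.mem_sample.2 h)) ?_
      simp
    · exact hinj u (Finset.mem_filter.1 hu).1 u' (Finset.mem_filter.1 hu').1
        (sub_left_injective (Prod.ext_iff.1 h).2)

lemma IsRegular.card_sample (hS : S.IsRegular) (T : S.PuncturedHull) (n : ℕ) :
    (hS.sample T n).card = (S.supertile n ((hS.root n T).1, 0)).ncard := by
  rw [IsRegular.sample, ← Set.ncard_eq_toFinset_card _ (S.supertile_finite n (hS.root n T)), ← Prod.mk.eta (p := hS.root n T),
    supertile_eq_translate, translateTiles]
  exact Set.ncard_image_of_injective _ fun u u' h =>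
    Prod.ext (Prod.ext_iff.1 h).1 (add_left_injective _ (Prod.ext_iff.1 h).2)

lemma totallySeparatedSpace : TotallySeparatedSpace S.PuncturedHull :=
  totallySeparatedSpace_iff_exists_isClopen.2 fun _ _ hne => by
    obtain ⟨t, ht, htT'⟩ := PuncturedHull.exists_mem_cylinder_notMem hne
    exact ⟨_, isClopen_cylinder_singleton t, singleton_subset_iff.2 ht, htT'⟩

lemma IsRegular.countable_vec (hS : S.IsRegular) :
    {v : EuclideanSpace ℝ (Fin d) | ∃ γ : S.PuncArrow, γ.vec = v}.Countable := by
  refine (countable_iUnion fun n : ℕ => (hS.finite_vec n).countable).mono fun v hv => ?_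
  obtain ⟨n, hn⟩ := exists_nat_ge ‖v‖
  exact mem_iUnion.2 ⟨n, hn, hv⟩

variable [MeasurableSpace S.PuncturedHull]

/-- The uniform distribution on the translates of `T` by the punctures of a supertile. -/
noncomputable def IsRegular.average (hS : S.IsRegular) (T : S.PuncturedHull) (n : ℕ) :
    Measure S.PuncturedHull :=
  ((hS.sample T n).card : ENNReal)⁻¹ • ∑ u ∈ hS.sample T n, Measure.dirac (shiftOrSelf T (-u.2))

lemma IsRegular.average_apply (hS : S.IsRegular) (T : S.PuncturedHull) (n : ℕ)
    {C : Set S.PuncturedHull} (hC : MeasurableSet C) :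
    hS.average T n C = ((hS.sample T n).card : ENNReal)⁻¹ * (hS.visits T n C).card := by
  classical
  rw [IsRegular.average, Measure.smul_apply, smul_eq_mul, Measure.finsetSum_apply,
    IsRegular.visits, Finset.card_filter]
  congr 1
  push_cast
  refine Finset.sum_congr rfl fun u _ => ?_
  rw [Measure.dirac_apply' _ hC, indicator_apply]
  rfl

lemma IsRegular.isProbabilityMeasure_average (hS : S.IsRegular) (T : S.PuncturedHull) (n : ℕ) :
    IsProbabilityMeasure (hS.average T n) := by
  refine ⟨?_⟩
  have : hS.visits T n univ = hS.sample T n := by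
    ext u; simp [IsRegular.mem_visits]
  rw [hS.average_apply T n .univ, this]
  refine ENNReal.inv_mul_cancel ?_ (ENNReal.natCast_ne_top _)
  exact_mod_cast (hS.sample_nonempty T n).card_pos.ne'

lemma IsRegular.real_average (hS : S.IsRegular) (T : S.PuncturedHull) (n : ℕ)
    {C : Set S.PuncturedHull} (hC : MeasurableSet C) :
    (hS.average T n).real C = (hS.visits T n C).card / (hS.sample T n).card := by
  rw [Measure.real, hS.average_apply T n hC, ENNReal.toReal_mul, ENNReal.toReal_inv]
  simp [div_eq_inv_mul]

lemma IsRegular.eventually_average_le (hS : S.IsRegular) (T : S.PuncturedHull)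
    (v : EuclideanSpace ℝ (Fin d)) {C : Set S.PuncturedHull} (hC : C ⊆ S.shiftDomain v)
    (hCm : MeasurableSet C) (hCm' : MeasurableSet (shiftSet v C)) {δ : ℝ} (hδ : 0 < δ) :
    ∀ᶠ n in atTop, (hS.average T n).real C ≤ (hS.average T n).real (shiftSet v C) + δ := by
  obtain ⟨n₀, hn₀⟩ := S.exists_nearBoundary_small ‖v‖ hδ
  filter_upwards [eventually_ge_atTop n₀] with n hn
  have h1 : ((hS.visits T n C).card : ℝ) ≤ (hS.visits T n (shiftSet v C)).card +
      (S.nearBoundary n (hS.root n T).1 ‖v‖).ncard := by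
    exact_mod_cast hS.card_visits_le T n v hC
  have h2 := hn₀ n hn (hS.root n T).1
  rw [← hS.card_sample] at h2
  have h3 := hS.card_sample_pos T n
  rw [hS.real_average T n hCm, hS.real_average T n hCm', div_le_iff₀ h3, add_mul,
    div_mul_cancel₀ _ h3.ne']
  linarith

variable [BorelSpace S.PuncturedHull]

/-- A probability measure on the punctured hull that is invariant under translations of clopen
sets. -/
lemma IsRegular.exists_measure_clopen [Nonempty ι] (hS : S.IsRegular) :
    ∃ μ : Measure S.PuncturedHull, IsProbabilityMeasure μ ∧
      ∀ v, ∀ C, IsClopen C → C ⊆ S.shiftDomain v → μ C ≤ μ (shiftSet v C) := by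
  have := hS.compactSpace
  have := hS.t2Space
  have := hS.secondCountable
  obtain ⟨T⟩ := hS.nonempty
  let ν : ℕ → ProbabilityMeasure S.PuncturedHull := fun n =>
    ⟨hS.average T n, hS.isProbabilityMeasure_average T n⟩
  -- The space of probability measures is compact, so the averages converge weakly along an
  -- ultrafilter. Clopen sets have empty boundary, so their measures converge as well.
  let 𝒰 : Ultrafilter ℕ := Ultrafilter.of atTop
  obtain ⟨μ, -, hμ⟩ := isCompact_iff_ultrafilter_le_nhds.1
    (isCompact_univ (X := ProbabilityMeasure S.PuncturedHull)) (𝒰.map ν) (by simp)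
  have hlim : Tendsto ν 𝒰 (𝓝 μ) := hμ
  have hreal : ∀ C : Set S.PuncturedHull, IsClopen C →
      Tendsto (fun n => (hS.average T n).real C) 𝒰 (𝓝 ((μ : Measure S.PuncturedHull).real C)) := by
    intro C hC
    have h := ProbabilityMeasure.tendsto_measure_of_isClopen_of_tendsto hlim hC
    exact (NNReal.tendsto_coe.2 h)
  refine ⟨μ, inferInstance, fun v C hC hCv => ?_⟩
  have hC' := hS.isClopen_shiftSet v hC
  have hle : (μ : Measure S.PuncturedHull).real C ≤
      (μ : Measure S.PuncturedHull).real (shiftSet v C) := by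
    refine le_of_forall_pos_le_add fun δ hδ => ?_
    refine le_of_tendsto_of_tendsto (hreal C hC) ((hreal _ hC').add_const δ) ?_
    exact Ultrafilter.of_le _ (hS.eventually_average_le T v hCv hC.isOpen.measurableSet
      hC'.isOpen.measurableSet hδ)
  exact (ENNReal.toReal_le_toReal (measure_ne_top _ _) (measure_ne_top _ _)).1 hle

/-- A translation invariant probability measure on the punctured hull. -/
lemma IsRegular.exists_measure [Nonempty ι] (hS : S.IsRegular) :
    ∃ μ : Measure S.PuncturedHull, IsProbabilityMeasure μ ∧
      ∀ v, ∀ U, IsOpen U → U ⊆ S.shiftDomain v → μ (shiftSet v U) = μ U := by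
  obtain ⟨μ, hμ, hclopen⟩ := hS.exists_measure_clopen
  refine ⟨μ, hμ, ?_⟩
  -- An open set is the directed union of its countably many clopen subsets, which transfers the
  -- inequality. Applied again with `-v`, it becomes an equality.
  have hle : ∀ v, ∀ U, IsOpen U → U ⊆ S.shiftDomain v → μ U ≤ μ (shiftSet v U) := by
    intro v U hU hUv
    have := hS.compactSpace
    have := hS.t2Space
    have hsc := hS.secondCountable
    have := totallySeparatedSpace (S := S)
    have := TopologicalSpace.Clopens.countable_iff_secondCountable.2 hsc
    let κ := {C : TopologicalSpace.Clopens S.PuncturedHull // (C : Set S.PuncturedHull) ⊆ U}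
    have hcov : U = ⋃ C : κ, (C.1 : Set S.PuncturedHull) := by
      refine Subset.antisymm (fun T hT => ?_) (iUnion_subset fun C => C.2)
      obtain ⟨P, hP, hfin, hPU⟩ := isOpen_iff_cylinder.1 hU T hT
      exact mem_iUnion.2 ⟨⟨⟨_, isClopen_cylinder hfin⟩, hPU⟩, hP⟩
    have hdir : Directed (· ⊆ ·) fun C : κ => (C.1 : Set S.PuncturedHull) := fun C C' =>
      ⟨⟨C.1 ⊔ C'.1, union_subset C.2 C'.2⟩, subset_union_left, subset_union_right⟩
    rw [congrArg μ hcov, hdir.measure_iUnion]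
    refine iSup_le fun C => (hclopen v C.1 C.1.isClopen (C.2.trans hUv)).trans (measure_mono ?_)
    rintro T ⟨T', hT', h⟩
    exact ⟨T', C.2 hT', h⟩
  intro v U hU hUv
  refine le_antisymm ?_ (hle v U hU hUv)
  have := hle (-v) (shiftSet v U) (hS.isOpen_shiftSet v hU) (shiftSet_subset_domain v U)
  rwa [shiftSet_shiftSet hUv] at this

/-! ### Invariant measures for the semidirect product -/

variable {G : Subgroup (EuclideanSpace ℝ (Fin d) ≃ₗᵢ[ℝ] EuclideanSpace ℝ (Fin d))}
  [MulAction G ι]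

/-- A probability measure on the punctured hull invariant under translations and symmetries. -/
lemma IsRegular.exists_measure_symmetric [Nonempty ι] [Finite G] (hS : S.IsRegular)
    (hG : S.IsSymmetryGroup G) :
    ∃ μ : Measure S.PuncturedHull, IsProbabilityMeasure μ ∧
      (∀ v, ∀ U, IsOpen U → U ⊆ S.shiftDomain v → μ (shiftSet v U) = μ U) ∧
      ∀ (g : G) (U), IsOpen U → μ (actHull hG g ⁻¹' U) = μ U := by
  obtain ⟨μ, hμ, hinv⟩ := hS.exists_measure
  have := Fintype.ofFinite G
  -- Averaging over `G` keeps translation invariance, since the preimage under `g` of a translate by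
  -- `v` is the translate by `g⁻¹ v` of the preimage.
  let ν : Measure S.PuncturedHull :=
    (Fintype.card G : ENNReal)⁻¹ • ∑ g : G, μ.map (actHull hG g)
  have hν : ∀ U, IsOpen U →
      ν U = (Fintype.card G : ENNReal)⁻¹ * ∑ g : G, μ (actHull hG g ⁻¹' U) := by
    intro U hU
    rw [Measure.smul_apply, smul_eq_mul, Measure.finsetSum_apply]
    congr 1
    exact Finset.sum_congr rfl fun g _ =>
      Measure.map_apply (continuous_actHull hG g).measurable hU.measurableSet
  refine ⟨ν, ⟨?_⟩, fun v U hU hUv => ?_, fun h U hU => ?_⟩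
  · rw [hν _ isOpen_univ]
    simp only [preimage_univ, measure_univ, Finset.sum_const, Finset.card_univ, nsmul_eq_mul,
      mul_one]
    exact ENNReal.inv_mul_cancel (by simp) (ENNReal.natCast_ne_top _)
  · rw [hν _ hU, hν _ (hS.isOpen_shiftSet v hU)]
    congr 1
    refine Finset.sum_congr rfl fun g _ => ?_
    rw [preimage_actHull_shiftSet]
    exact hinv _ _ (hU.preimage (continuous_actHull hG g)) (preimage_actHull_subset_domain hG g hUv)
  · rw [hν _ hU, hν _ (hU.preimage (continuous_actHull hG h))]
    congr 1
    refine Fintype.sum_equiv (Equiv.mulLeft h) _ _ fun g => ?_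
    rw [Equiv.coe_mulLeft, map_mul, ← preimage_comp]
    rfl

/-- Partition the arrows by vector and group component. On one piece, the source of an open set is
the preimage under `g` of its range translated by `v`. -/
lemma IsRegular.isInvariantMeasure [Nonempty ι] [Finite G] (hS : S.IsRegular)
    (hG : S.IsSymmetryGroup G) {μ : Measure S.PuncturedHull}
    (hshift : ∀ v, ∀ U, IsOpen U → U ⊆ S.shiftDomain v → μ (shiftSet v U) = μ U)
    (hact : ∀ (g : G) (U), IsOpen U → μ (actHull hG g ⁻¹' U) = μ U) :
    (puncSemidirect hG).IsInvariantMeasure μ := by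
  let : TopologicalSpace G := ⊥
  have : DiscreteTopology G := ⟨rfl⟩
  have hE := (hS.isCantor_semidirect hG).toIsEtale
  have := hS.countable_vec.to_subtype
  refine SetGroupoid.isInvariantMeasure_of_partition hE μ
    (κ := {v : EuclideanSpace ℝ (Fin d) | ∃ γ : S.PuncArrow, γ.vec = v} × G)
    (fun k => {a | a.1.vec = k.1 ∧ a.2 = k.2}) (fun k => ?_) (fun k l hkl => ?_) ?_ ?_
  · have : IsOpen ({γ : S.PuncArrow | γ.vec = k.1} ×ˢ ({k.2} : Set G)) :=
      (hS.isClopen_vec_fiber _).isOpen.prod (isOpen_discrete _)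
    exact this
  · refine Set.disjoint_left.2 fun a ha ha' => hkl ?_
    exact Prod.ext (Subtype.ext (ha.1.symm.trans ha'.1)) (ha.2.symm.trans ha'.2)
  · exact eq_univ_of_forall fun a => mem_iUnion.2 ⟨(⟨a.1.vec, a.1, rfl⟩, a.2), rfl, rfl⟩
  · rintro ⟨⟨v, hv⟩, g⟩ V hVB hV
    set U := (puncSemidirect hG).r '' V
    have hU : IsOpen U := hE.isLocalHomeomorph_r.isOpenMap _ hV
    have hUv : U ⊆ S.shiftDomain v := by
      rintro _ ⟨a, ha, rfl⟩
      have h : a.1.vec = v := (hVB ha).1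
      exact h ▸ a.1.exists_mem
    have hs : (puncSemidirect hG).s '' V = actHull hG g ⁻¹' shiftSet v U := by
      ext T
      constructor
      · rintro ⟨a, ha, rfl⟩
        obtain ⟨h1, h2⟩ : a.1.vec = v ∧ a.2 = g := hVB ha
        refine ⟨a.1.1.1, ⟨a, ha, rfl⟩, ?_⟩
        change (actHull hG g (actHull hG a.2⁻¹ a.1.1.2)).1 = _
        rw [h2, ← h1, ← a.1.eq_translate]
        simp
      · rintro ⟨_, ⟨a, ha, rfl⟩, h⟩
        obtain ⟨h1, h2⟩ : a.1.vec = v ∧ a.2 = g := hVB ha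
        refine ⟨a, ha, ?_⟩
        change actHull hG a.2⁻¹ a.1.1.2 = T
        have h3 : actHull hG g T = a.1.1.2 := by
          refine Subtype.ext (h.trans ?_)
          rw [a.1.eq_translate, h1]
          rfl
        rw [h2, ← h3]
        simp
    rw [hs, hact g _ (hS.isOpen_shiftSet v hU), hshift v U hU hUv]

end SubstitutionSystem

/-! ### Full support and minimality. -/

namespace SubstitutionSystem

open MeasureTheory

variable {d : ℕ} {ι : Type*} {S : SubstitutionSystem d ι} [Finite ι]
  {G : Subgroup (EuclideanSpace ℝ (Fin d) ≃ₗᵢ[ℝ] EuclideanSpace ℝ (Fin d))} [MulAction G ι]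

/-- Translation invariant probability measures have full support. -/
lemma IsRegular.measure_pos [Nonempty ι] (hS : S.IsRegular) {_ : MeasurableSpace S.PuncturedHull}
    {μ : Measure S.PuncturedHull} [IsProbabilityMeasure μ]
    (hshift : ∀ v, ∀ U, IsOpen U → U ⊆ S.shiftDomain v → μ (shiftSet v U) = μ U)
    {V : Set S.PuncturedHull} (hV : IsOpen V) (hne : V.Nonempty) : 0 < μ V := by
  rw [pos_iff_ne_zero]
  intro h0
  -- Every orbit meets `V`, so countably many translates of parts of `V` cover the space, and they
  -- would all be null.
  have hcov : (univ : Set S.PuncturedHull) ⊆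
      ⋃ v ∈ {v : EuclideanSpace ℝ (Fin d) | ∃ γ : S.PuncArrow, γ.vec = v},
        shiftSet v (V ∩ S.shiftDomain v) := by
    intro T _
    obtain ⟨γ, rfl, hγ⟩ := hS.exists_arrow_mem T hV hne
    have hvec := hS.vec_inv γ
    refine mem_iUnion₂.2 ⟨_, ⟨S.puncGroupoid.inv γ, rfl⟩, γ.1.2, ⟨hγ, ?_⟩, ?_⟩
    · exact (S.puncGroupoid.inv γ).exists_mem
    · exact (S.puncGroupoid.inv γ).eq_translate
  have hnull : μ (⋃ v ∈ {v : EuclideanSpace ℝ (Fin d) | ∃ γ : S.PuncArrow, γ.vec = v},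
      shiftSet v (V ∩ S.shiftDomain v)) = 0 := by
    refine (measure_biUnion_null_iff hS.countable_vec).2 fun v _ => ?_
    rw [hshift v _ (hV.inter (isOpen_shiftDomain v)) inter_subset_right]
    exact measure_mono_null inter_subset_left h0
  have := measure_mono_null hcov hnull
  simp at this

/-- Every orbit is dense, so a nonempty closed invariant set is the whole unit space, and an
invariant measure of full support suffices. -/
lemma IsRegular.hasEnoughInvariantMeasures [Nonempty ι] [Finite G] (hS : S.IsRegular)
    (hG : S.IsSymmetryGroup G) : (puncSemidirect hG).HasEnoughInvariantMeasures := by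
  let : MeasurableSpace S.PuncturedHull := borel _
  have : BorelSpace S.PuncturedHull := ⟨rfl⟩
  intro E hE hinv V hV hne
  have hEuniv : E = univ := by
    by_contra hcon
    obtain ⟨T, -, hT⟩ := hne
    obtain ⟨γ, rfl, hγ⟩ := hS.exists_arrow_mem T hE.isOpen_compl (nonempty_compl.2 hcon)
    refine hγ (hinv (S.puncGroupoid.inv γ, 1) ?_)
    change actHull hG (1 : G)⁻¹ γ.1.1 ∈ E
    simpa using hT
  rw [hEuniv, inter_univ] at hne ⊢
  obtain ⟨μ, hμ, hshift, hact⟩ := hS.exists_measure_symmetric hG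
  exact ⟨μ, hμ, hS.isInvariantMeasure hG hshift hact, hS.measure_pos hshift hV hne⟩

end SubstitutionSystem

/-! ### The main theorem. -/

theorem mainTheorem1 {d : ℕ} {ι : Type*} [Finite ι] [Nonempty ι]
    (S : SubstitutionSystem d ι)
    (hprim : S.IsPrimitive) (hflc : S.HasFLC) (hinj : Set.InjOn S.omega S.hull)
    (hborder : S.ForcesBorder)
    (G : Subgroup (EuclideanSpace ℝ (Fin d) ≃ₗᵢ[ℝ] EuclideanSpace ℝ (Fin d))) [Finite G]
    [MulAction G ι] (hG : S.IsSymmetryGroup G)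
    (hfree : ∀ (g : G) (i : ι), g • i = i → g = 1) :
    (SubstitutionSystem.puncSemidirect hG).IsAlmostAFWith
      (SubstitutionSystem.afSemidirectArrows S G) := by
  have hS : S.IsRegular := ⟨hprim, hflc, hinj⟩
  have hC := hS.isCantor_semidirect hG
  refine ⟨hC, ?_, hS.isSubgroupoid_af hG, hS.isAF hG hfree,
    fun K hK hsub => hS.isThin_source hG hK hsub hC.continuous_s,
    hS.hasEnoughInvariantMeasures hG⟩
  rw [SubstitutionSystem.afSemidirectArrows_eq]
  exact isOpen_iUnion hS.isOpen_supertileSemidirectArrows
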